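/- **Theorem.** Let $\omega=(\omega_1,\dots,\omega_m)\in\mathbb R^m$, $\gamma_0\in\mathbb R$, $c_0>0$, $\sigma>0$ satisfy the Diophantine condition $$\left|\frac{\langle k,\omega\rangle\gamma_0}{2\pi}-j\right|\ge\frac{c_0}{|k|^{\sigma}}\qquad\text{for all }k\in\mathbb Z^m\setminus\{0\},\ j\in\mathbb Z,\qquad |k|=|k_1|+\dots+|k_m|.$$ Call a real function $h(\theta)$ *analytic quasi-periodic* if $h(\theta)=\sum_{j\in\mathbb Z^m}c_j e^{i\langle j,\omega\rangle\theta}$ with $\sum_j|c_j|e^{t|j|}<\infty$ for some $t>0$. Call a real function $h(\theta,r)$, defined for $\theta\in\mathbb R$ and small $|r|$, *analytic quasi-periodic near $r=0$* if $h(\theta,r)=\sum_{k\ge0}\sum_{j\in\mathbb Z^m}c_{kj}e^{i\langle j,\omega\rangle\theta}r^k$ for $|r|<\rho$, with $\sum_{k,j}|c_{kj}|e^{t|j|}\rho^k<\infty$ for some $t,\rho>0$. (These are the functions $H(\omega\theta)$, respectively $H(\omega\theta,r)$, with $H$ real analytic on the torus $\mathbb R^m/2\pi\mathbb Z^m$,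 respectively on its product with an interval around $0$.) Let $$M(\theta,r)=(\theta+\gamma_0+f(\theta,r),\ r+g(\theta,r)),$$ where $f,g$ are analytic quasi-periodic near $r=0$ and $f(\theta,0)=g(\theta,0)=0$. Suppose that $M$ is reversible with respect to $G(\theta,r)=(-\theta,r)$, that is, $GMG=M^{-1}$ (equivalently $MGM=G$) near $r=0$. Suppose also that there is a formal change of variables $$U:\ \theta=\xi+u(\xi,\eta),\quad r=\eta+v(\xi,\eta),\qquad u=\sum_{k\ge1}u_k(\xi)\eta^k,\quad v=\sum_{k\ge1}v_k(\xi)\eta^k,$$ where the series are formal power series in $\eta$, all $u_k,v_k$ are analytic quasi-periodic, and $1+v_1(\xi)\ne0$ for all $\xi\in\mathbb R$ (formal invertibility), such that $U^{-1}MU$ is the rotation $(\xi,\eta)\mapsto(\xi+\gamma_0,\eta)$, in the sense that $M(U(\xi,\eta))=U(\xi+\gamma_0,\eta)$ as formal power series in $\eta$ for every $\xi\in\mathbb R$ (with $f,g$ expanded in Taylor series at $(\xi,0)$). Then there is a convergent change of variables $$U:\ \theta=\xi+u(\xi,\eta),\quad r=\eta+v(\xi,\eta)$$ with $u,v$ analytic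 quasi-periodic near $\eta=0$ and $u(\xi,0)=v(\xi,0)=0$, which near $\eta=0$ has an inverse of the same form, such that, for all $\xi\in\mathbb R$ and all sufficiently small $|\eta|$ (uniformly in $\xi$), $$U^{-1}MU(\xi,\eta)=(\xi+\gamma_0,\eta),\qquad UG=GU.$$ In particular, for every sufficiently small $|\eta|$ the curve $\{U(\xi,\eta):\xi\in\mathbb R\}$ is invariant under $M$. -/

import Mathlib

noncomputable section

namespace QPReversible

/-- The order `|k| = |k₁| + ⋯ + |k_m|` of an integer vector. -/
def order {m : ℕ} (k : Fin m → ℤ) : ℝ := ∑ i, |(k i : ℝ)|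

/-- The pairing `⟨k, ω⟩ = k₁ω₁ + ⋯ + k_mω_m`. -/
def pairing {m : ℕ} (k : Fin m → ℤ) (ω : Fin m → ℝ) : ℝ := ∑ i, (k i : ℝ) * ω i

/-- The Diophantine condition `|⟨k, ω⟩ γ₀ / (2π) - j| ≥ c₀ / |k|^σ` for all `k ∈ ℤ^m \ {0}` and
`j ∈ ℤ`. -/
def IsDiophantine {m : ℕ} (ω : Fin m → ℝ) (γ₀ c₀ σ : ℝ) : Prop :=
  ∀ k : Fin m → ℤ, k ≠ 0 → ∀ j : ℤ,
    c₀ / order k ^ σ ≤ |pairing k ω * γ₀ / (2 * Real.pi) - (j : ℝ)|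

/-- The mode `θ ↦ exp (i ⟨j, ω⟩ θ)`. -/
def mode {m : ℕ} (ω : Fin m → ℝ) (j : Fin m → ℤ) (θ : ℝ) : ℂ :=
  Complex.exp (Complex.I * ((pairing j ω * θ : ℝ) : ℂ))

/-- `h : ℝ → ℝ` is real analytic and quasi-periodic with frequency `ω`: it is the sum of a series
`∑ⱼ cⱼ exp (i ⟨j, ω⟩ θ)` whose coefficients are exponentially small. Equivalently
`h θ = H (ω θ)` where `H` is real analytic on the torus `ℝ^m / (2πℤ)^m`; the series of `H`
converges absolutely on the complex strip `|Im φᵢ| ≤ t`. -/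
def IsQPAnalyticFun {m : ℕ} (ω : Fin m → ℝ) (h : ℝ → ℝ) : Prop :=
  ∃ t : ℝ, 0 < t ∧ ∃ c : (Fin m → ℤ) → ℂ,
    Summable (fun j => ‖c j‖ * Real.exp (t * order j)) ∧
    ∀ θ : ℝ, HasSum (fun j => c j * mode ω j θ) ((h θ : ℝ) : ℂ)

/-- `f (θ, r)` is real analytic in a neighbourhood of `r = 0` and quasi-periodic in `θ` with
frequency `ω`: for `|r| < ρ` it is the sum of a series `∑ₖ ∑ⱼ cₖⱼ exp (i ⟨j, ω⟩ θ) rᵏ`.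
Equivalently `f (θ, r) = F (ω θ, r)` for small `|r|`, where `F` is real analytic on the product of
the torus with an interval around `0`; the series of `F` converges absolutely for
`|Im φᵢ| ≤ t`, `|r| ≤ ρ`. Values of `f` at large `|r|` are irrelevant. -/
def IsQPAnalytic {m : ℕ} (ω : Fin m → ℝ) (f : ℝ → ℝ → ℝ) : Prop :=
  ∃ t : ℝ, 0 < t ∧ ∃ ρ : ℝ, 0 < ρ ∧ ∃ c : ℕ → (Fin m → ℤ) → ℂ,
    Summable (fun p : ℕ × (Fin m → ℤ) => ‖c p.1 p.2‖ * Real.exp (t * order p.2) * ρ ^ p.1) ∧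
    ∀ θ r : ℝ, |r| < ρ →
      HasSum (fun p : ℕ × (Fin m → ℤ) => c p.1 p.2 * mode ω p.2 θ * (r : ℂ) ^ p.1)
        ((f θ r : ℝ) : ℂ)

/-- The map `I + (u, v) : (ξ, η) ↦ (ξ + u (ξ, η), η + v (ξ, η))`. -/
def nearIdentity (u v : ℝ → ℝ → ℝ) (p : ℝ × ℝ) : ℝ × ℝ :=
  (p.1 + u p.1 p.2, p.2 + v p.1 p.2)

/-- The map `M : (θ, r) ↦ (θ + γ₀ + f (θ, r), r + g (θ, r))`. -/
def mapM (γ₀ : ℝ) (f g : ℝ → ℝ → ℝ) (p : ℝ × ℝ) : ℝ × ℝ :=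
  (p.1 + γ₀ + f p.1 p.2, p.2 + g p.1 p.2)

/-- The rotation `I + β : (ξ, η) ↦ (ξ + γ₀, η)`. -/
def rotation (γ₀ : ℝ) (p : ℝ × ℝ) : ℝ × ℝ := (p.1 + γ₀, p.2)

/-- The involution `G : (θ, r) ↦ (-θ, r)`. -/
def involution (p : ℝ × ℝ) : ℝ × ℝ := (-p.1, p.2)

/-- `M` is reversible with respect to `G` near `r = 0`: `G ∘ M ∘ G` is a two-sided inverse of `M`
(each of the two identities says `M ∘ G ∘ M = G`). -/
def IsReversible (M : ℝ × ℝ → ℝ × ℝ) : Prop :=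
  ∃ δ : ℝ, 0 < δ ∧ ∀ θ r : ℝ, |r| < δ → M (involution (M (θ, r))) = involution (θ, r)

/-- The formal series `∑ₖ uₖ(ξ) ηᵏ`, at a fixed `ξ`, as a power series in `η`. -/
def seriesAt (u : ℕ → ℝ → ℝ) (ξ : ℝ) : PowerSeries ℝ := PowerSeries.mk fun k => u k ξ

/-- The Taylor coefficient of `f` at the point `(ξ, 0)`: the coefficient of `(θ - ξ)ⁿ rᵏ`. -/
def taylorCoeff (f : ℝ → ℝ → ℝ) (ξ : ℝ) (n k : ℕ) : ℝ :=
  iteratedDeriv n (fun θ => iteratedDeriv k (fun r => f θ r) 0) ξ / (n.factorial * k.factorial)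

/-- The formal composition `f (ξ + u (ξ, η), η + v (ξ, η))`, at a fixed `ξ`, as a power series in
`η`. It is the series `∑ₙ ∑ₖ aₙₖ(ξ) uⁿ (η + v)ᵏ` with `aₙₖ(ξ)` the Taylor coefficients of `f` at
`(ξ, 0)`. When `u` and `v` have no term of degree zero in `η`, only the terms with `n, k ≤ N`
contribute to the coefficient of `ηᴺ`. -/
def formalComp (f : ℝ → ℝ → ℝ) (u v : ℕ → ℝ → ℝ) (ξ : ℝ) : PowerSeries ℝ :=
  PowerSeries.mk fun N =>
    ∑ n ∈ Finset.range (N + 1), ∑ k ∈ Finset.range (N + 1),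
      taylorCoeff f ξ n k *
        PowerSeries.coeff N (seriesAt u ξ ^ n * (PowerSeries.X + seriesAt v ξ) ^ k)

/-- `u = ∑_{k ≥ 1} uₖ(ξ) ηᵏ` is a formal power series in `η`, without constant term and without any
convergence condition, whose coefficients are real analytic quasi-periodic functions of `ξ` with
frequency `ω`. -/
def IsFormalQPSeries {m : ℕ} (ω : Fin m → ℝ) (u : ℕ → ℝ → ℝ) : Prop :=
  (∀ ξ, u 0 ξ = 0) ∧ ∀ k, IsQPAnalyticFun ω (u k)

/-- `U : θ = ξ + u (ξ, η), r = η + v (ξ, η)` is a formal change of variables: `u`, `v` are formal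
quasi-periodic series and `U` is formally invertible, which means that the linear part
`(1 + v₁(ξ)) η` of its second component never degenerates. -/
def IsFormalChange {m : ℕ} (ω : Fin m → ℝ) (u v : ℕ → ℝ → ℝ) : Prop :=
  IsFormalQPSeries ω u ∧ IsFormalQPSeries ω v ∧ ∀ ξ, 1 + v 1 ξ ≠ 0

/-- The formal change of variables `U` transforms `M` into the rotation: `M ∘ U = U ∘ (I + β)` as
formal power series in `η`, for every `ξ`. -/
def FormallyLinearizes (γ₀ : ℝ) (f g : ℝ → ℝ → ℝ) (u v : ℕ → ℝ → ℝ) : Prop :=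
  ∀ ξ : ℝ,
    PowerSeries.C ξ + seriesAt u ξ + PowerSeries.C γ₀ + formalComp f u v ξ =
        PowerSeries.C (ξ + γ₀) + seriesAt u (ξ + γ₀) ∧
    PowerSeries.X + seriesAt v ξ + formalComp g u v ξ =
        PowerSeries.X + seriesAt v (ξ + γ₀)

/-- `I + (u, v)` is a germ at `η = 0` of a real analytic quasi-periodic map that fixes every point
of the curve `η = 0`. -/
def IsAnalyticQPPair {m : ℕ} (ω : Fin m → ℝ) (u v : ℝ → ℝ → ℝ) : Prop :=
  IsQPAnalytic ω u ∧ IsQPAnalytic ω v ∧ ∀ ξ, u ξ 0 = 0 ∧ v ξ 0 = 0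

end QPReversible

end

/-! Write `R` for the rotation and `E = M ∘ U - U ∘ R` for the defect of a map `U = I + (u, v)`. The
formal series need not converge. Its truncations, however, are analytic maps `P` for which `M ∘ P -
P ∘ R` has any prescribed order in `η` (`FormallyLinearizes.isBigO`). A true conjugacy is built from
them by a Newton iteration with small divisors.

Correct `U` by `DU · Y`. Differentiating `M ∘ U = U ∘ R + E` gives `DM(U) · DU = DU ∘ R + DE`. The
new defect is therefore `E - (DU ∘ R)(Y ∘ R - Y)` plus a Taylor remainder and the term `DE · Y`,
which are both quadratic (`defect_newton`). With `B = (DU ∘ R)⁻¹ E` one solves `Y ∘ R - Y = B -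
[B]`, where `[B]` is the mean; the Diophantine condition controls the loss of analyticity
(`RRep.homological`).

The obstruction is `[B]`, and it is here that formal linearizability enters. If `E = O(η ^ s)`,
comparison of `U` with a truncation `P` of high order shows that `B` is a coboundary up to `O(η ^
(2s - 1))` (`exists_near_coboundary`), so `[B]` has that order (`mean_ordU`). Shrinking the radius
by a factor `θ` then multiplies `[B]` by `θ ^ (2s - 1)`. Since `s` nearly doubles at each step, the
radii can stay bounded below while every step gains a fixed factor (`Approx.step`,
`exists_conjugacy_of_small`). All sizes are weighted `ℓ¹` norms of Fourier-Taylor coefficients,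
which make composition, derivatives and remainders explicit (`Rep.exists_taylor`).

The iteration starts from perturbations that are small and of order two. Order two comes from a
preliminary conjugation by the first truncation, smallness from a dilation in `η`. Inverting
truncations requires `1 + v₁` to be bounded away from zero and to have a quasi-periodic inverse. The
linear part of the conjugacy bounds the growth of `1 + v₁` along orbits, so an infimum equal to zero
would make all its Fourier coefficients vanish (`exists_lower_bound`, `exists_inverse`).

Reversibility gives the symmetry at the end. A conjugacy may be composed with maps commuting with
`R`, and is so normalized to be the identity on `ξ = 0`, the fixed set of `G`. Then `UG = GU` holds
along the orbit of `ξ = 0`, by induction from `GMG = M⁻¹`, and a quasi-periodic function that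
vanishes on this orbit vanishes (`QPDiffeo.normalize`, `commute_involution`). -/

noncomputable section

/-! ### Weighted algebras of Fourier-Taylor series. -/

namespace QPReversible

open Filter Topology Asymptotics

variable {m : ℕ} {ω : Fin m → ℝ}

/-! ### Modes and weights -/

theorem order_nonneg (k : Fin m → ℤ) : 0 ≤ order k := Finset.sum_nonneg fun _ _ => abs_nonneg _

theorem order_add_le (k l : Fin m → ℤ) : order (k + l) ≤ order k + order l := by
  unfold order
  rw [← Finset.sum_add_distrib]
  refine Finset.sum_le_sum fun i _ => ?_
  simpa using abs_add_le (k i : ℝ) (l i)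

theorem order_neg (k : Fin m → ℤ) : order (-k) = order k := by
  simp [order]

theorem order_zero : order (0 : Fin m → ℤ) = 0 := by simp [order]

theorem one_le_order {k : Fin m → ℤ} (hk : k ≠ 0) : 1 ≤ order k := by
  obtain ⟨i, hi⟩ := Function.ne_iff.1 hk
  have h1 : (1 : ℝ) ≤ |(k i : ℝ)| := by
    have : (1 : ℤ) ≤ |k i| := Int.one_le_abs hi
    exact_mod_cast this
  exact h1.trans (Finset.single_le_sum (f := fun i => |(k i : ℝ)|)
    (fun _ _ => abs_nonneg _) (Finset.mem_univ i))

theorem pairing_add (k l : Fin m → ℤ) : pairing (k + l) ω = pairing k ω + pairing l ω := by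
  simp [pairing, add_mul, Finset.sum_add_distrib]

theorem pairing_neg (k : Fin m → ℤ) : pairing (-k) ω = -pairing k ω := by
  simp [pairing]

theorem pairing_zero : pairing (0 : Fin m → ℤ) ω = 0 := by simp [pairing]

/-- A positive constant that bounds the frequencies. -/
def freqBound (ω : Fin m → ℝ) : ℝ := ∑ i, |ω i| + 1

theorem freqBound_pos : 0 < freqBound ω := by
  have : 0 ≤ ∑ i, |ω i| := Finset.sum_nonneg fun _ _ => abs_nonneg _
  unfold freqBound; linarith

theorem abs_pairing_le (k : Fin m → ℤ) : |pairing k ω| ≤ freqBound ω * order k := by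
  unfold pairing order
  rw [Finset.mul_sum]
  refine (Finset.abs_sum_le_sum_abs _ _).trans (Finset.sum_le_sum fun i _ => ?_)
  rw [abs_mul, mul_comm]
  refine mul_le_mul_of_nonneg_right ?_ (abs_nonneg _)
  have := Finset.single_le_sum (f := fun i => |ω i|) (fun _ _ => abs_nonneg _) (Finset.mem_univ i)
  unfold freqBound; linarith

theorem mode_zero (θ : ℝ) : mode ω 0 θ = 1 := by simp [mode, pairing_zero]

theorem mode_add (k l : Fin m → ℤ) (θ : ℝ) : mode ω (k + l) θ = mode ω k θ * mode ω l θ := by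
  simp only [mode, pairing_add, ← Complex.exp_add]; congr 1; push_cast; ring

theorem mode_apply_add (k : Fin m → ℤ) (θ x : ℝ) :
    mode ω k (θ + x) = mode ω k θ * mode ω k x := by
  simp only [mode, ← Complex.exp_add]; congr 1; push_cast; ring

theorem norm_mode (k : Fin m → ℤ) (θ : ℝ) : ‖mode ω k θ‖ = 1 := by
  simp only [mode]; rw [mul_comm]; exact Complex.norm_exp_ofReal_mul_I _

theorem conj_mode (k : Fin m → ℤ) (θ : ℝ) :
    (starRingEnd ℂ) (mode ω k θ) = mode ω (-k) θ := by
  simp only [mode, ← Complex.exp_conj, pairing_neg]; congr 1; simp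

theorem mode_apply_nat_mul (k : Fin m → ℤ) (γ : ℝ) (n : ℕ) :
    mode ω k (n * γ) = mode ω k γ ^ n := by
  simp only [mode, ← Complex.exp_nat_mul]; congr 1; push_cast; ring

/-- The weight `exp (t |j|) ρᵏ` of the index `(k, j)`. -/
def weight (t ρ : ℝ) (p : ℕ × (Fin m → ℤ)) : ℝ := Real.exp (t * order p.2) * ρ ^ p.1

/-- The basic function `exp (i ⟨j, ω⟩ θ) rᵏ` of the index `(k, j)`. -/
def basic (ω : Fin m → ℝ) (θ r : ℝ) (p : ℕ × (Fin m → ℤ)) : ℂ := mode ω p.2 θ * (r : ℂ) ^ p.1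

theorem weight_nonneg {t ρ : ℝ} (hρ : 0 ≤ ρ) (p : ℕ × (Fin m → ℤ)) : 0 ≤ weight t ρ p := by
  unfold weight; positivity

theorem weight_pos {t ρ : ℝ} (hρ : 0 < ρ) (p : ℕ × (Fin m → ℤ)) : 0 < weight t ρ p := by
  unfold weight; positivity

/-- Submultiplicative weights make the weighted `ℓ¹` space an algebra under convolution; `Rep.mul`
rests on this. -/
theorem weight_add_le {t ρ : ℝ} (ht : 0 ≤ t) (hρ : 0 ≤ ρ) (p q : ℕ × (Fin m → ℤ)) :
    weight t ρ (p + q) ≤ weight t ρ p * weight t ρ q := by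
  unfold weight
  have h : Real.exp (t * order (p + q).2) ≤ Real.exp (t * order p.2) * Real.exp (t * order q.2) := by
    rw [← Real.exp_add, ← mul_add]
    exact Real.exp_le_exp.2 (mul_le_mul_of_nonneg_left (order_add_le _ _) ht)
  calc _ ≤ (Real.exp (t * order p.2) * Real.exp (t * order q.2)) * ρ ^ (p + q).1 :=
        mul_le_mul_of_nonneg_right h (by positivity)
    _ = _ := by simp only [Prod.fst_add, pow_add]; ring

theorem basic_add (θ r : ℝ) (p q : ℕ × (Fin m → ℤ)) :
    basic ω θ r (p + q) = basic ω θ r p * basic ω θ r q := by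
  simp only [basic, Prod.fst_add, Prod.snd_add, mode_add, pow_add]; ring

theorem norm_basic_le {t ρ θ r : ℝ} (ht : 0 ≤ t) (hr : |r| ≤ ρ) (p : ℕ × (Fin m → ℤ)) :
    ‖basic ω θ r p‖ ≤ weight t ρ p := by
  simp only [basic, weight, norm_mul, norm_mode, norm_pow, Complex.norm_real, Real.norm_eq_abs]
  exact mul_le_mul (Real.one_le_exp (mul_nonneg ht (order_nonneg _)))
    (pow_le_pow_left₀ (abs_nonneg _) hr _) (by positivity) (by positivity)

/-! ### Functions with a weighted absolutely convergent series -/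

/-- `h` is, for `|r| < ρ`, the sum of a series with coefficients `c`, which vanish in degree `< s`
in `r`, and whose weighted norm is at most `K`. -/
structure HasCoeffs (ω : Fin m → ℝ) (s : ℕ) (t ρ K : ℝ) (h : ℝ → ℝ → ℂ)
    (c : ℕ × (Fin m → ℤ) → ℂ) : Prop where
  low : ∀ p, p.1 < s → c p = 0
  summable : Summable fun p => ‖c p‖ * weight t ρ p
  le : ∑' p, ‖c p‖ * weight t ρ p ≤ K
  hasSum : ∀ θ r : ℝ, |r| < ρ → HasSum (fun p => c p * basic ω θ r p) (h θ r)

/-- `h` has a series with weighted norm at most `K`, divisible by `r ^ s`. -/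
def Rep (ω : Fin m → ℝ) (s : ℕ) (t ρ K : ℝ) (h : ℝ → ℝ → ℂ) : Prop :=
  ∃ c, HasCoeffs ω s t ρ K h c

variable {s : ℕ} {t ρ K : ℝ} {h h₁ h₂ : ℝ → ℝ → ℂ}

theorem summable_mul_basic {c : ℕ × (Fin m → ℤ) → ℂ} (ht : 0 ≤ t)
    (hc : Summable fun p => ‖c p‖ * weight t ρ p) (θ : ℝ) {r : ℝ} (hr : |r| ≤ ρ) :
    Summable fun p => c p * basic ω θ r p := by
  refine Summable.of_norm_bounded hc fun p => ?_
  rw [norm_mul]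
  exact mul_le_mul_of_nonneg_left (norm_basic_le ht hr p) (norm_nonneg _)

theorem Rep.nonneg (hρ : 0 ≤ ρ) (hh : Rep ω s t ρ K h) : 0 ≤ K := by
  obtain ⟨c, hc⟩ := hh
  exact (tsum_nonneg fun p => mul_nonneg (norm_nonneg _) (weight_nonneg hρ p)).trans hc.le

theorem Rep.congr (hh : Rep ω s t ρ K h₁) (h12 : ∀ θ r : ℝ, |r| < ρ → h₂ θ r = h₁ θ r) :
    Rep ω s t ρ K h₂ := by
  obtain ⟨c, hc⟩ := hh
  exact ⟨c, hc.low, hc.summable, hc.le, fun θ r hr => by rw [h12 θ r hr]; exact hc.hasSum θ r hr⟩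

theorem Rep.norm_le (ht : 0 ≤ t) (hh : Rep ω s t ρ K h) (θ : ℝ) {r : ℝ} (hr : |r| < ρ) :
    ‖h θ r‖ ≤ K := by
  obtain ⟨c, hc⟩ := hh
  rw [← (hc.hasSum θ r hr).tsum_eq]
  refine (tsum_of_norm_bounded hc.summable.hasSum fun p => ?_).trans hc.le
  rw [norm_mul]
  exact mul_le_mul_of_nonneg_left (norm_basic_le ht hr.le p) (norm_nonneg _)

theorem weight_mono {t' ρ' : ℝ} (htt : t' ≤ t) (hρ' : 0 ≤ ρ') (hρρ : ρ' ≤ ρ)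
    (p : ℕ × (Fin m → ℤ)) : weight t' ρ' p ≤ weight t ρ p := by
  unfold weight
  exact mul_le_mul (Real.exp_le_exp.2 (mul_le_mul_of_nonneg_right htt (order_nonneg _)))
    (pow_le_pow_left₀ hρ' hρρ _) (by positivity) (by positivity)

/-- Domination of coefficients, term by term. -/
theorem HasCoeffs.of_le {s' : ℕ} {t' ρ' C : ℝ} {h' : ℝ → ℝ → ℂ} {c c' : ℕ × (Fin m → ℤ) → ℂ}
    (hc : HasCoeffs ω s t ρ K h c) (ht' : 0 ≤ t') (hρ' : 0 ≤ ρ')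
    (hlow : ∀ p, p.1 < s' → c' p = 0) (hC : 0 ≤ C)
    (hle : ∀ p, ‖c' p‖ * weight t' ρ' p ≤ C * (‖c p‖ * weight t ρ p))
    (hsum : ∀ θ r : ℝ, |r| < ρ' → Summable (fun p => c' p * basic ω θ r p) →
      HasSum (fun p => c' p * basic ω θ r p) (h' θ r)) :
    HasCoeffs ω s' t' ρ' (C * K) h' c' := by
  have hs : Summable fun p => ‖c' p‖ * weight t' ρ' p :=
    Summable.of_nonneg_of_le (fun p => mul_nonneg (norm_nonneg _) (weight_nonneg hρ' p)) hle
      (hc.summable.mul_left C)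
  refine ⟨hlow, hs, ?_, fun θ r hr => hsum θ r hr (summable_mul_basic ht' hs θ hr.le)⟩
  calc _ ≤ ∑' p, C * (‖c p‖ * weight t ρ p) := hs.tsum_le_tsum hle (hc.summable.mul_left C)
    _ = C * ∑' p, ‖c p‖ * weight t ρ p := tsum_mul_left
    _ ≤ C * K := mul_le_mul_of_nonneg_left hc.le hC

theorem Rep.mono {s' : ℕ} {t' ρ' K' : ℝ} (hh : Rep ω s t ρ K h) (hs : s' ≤ s) (ht' : 0 ≤ t')
    (htt : t' ≤ t) (hρ' : 0 ≤ ρ') (hρρ : ρ' ≤ ρ) (hK : K ≤ K') : Rep ω s' t' ρ' K' h := by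
  obtain ⟨c, hc⟩ := hh
  have := hc.of_le (h' := h) (c' := c) (s' := s') ht' hρ' (fun p hp => hc.low p (by omega))
    zero_le_one (fun p => by
      rw [one_mul]
      exact mul_le_mul_of_nonneg_left (weight_mono htt hρ' hρρ p) (norm_nonneg _))
    (fun θ r hr _ => hc.hasSum θ r (hr.trans_le hρρ))
  exact ⟨c, this.low, this.summable, this.le.trans (by linarith), this.hasSum⟩

theorem Rep.mono_const {K' : ℝ} (hh : Rep ω s t ρ K h) (hK : K ≤ K') : Rep ω s t ρ K' h := by
  obtain ⟨c, hc⟩ := hh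
  exact ⟨c, hc.low, hc.summable, hc.le.trans hK, hc.hasSum⟩

theorem Rep.mono_order {s' : ℕ} (hh : Rep ω s t ρ K h) (hs : s' ≤ s) : Rep ω s' t ρ K h := by
  obtain ⟨c, hc⟩ := hh
  exact ⟨c, fun p hp => hc.low p (by omega), hc.summable, hc.le, hc.hasSum⟩

/-- A function divisible by `r ^ s` gains a factor when the radius shrinks. -/
theorem Rep.shrink {ρ' q : ℝ} (hh : Rep ω s t ρ K h) (ht : 0 ≤ t) (hρ' : 0 ≤ ρ') (hρ : 0 ≤ ρ)
    (hq : q ≤ 1) (hq0 : 0 ≤ q) (hρρ : ρ' ≤ q * ρ) : Rep ω s t ρ' (q ^ s * K) h := by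
  obtain ⟨c, hc⟩ := hh
  refine ⟨c, hc.of_le ht hρ' hc.low (by positivity) (fun p => ?_)
    (fun θ r hr _ => hc.hasSum θ r (hr.trans_le (hρρ.trans (mul_le_of_le_one_left hρ hq))))⟩
  by_cases hp : p.1 < s
  · simp [hc.low p hp]
  · have h1 : ρ' ^ p.1 ≤ q ^ s * ρ ^ p.1 := by
      calc ρ' ^ p.1 ≤ (q * ρ) ^ p.1 := pow_le_pow_left₀ hρ' hρρ _
        _ = q ^ p.1 * ρ ^ p.1 := mul_pow _ _ _
        _ ≤ q ^ s * ρ ^ p.1 := mul_le_mul_of_nonneg_right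
          (pow_le_pow_of_le_one hq0 hq (by omega)) (by positivity)
    calc ‖c p‖ * weight t ρ' p = ‖c p‖ * Real.exp (t * order p.2) * ρ' ^ p.1 := by
          unfold weight; ring
      _ ≤ ‖c p‖ * Real.exp (t * order p.2) * (q ^ s * ρ ^ p.1) :=
          mul_le_mul_of_nonneg_left h1 (by positivity)
      _ = _ := by unfold weight; ring

/-- A monomial. -/
theorem Rep.monomial (c : ℂ) (k : ℕ) (j : Fin m → ℤ) (hs : k < s → c = 0) :
    Rep ω s t ρ (‖c‖ * weight t ρ (k, j)) (fun θ r => c * (mode ω j θ * (r : ℂ) ^ k)) := by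
  classical
  have key : ∀ p, p ≠ (k, j) → (Pi.single (k, j) c : ℕ × (Fin m → ℤ) → ℂ) p = 0 := fun p hp => by
    rw [Pi.single_eq_of_ne hp]
  refine ⟨Pi.single (k, j) c, ?_, ?_, ?_, ?_⟩
  · intro p hp
    by_cases hpk : p = (k, j)
    · subst hpk; rw [Pi.single_eq_same]; exact hs hp
    · exact key p hpk
  · refine summable_of_ne_finset_zero (s := {(k, j)}) fun p hp => ?_
    rw [key p (by simpa using hp)]; simp
  · rw [tsum_eq_single (k, j) fun p hp => by rw [key p hp]; simp]
    simp
  · intro θ r _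
    convert hasSum_single (k, j) (f := fun p => (Pi.single (k, j) c : ℕ × (Fin m → ℤ) → ℂ) p *
      basic ω θ r p) (fun p hp => by rw [key p hp]; simp) using 1
    simp [basic]

theorem Rep.const (c : ℂ) : Rep ω 0 t ρ ‖c‖ (fun _ _ => c) := by
  have := Rep.monomial (ω := ω) (s := 0) (t := t) (ρ := ρ) c 0 0 (by simp)
  exact (this.mono_const (by simp [weight, order_zero])).congr fun θ r _ => by simp [mode_zero]

theorem Rep.zero : Rep ω s t ρ 0 (fun _ _ => 0) := by
  have := Rep.monomial (ω := ω) (s := s) (t := t) (ρ := ρ) 0 0 0 (by simp)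
  exact (this.mono_const (by simp)).congr fun θ r _ => by simp

theorem Rep.snd : Rep ω 1 t ρ ρ (fun _ r => (r : ℂ)) := by
  have := Rep.monomial (ω := ω) (s := 1) (t := t) (ρ := ρ) 1 1 0 (by simp)
  exact (this.mono_const (by simp [weight, order_zero])).congr fun θ r _ => by simp [mode_zero]

/-- Countable sums. -/
theorem Rep.hasSum {β : Type*} {H : β → ℝ → ℝ → ℂ} {κ : β → ℝ} (ht : 0 ≤ t) (hρ : 0 ≤ ρ)
    (hκ : Summable κ) (hH : ∀ b, Rep ω s t ρ (κ b) (H b))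
    (hs : ∀ θ r : ℝ, |r| < ρ → HasSum (fun b => H b θ r) (h θ r)) :
    Rep ω s t ρ (∑' b, κ b) h := by
  choose c hc using hH
  have hnn : ∀ b p, 0 ≤ ‖c b p‖ * weight t ρ p := fun b p =>
    mul_nonneg (norm_nonneg _) (weight_nonneg hρ p)
  have hsum : Summable fun x : β × (ℕ × (Fin m → ℤ)) => ‖c x.1 x.2‖ * weight t ρ x.2 := by
    refine (summable_prod_of_nonneg fun x => hnn x.1 x.2).2 ⟨fun b => (hc b).summable, ?_⟩
    exact Summable.of_nonneg_of_le (fun b => tsum_nonneg (hnn b)) (fun b => (hc b).le) hκ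
  have hsum' : Summable fun x : (ℕ × (Fin m → ℤ)) × β => ‖c x.2 x.1‖ * weight t ρ x.1 :=
    (Equiv.prodComm _ _).summable_iff.1 (by simpa [Function.comp_def] using hsum)
  have hw : ρ = 0 ∨ 0 < ρ := by rcases hρ.eq_or_lt with h0 | h0 <;> simp [*]
  -- For `ρ = 0` no `r` satisfies `|r| < ρ`, so zero coefficients serve. This case is separated
  -- because the weights may vanish and are inverted below.
  rcases hw with h0 | hpos
  · refine ⟨0, by simp, by simp, ?_, ?_⟩
    · have : ∀ b, 0 ≤ κ b := fun b => Rep.nonneg hρ ⟨_, hc b⟩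
      simpa using tsum_nonneg this
    · intro θ r hr; rw [h0] at hr; exact absurd hr (by simp)
  have hcs : ∀ p, Summable fun b => ‖c b p‖ := fun p => by
    have := (hsum'.prod_factor p).mul_right (weight t ρ p)⁻¹
    refine this.congr fun b => ?_
    have := (weight_pos (t := t) hpos p).ne'
    field_simp
  have hle : ∀ p, ‖∑' b, c b p‖ * weight t ρ p ≤ ∑' b, ‖c b p‖ * weight t ρ p := fun p => by
    rw [tsum_mul_right]
    exact mul_le_mul_of_nonneg_right (norm_tsum_le_tsum_norm (hcs p)) (weight_nonneg hρ p)
  have hS := ((summable_prod_of_nonneg fun x => hnn x.2 x.1).1 hsum').2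
  have hS2 : Summable fun p => ‖∑' b, c b p‖ * weight t ρ p := Summable.of_nonneg_of_le
    (fun p => mul_nonneg (norm_nonneg _) (weight_nonneg hρ p)) hle hS
  refine ⟨fun p => ∑' b, c b p, fun p hp => ?_, hS2, ?_, fun θ r hr => ?_⟩
  · simp [(hc _).low p hp]
  · calc _ ≤ ∑' p, ∑' b, ‖c b p‖ * weight t ρ p := hS2.tsum_le_tsum hle hS
      _ = ∑' b, ∑' p, ‖c b p‖ * weight t ρ p := hsum.tsum_comm
      _ ≤ ∑' b, κ b := by
          refine Summable.tsum_le_tsum (fun b => (hc b).le) ?_ hκ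
          exact ((summable_prod_of_nonneg fun x => hnn x.1 x.2).1 hsum).2
  · have hsum3 : Summable fun x : β × (ℕ × (Fin m → ℤ)) => c x.1 x.2 * basic ω θ r x.2 := by
      refine Summable.of_norm_bounded hsum fun x => ?_
      rw [norm_mul]
      exact mul_le_mul_of_nonneg_left (norm_basic_le ht hr.le _) (norm_nonneg _)
    have h1 : HasSum (fun x : β × (ℕ × (Fin m → ℤ)) => c x.1 x.2 * basic ω θ r x.2) (h θ r) := by
      have := hsum3.hasSum.prod_fiberwise fun b => (hc b).hasSum θ r hr
      rw [(hs θ r hr).unique this]; exact hsum3.hasSum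
    have h2 : HasSum (fun x : (ℕ × (Fin m → ℤ)) × β => c x.2 x.1 * basic ω θ r x.1) (h θ r) :=
      (Equiv.prodComm _ _).hasSum_iff.1 (by simpa [Function.comp_def] using h1)
    have h3 : ∀ p, HasSum (fun b => c b p * basic ω θ r p) ((∑' b, c b p) * basic ω θ r p) :=
      fun p => (hcs p).of_norm.hasSum.mul_right _
    exact HasSum.prod_fiberwise (f := fun x : (ℕ × (Fin m → ℤ)) × β =>
      c x.2 x.1 * basic ω θ r x.1) h2 h3

theorem Rep.add {K₁ K₂ : ℝ} (ht : 0 ≤ t) (hρ : 0 ≤ ρ) (hh₁ : Rep ω s t ρ K₁ h₁)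
    (hh₂ : Rep ω s t ρ K₂ h₂) : Rep ω s t ρ (K₁ + K₂) (fun θ r => h₁ θ r + h₂ θ r) := by
  have := Rep.hasSum (β := Bool) (H := fun b => cond b h₁ h₂) (κ := fun b => cond b K₁ K₂)
    (h := fun θ r => h₁ θ r + h₂ θ r) ht hρ Summable.of_finite
    (by rintro (_ | _) <;> simp only [cond] <;> assumption) (fun θ r _ => by
      convert hasSum_fintype (fun b : Bool => (cond b h₁ h₂ : ℝ → ℝ → ℂ) θ r) using 1
      simp)
  simpa using this

theorem Rep.const_mul (hh : Rep ω s t ρ K h) (ht : 0 ≤ t) (hρ : 0 ≤ ρ) (a : ℂ) :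
    Rep ω s t ρ (‖a‖ * K) (fun θ r => a * h θ r) := by
  obtain ⟨c, hc⟩ := hh
  refine ⟨fun p => a * c p, hc.of_le ht hρ (fun p hp => by simp [hc.low p hp]) (norm_nonneg _)
    (fun p => by rw [norm_mul, mul_assoc]) (fun θ r hr _ => ?_)⟩
  simpa [mul_assoc] using (hc.hasSum θ r hr).mul_left a

theorem Rep.neg (hh : Rep ω s t ρ K h) (ht : 0 ≤ t) (hρ : 0 ≤ ρ) :
    Rep ω s t ρ K (fun θ r => -h θ r) := by
  simpa using hh.const_mul ht hρ (-1)

theorem Rep.sub {K₁ K₂ : ℝ} (ht : 0 ≤ t) (hρ : 0 ≤ ρ) (hh₁ : Rep ω s t ρ K₁ h₁)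
    (hh₂ : Rep ω s t ρ K₂ h₂) : Rep ω s t ρ (K₁ + K₂) (fun θ r => h₁ θ r - h₂ θ r) := by
  simpa [sub_eq_add_neg] using hh₁.add ht hρ (hh₂.neg ht hρ)

/-- The convolution of two coefficient families. -/
def conv {ι : Type*} [Add ι] (c d : ι → ℂ) (q : ι) : ℂ :=
  ∑' x : (fun p : ι × ι => p.1 + p.2) ⁻¹' {q}, c x.1.1 * d x.1.2

/-- The character `χ` is arbitrary because two kinds occur: the basic functions, and the modes
displaced into the complex torus in `norm_convPow_le`. -/
theorem hasSum_conv {ι : Type*} [Add ι] {c d χ : ι → ℂ} (hχ : ∀ p q, χ (p + q) = χ p * χ q)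
    {A B : ℂ} (hc : HasSum (fun p => c p * χ p) A) (hd : HasSum (fun p => d p * χ p) B) :
    HasSum (fun q => conv c d q * χ q) (A * B) := by
  have h0 : Summable fun x : ι × ι => (c x.1 * χ x.1) * (d x.2 * χ x.2) :=
    summable_mul_of_summable_norm (f := fun p => c p * χ p) (g := fun p => d p * χ p)
      hc.summable.norm hd.summable.norm
  have h := (HasSum.mul (f := fun p => c p * χ p) (g := fun p => d p * χ p) hc hd
    h0).tsum_fiberwise (fun p : ι × ι => p.1 + p.2)
  suffices he : (fun q => conv c d q * χ q) = fun q => ∑' x : (fun p : ι × ι => p.1 + p.2) ⁻¹' {q},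
      (c x.1.1 * χ x.1.1) * (d x.1.2 * χ x.1.2) by
    rw [he]; exact h
  funext q
  unfold conv
  rw [← tsum_mul_right]
  refine tsum_congr fun x => ?_
  have hx : x.1.1 + x.1.2 = q := x.2
  have hχq : χ q = χ x.1.1 * χ x.1.2 := by
    have := hχ x.1.1 x.1.2
    rwa [hx] at this
  rw [hχq]; ring

theorem summable_conv {ι : Type*} [Add ι] {c d : ι → ℂ} {w : ι → ℝ} (hw : ∀ p, 0 ≤ w p)
    (hadd : ∀ p q, w (p + q) ≤ w p * w q) (hpos : ∀ p, 0 < w p)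
    (hc : Summable fun p => ‖c p‖ * w p) (hd : Summable fun p => ‖d p‖ * w p) :
    (Summable fun q => ‖conv c d q‖ * w q) ∧
      ∑' q, ‖conv c d q‖ * w q ≤ (∑' p, ‖c p‖ * w p) * ∑' p, ‖d p‖ * w p := by
  have h0 := hc.hasSum.mul hd.hasSum (hc.mul_of_nonneg hd
    (fun p => mul_nonneg (norm_nonneg _) (hw p)) (fun p => mul_nonneg (norm_nonneg _) (hw p)))
  have h := h0.tsum_fiberwise (fun p : ι × ι => p.1 + p.2)
  have hle : ∀ q, ‖conv c d q‖ * w q ≤ ∑' x : (fun p : ι × ι => p.1 + p.2) ⁻¹' {q},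
      (‖c x.1.1‖ * w x.1.1) * (‖d x.1.2‖ * w x.1.2) := fun q => by
    have hsq := h0.summable.subtype ((fun p : ι × ι => p.1 + p.2) ⁻¹' {q})
    have hb : ∀ x : (fun p : ι × ι => p.1 + p.2) ⁻¹' {q}, ‖c x.1.1 * d x.1.2‖ * w q ≤
        (‖c x.1.1‖ * w x.1.1) * (‖d x.1.2‖ * w x.1.2) := fun x => by
      have hx : x.1.1 + x.1.2 = q := x.2
      have hwq : w q ≤ w x.1.1 * w x.1.2 := by
        have := hadd x.1.1 x.1.2
        rwa [hx] at this
      rw [norm_mul]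
      calc _ ≤ ‖c x.1.1‖ * ‖d x.1.2‖ * (w x.1.1 * w x.1.2) :=
            mul_le_mul_of_nonneg_left hwq (by positivity)
        _ = _ := by ring
    have hs1 : Summable fun x : (fun p : ι × ι => p.1 + p.2) ⁻¹' {q} =>
        ‖c x.1.1 * d x.1.2‖ * w q :=
      Summable.of_nonneg_of_le (fun x => mul_nonneg (norm_nonneg _) (hw q)) hb hsq
    have hs2 : Summable fun x : (fun p : ι × ι => p.1 + p.2) ⁻¹' {q} => ‖c x.1.1 * d x.1.2‖ := by
      refine (hs1.mul_right (w q)⁻¹).congr fun x => ?_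
      have := (hpos q).ne'
      field_simp
    calc ‖conv c d q‖ * w q ≤ (∑' x : (fun p : ι × ι => p.1 + p.2) ⁻¹' {q},
          ‖c x.1.1 * d x.1.2‖) * w q :=
          mul_le_mul_of_nonneg_right (norm_tsum_le_tsum_norm hs2) (hw q)
      _ = ∑' x : (fun p : ι × ι => p.1 + p.2) ⁻¹' {q}, ‖c x.1.1 * d x.1.2‖ * w q :=
          tsum_mul_right.symm
      _ ≤ _ := hs1.tsum_le_tsum hb hsq
  have hS : Summable fun q => ‖conv c d q‖ * w q := Summable.of_nonneg_of_le
    (fun q => mul_nonneg (norm_nonneg _) (hw q)) hle h.summable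
  exact ⟨hS, (hS.tsum_le_tsum hle h.summable).trans h.tsum_eq.le⟩

theorem Rep.mul {s₁ s₂ : ℕ} {K₁ K₂ : ℝ} (ht : 0 ≤ t) (hρ : 0 < ρ) (hh₁ : Rep ω s₁ t ρ K₁ h₁)
    (hh₂ : Rep ω s₂ t ρ K₂ h₂) :
    Rep ω (s₁ + s₂) t ρ (K₁ * K₂) (fun θ r => h₁ θ r * h₂ θ r) := by
  have hK₁ := hh₁.nonneg hρ.le
  obtain ⟨c, hc⟩ := hh₁
  obtain ⟨d, hd⟩ := hh₂
  obtain ⟨h1, h2⟩ := summable_conv (weight_nonneg hρ.le) (weight_add_le ht hρ.le) (weight_pos hρ)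
    hc.summable hd.summable
  refine ⟨conv c d, fun q hq => ?_, h1, h2.trans ?_, fun θ r hr => ?_⟩
  · unfold conv
    convert tsum_zero using 2 with x
    funext x
    have hx : x.1.1 + x.1.2 = q := x.2
    have hx1 : x.1.1.1 + x.1.2.1 = q.1 := congrArg Prod.fst hx
    by_cases hlt : x.1.1.1 < s₁
    · rw [hc.low _ hlt, zero_mul]
    · rw [hd.low _ (by omega), mul_zero]
  · exact mul_le_mul hc.le hd.le (tsum_nonneg fun p =>
      mul_nonneg (norm_nonneg _) (weight_nonneg hρ.le p)) hK₁
  · exact hasSum_conv (basic_add θ r) (hc.hasSum θ r hr) (hd.hasSum θ r hr)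

theorem Rep.pow_order (ht : 0 ≤ t) (hρ : 0 < ρ) (hh : Rep ω s t ρ K h) (n : ℕ) :
    Rep ω (s * n) t ρ (K ^ n) (fun θ r => h θ r ^ n) := by
  induction n with
  | zero => simpa using Rep.const (ω := ω) (t := t) (ρ := ρ) 1
  | succ n ih => simpa only [pow_succ, Nat.mul_succ] using ih.mul ht hρ hh

theorem Rep.pow (ht : 0 ≤ t) (hρ : 0 < ρ) (hh : Rep ω 0 t ρ K h) (n : ℕ) :
    Rep ω 0 t ρ (K ^ n) (fun θ r => h θ r ^ n) :=
  (hh.pow_order ht hρ n).mono_order (Nat.zero_le _)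

/-- A constant real translation multiplies coefficients by numbers of modulus one, so neither strip
nor radius is lost. -/
theorem Rep.shift (hh : Rep ω s t ρ K h) (ht : 0 ≤ t) (hρ : 0 ≤ ρ) (γ : ℝ) :
    Rep ω s t ρ K (fun θ r => h (θ + γ) r) := by
  obtain ⟨c, hc⟩ := hh
  have := hc.of_le (s' := s) (h' := fun θ r => h (θ + γ) r) (c' := fun p => c p * mode ω p.2 γ) ht hρ
    (fun p hp => by simp [hc.low p hp]) zero_le_one
    (fun p => by rw [norm_mul, norm_mode, mul_one, one_mul])
    (fun θ r hr _ => by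
      convert hc.hasSum (θ + γ) r hr using 2 with p
      simp only [basic, mode_apply_add]; ring)
  exact ⟨_, by simpa using this⟩

/-- The involution of the index set that changes the sign of the Fourier index. -/
def negIndex : ℕ × (Fin m → ℤ) ≃ ℕ × (Fin m → ℤ) := Equiv.prodCongr (Equiv.refl _) (Equiv.neg _)

theorem weight_negIndex (p : ℕ × (Fin m → ℤ)) : weight t ρ (negIndex p) = weight t ρ p := by
  simp [weight, negIndex, order_neg]

theorem Rep.conj (hh : Rep ω s t ρ K h) :
    Rep ω s t ρ K (fun θ r => (starRingEnd ℂ) (h θ r)) := by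
  obtain ⟨c, hc⟩ := hh
  have hw : (fun p => ‖(starRingEnd ℂ) (c (negIndex p))‖ * weight t ρ p) =
      (fun p => ‖c p‖ * weight t ρ p) ∘ negIndex := by
    funext p; simp [weight_negIndex]
  refine ⟨fun p => (starRingEnd ℂ) (c (negIndex p)), fun p hp => ?_, ?_, ?_, fun θ r hr => ?_⟩
  · rw [hc.low (negIndex p) hp, map_zero]
  · rw [hw]; exact negIndex.summable_iff.2 hc.summable
  · rw [hw]; exact (negIndex.tsum_eq (fun p => ‖c p‖ * weight t ρ p)).trans_le hc.le
  · have h1 := (negIndex.hasSum_iff.2 (hc.hasSum θ r hr)).map (starRingEnd ℂ)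
      Complex.continuous_conj
    convert h1 using 2 with p
    simp [basic, negIndex, conj_mode]

/-! ### Real functions -/

/-- `Rep` for real functions. -/
def RRep (ω : Fin m → ℝ) (s : ℕ) (t ρ K : ℝ) (h : ℝ → ℝ → ℝ) : Prop :=
  Rep ω s t ρ K fun θ r => (h θ r : ℂ)

theorem Rep.re (hh : Rep ω s t ρ K h) (ht : 0 ≤ t) (hρ : 0 ≤ ρ) :
    RRep ω s t ρ K (fun θ r => (h θ r).re) := by
  have := ((hh.add ht hρ hh.conj).const_mul ht hρ (1 / 2)).mono_const (K' := K)
    (by norm_num; linarith)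
  refine this.congr fun θ r _ => ?_
  rw [Complex.re_eq_add_conj]; ring

section RRep

variable {f g : ℝ → ℝ → ℝ} {K₁ K₂ : ℝ}

theorem RRep.abs_le (ht : 0 ≤ t) (hh : RRep ω s t ρ K f) (θ : ℝ) {r : ℝ} (hr : |r| < ρ) :
    |f θ r| ≤ K := by
  simpa using Rep.norm_le ht hh θ hr

theorem RRep.congr (hh : RRep ω s t ρ K f) (h12 : ∀ θ r : ℝ, |r| < ρ → g θ r = f θ r) :
    RRep ω s t ρ K g :=
  Rep.congr hh fun θ r hr => by simp only [h12 θ r hr]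

theorem RRep.add (ht : 0 ≤ t) (hρ : 0 ≤ ρ) (hf : RRep ω s t ρ K₁ f) (hg : RRep ω s t ρ K₂ g) :
    RRep ω s t ρ (K₁ + K₂) (fun θ r => f θ r + g θ r) := by
  simpa [RRep] using Rep.add ht hρ hf hg

theorem RRep.sub (ht : 0 ≤ t) (hρ : 0 ≤ ρ) (hf : RRep ω s t ρ K₁ f) (hg : RRep ω s t ρ K₂ g) :
    RRep ω s t ρ (K₁ + K₂) (fun θ r => f θ r - g θ r) := by
  simpa [RRep] using Rep.sub ht hρ hf hg

theorem RRep.neg (hf : RRep ω s t ρ K f) (ht : 0 ≤ t) (hρ : 0 ≤ ρ) :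
    RRep ω s t ρ K (fun θ r => -f θ r) := by
  simpa [RRep] using Rep.neg hf ht hρ

theorem RRep.mul {s₁ s₂ : ℕ} (ht : 0 ≤ t) (hρ : 0 < ρ) (hf : RRep ω s₁ t ρ K₁ f)
    (hg : RRep ω s₂ t ρ K₂ g) : RRep ω (s₁ + s₂) t ρ (K₁ * K₂) (fun θ r => f θ r * g θ r) := by
  simpa [RRep] using Rep.mul ht hρ hf hg

theorem RRep.pow (ht : 0 ≤ t) (hρ : 0 < ρ) (hf : RRep ω 0 t ρ K f) (n : ℕ) :
    RRep ω 0 t ρ (K ^ n) (fun θ r => f θ r ^ n) := by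
  simpa [RRep] using Rep.pow ht hρ hf n

theorem RRep.const_mul (hf : RRep ω s t ρ K f) (ht : 0 ≤ t) (hρ : 0 ≤ ρ) (a : ℝ) :
    RRep ω s t ρ (|a| * K) (fun θ r => a * f θ r) := by
  simpa [RRep] using Rep.const_mul hf ht hρ a

theorem RRep.shift (hf : RRep ω s t ρ K f) (ht : 0 ≤ t) (hρ : 0 ≤ ρ) (γ : ℝ) :
    RRep ω s t ρ K (fun θ r => f (θ + γ) r) :=
  Rep.shift hf ht hρ γ

theorem RRep.const (a : ℝ) : RRep ω 0 t ρ |a| (fun _ _ => a) := by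
  simpa [RRep] using Rep.const (ω := ω) (t := t) (ρ := ρ) (a : ℂ)

theorem RRep.zero : RRep ω s t ρ 0 (fun _ _ => 0) := by
  simpa [RRep] using Rep.zero (ω := ω) (s := s) (t := t) (ρ := ρ)

theorem RRep.hasSum {β : Type*} {H : β → ℝ → ℝ → ℝ} {κ : β → ℝ} (ht : 0 ≤ t) (hρ : 0 ≤ ρ)
    (hκ : Summable κ) (hH : ∀ b, RRep ω s t ρ (κ b) (H b))
    (hs : ∀ θ r : ℝ, |r| < ρ → HasSum (fun b => H b θ r) (f θ r)) :
    RRep ω s t ρ (∑' b, κ b) f :=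
  Rep.hasSum ht hρ hκ hH fun θ r hr => Complex.hasSum_ofReal.2 (hs θ r hr)

end RRep

end QPReversible

end

/-! ### Taylor expansion, composition, remainders and Cauchy estimates in the weighted norms. -/

noncomputable section

namespace QPReversible

open Filter Topology Asymptotics

variable {m : ℕ} {ω : Fin m → ℝ}

/-! ### Taylor expansion -/

/-- The contribution of the index `p` to the Taylor coefficient of order `q`. -/
def taylorFactor (ω : Fin m → ℝ) (c : ℕ × (Fin m → ℤ) → ℂ) (q : ℕ × ℕ) (p : ℕ × (Fin m → ℤ)) : ℂ :=
  c p * (Complex.I * pairing p.2 ω) ^ q.1 / (q.1.factorial : ℂ) * (p.1.choose q.2 : ℂ)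

theorem hasSum_add_pow {R : Type*} [NormedCommRing R] (x y : R) (k : ℕ) :
    HasSum (fun l : ℕ => (k.choose l : R) * x ^ (k - l) * y ^ l) ((x + y) ^ k) := by
  rw [add_comm, add_pow]
  have : ∑ l ∈ Finset.range (k + 1), y ^ l * x ^ (k - l) * (k.choose l : R) =
      ∑ l ∈ Finset.range (k + 1), (k.choose l : R) * x ^ (k - l) * y ^ l :=
    Finset.sum_congr rfl fun l _ => by ring
  rw [this]
  refine hasSum_sum_of_ne_finset_zero fun l hl => ?_
  rw [Nat.choose_eq_zero_of_lt (by simpa using hl)]; simp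

theorem hasSum_exp_real (x : ℝ) : HasSum (fun n : ℕ => x ^ n / n.factorial) (Real.exp x) := by
  rw [Real.exp_eq_exp_ℝ]; exact NormedSpace.expSeries_div_hasSum_exp x

theorem hasSum_exp_complex (x : ℂ) :
    HasSum (fun n : ℕ => x ^ n / (n.factorial : ℂ)) (Complex.exp x) := by
  rw [Complex.exp_eq_exp_ℂ]; exact NormedSpace.expSeries_div_hasSum_exp x

/-- Taylor expansion of a function with a weighted absolutely convergent series, with a bound for
the sum of the norms of its terms. -/
theorem Rep.exists_taylor {s : ℕ} {t ρ K t' ρ' X Y : ℝ} {f : ℝ → ℝ → ℂ} (hf : Rep ω s t ρ K f)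
    (ht' : 0 ≤ t') (hρ' : 0 < ρ') (hX : 0 < X) (hY : 0 < Y) (htX : t' + freqBound ω * X ≤ t)
    (hρY : ρ' + Y ≤ ρ) :
    ∃ (T : ℕ × ℕ → ℝ → ℝ → ℂ) (κ : ℕ × ℕ → ℝ), (∀ q, Rep ω (s - q.2) t' ρ' (κ q) (T q)) ∧
      (Summable fun q => κ q * X ^ q.1 * Y ^ q.2) ∧ (∑' q, κ q * X ^ q.1 * Y ^ q.2 ≤ K) ∧
      ∀ ξ η x y : ℝ, |η| < ρ' → |x| ≤ X → |y| ≤ Y →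
        HasSum (fun q => T q ξ η * (x : ℂ) ^ q.1 * (y : ℂ) ^ q.2) (f (ξ + x) (η + y)) := by
  obtain ⟨c, hc⟩ := hf
  -- The truncated subtraction `p.1 - q.2` is harmless: for `q.2 > p.1` the binomial coefficient in
  -- `taylorFactor` is zero.
  set a : ℕ × ℕ → ℕ × (Fin m → ℤ) → ℝ := fun q p =>
    ‖taylorFactor ω c q p‖ * weight t' ρ' (p.1 - q.2, p.2) with ha
  have ha0 : ∀ q p, 0 ≤ a q p := fun q p => mul_nonneg (norm_nonneg _) (weight_nonneg hρ'.le _)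
  have hnn : ∀ x : (ℕ × (Fin m → ℤ)) × (ℕ × ℕ), 0 ≤ a x.2 x.1 * X ^ x.2.1 * Y ^ x.2.2 :=
    fun x => by have := ha0 x.2 x.1; positivity
  have hin : ∀ p, HasSum (fun q : ℕ × ℕ => a q p * X ^ q.1 * Y ^ q.2)
      (‖c p‖ * Real.exp (t' * order p.2) *
        (Real.exp (|pairing p.2 ω| * X) * (ρ' + Y) ^ p.1)) := fun p => by
    have h1 := hasSum_exp_real (|pairing p.2 ω| * X)
    have h2 := hasSum_add_pow ρ' Y p.1
    have h3 := h1.mul h2 (h1.summable.mul_of_nonneg h2.summable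
      (fun n => by positivity) (fun n => by positivity))
    refine (h3.mul_left (‖c p‖ * Real.exp (t' * order p.2))).congr_fun ?_
    intro q
    simp only [ha, taylorFactor, weight, norm_mul, norm_div, norm_pow, Complex.norm_I,
      Complex.norm_real, Real.norm_eq_abs, Complex.norm_natCast, one_mul]
    ring
  -- Displacing by `X` costs `|⟨j, ω⟩| X ≤ freqBound ω * X * |j|` in the exponent, paid by the strip
  -- `t - t'`; displacing by `Y` is paid by the radius.
  have hin_le : ∀ p, ‖c p‖ * Real.exp (t' * order p.2) *
      (Real.exp (|pairing p.2 ω| * X) * (ρ' + Y) ^ p.1) ≤ ‖c p‖ * weight t ρ p := fun p => by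
    unfold weight
    rw [mul_assoc, ← mul_assoc (Real.exp _), ← Real.exp_add]
    refine mul_le_mul_of_nonneg_left (mul_le_mul (Real.exp_le_exp.2 ?_)
      (pow_le_pow_left₀ (by positivity) hρY _) (by positivity) (by positivity)) (norm_nonneg _)
    have h1 := mul_le_mul_of_nonneg_right (abs_pairing_le (ω := ω) p.2) hX.le
    have h2 := mul_le_mul_of_nonneg_right htX (order_nonneg p.2)
    nlinarith
  have hS1 : Summable fun x : (ℕ × (Fin m → ℤ)) × (ℕ × ℕ) => a x.2 x.1 * X ^ x.2.1 * Y ^ x.2.2 := by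
    refine (summable_prod_of_nonneg hnn).2 ⟨fun p => (hin p).summable, ?_⟩
    refine Summable.of_nonneg_of_le (fun p => tsum_nonneg fun q => hnn (p, q)) (fun p => ?_)
      hc.summable
    exact (hin p).tsum_eq.trans_le (hin_le p)
  have hS2 : Summable fun x : (ℕ × ℕ) × (ℕ × (Fin m → ℤ)) => a x.1 x.2 * X ^ x.1.1 * Y ^ x.1.2 :=
    (Equiv.prodComm _ _).summable_iff.1 (by simpa [Function.comp_def] using hS1)
  have hap : ∀ q, Summable (a q) := fun q => by
    have := (hS2.prod_factor q).mul_right (X ^ q.1 * Y ^ q.2)⁻¹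
    refine this.congr fun p => ?_
    have h1 : X ^ q.1 ≠ 0 := by positivity
    have h2 : Y ^ q.2 ≠ 0 := by positivity
    field_simp
  have hterm : ∀ q p, Rep ω (s - q.2) t' ρ' (a q p)
      (fun ξ η => taylorFactor ω c q p * (mode ω p.2 ξ * (η : ℂ) ^ (p.1 - q.2))) := fun q p =>
    Rep.monomial _ _ _ fun hlt => by
      have : p.1 < s := by omega
      simp [taylorFactor, hc.low p this]
  have hκ : ∀ q, ∑' p, a q p * X ^ q.1 * Y ^ q.2 = (∑' p, a q p) * X ^ q.1 * Y ^ q.2 := fun q => by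
    rw [tsum_mul_right, tsum_mul_right]
  have hsmall : ∀ q p (ξ η : ℝ), |η| < ρ' →
      ‖taylorFactor ω c q p * (mode ω p.2 ξ * (η : ℂ) ^ (p.1 - q.2))‖ ≤ a q p :=
    fun q p ξ η hη => (hterm q p).norm_le ht' ξ hη
  refine ⟨fun q ξ η => ∑' p, taylorFactor ω c q p * (mode ω p.2 ξ * (η : ℂ) ^ (p.1 - q.2)),
    fun q => ∑' p, a q p, fun q => ?_, ?_, ?_, fun ξ η x y hη hx hy => ?_⟩
  · exact Rep.hasSum ht' hρ'.le (hap q) (hterm q) fun ξ η hη =>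
      (Summable.of_norm_bounded (hap q) fun p => hsmall q p ξ η hη).hasSum
  · refine ((summable_prod_of_nonneg fun x => hnn (x.2, x.1)).1 hS2).2.congr fun q => ?_
    exact hκ q
  · calc _ = ∑' q, ∑' p, a q p * X ^ q.1 * Y ^ q.2 := tsum_congr fun q => (hκ q).symm
      _ = ∑' p, ∑' q, a q p * X ^ q.1 * Y ^ q.2 := hS1.tsum_comm
      _ ≤ ∑' p, ‖c p‖ * weight t ρ p := by
          refine Summable.tsum_le_tsum (fun p => ?_) ?_ hc.summable
          · exact (hin p).tsum_eq.trans_le (hin_le p)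
          · exact ((summable_prod_of_nonneg hnn).1 hS1).2
      _ ≤ K := hc.le
  · have hb : ∀ q p, ‖taylorFactor ω c q p * (mode ω p.2 ξ * (η : ℂ) ^ (p.1 - q.2)) *
        (x : ℂ) ^ q.1 * (y : ℂ) ^ q.2‖ ≤ a q p * X ^ q.1 * Y ^ q.2 := fun q p => by
      rw [norm_mul, norm_mul, norm_pow, norm_pow, Complex.norm_real, Complex.norm_real,
        Real.norm_eq_abs, Real.norm_eq_abs]
      have h1 := pow_le_pow_left₀ (abs_nonneg x) hx q.1
      have h2 := pow_le_pow_left₀ (abs_nonneg y) hy q.2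
      have h0 := ha0 q p
      exact mul_le_mul (mul_le_mul (hsmall q p ξ η hη) h1 (by positivity) h0) h2 (by positivity)
        (by positivity)
    have hsum1 : Summable fun z : (ℕ × (Fin m → ℤ)) × (ℕ × ℕ) =>
        taylorFactor ω c z.2 z.1 * (mode ω z.1.2 ξ * (η : ℂ) ^ (z.1.1 - z.2.2)) *
        (x : ℂ) ^ z.2.1 * (y : ℂ) ^ z.2.2 :=
      Summable.of_norm_bounded hS1 fun z => hb z.2 z.1
    have hp : ∀ p, HasSum (fun q : ℕ × ℕ => taylorFactor ω c q p *
        (mode ω p.2 ξ * (η : ℂ) ^ (p.1 - q.2)) * (x : ℂ) ^ q.1 * (y : ℂ) ^ q.2)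
        (c p * basic ω (ξ + x) (η + y) p) := fun p => by
      have h1 := hasSum_exp_complex (Complex.I * pairing p.2 ω * x)
      have h2 := hasSum_add_pow (η : ℂ) (y : ℂ) p.1
      have h3 := h1.mul h2 (summable_mul_of_summable_norm
        (f := fun n : ℕ => (Complex.I * pairing p.2 ω * x) ^ n / (n.factorial : ℂ))
        (g := fun l : ℕ => (p.1.choose l : ℂ) * (η : ℂ) ^ (p.1 - l) * (y : ℂ) ^ l)
        h1.summable.norm h2.summable.norm)
      have h4 := h3.mul_left (c p * mode ω p.2 ξ)
      have he : c p * mode ω p.2 ξ * (Complex.exp (Complex.I * pairing p.2 ω * x) *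
          ((η : ℂ) + y) ^ p.1) = c p * basic ω (ξ + x) (η + y) p := by
        simp only [basic, mode_apply_add]
        simp only [mode]; push_cast; ring_nf
      rw [← he]
      refine h4.congr_fun fun q => ?_
      simp only [taylorFactor]; ring
    have hη' : |η + y| < ρ := by
      have := abs_add_le η y; linarith
    have h1 := hsum1.hasSum.prod_fiberwise hp
    rw [(hc.hasSum (ξ + x) (η + y) hη').unique h1]
    have hsum2 : HasSum (fun z : (ℕ × ℕ) × (ℕ × (Fin m → ℤ)) =>
        taylorFactor ω c z.1 z.2 * (mode ω z.2.2 ξ * (η : ℂ) ^ (z.2.1 - z.1.2)) *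
        (x : ℂ) ^ z.1.1 * (y : ℂ) ^ z.1.2) _ :=
      (Equiv.prodComm _ _).hasSum_iff.1 (by simpa [Function.comp_def] using hsum1.hasSum)
    have hq : ∀ q : ℕ × ℕ, HasSum (fun p : ℕ × (Fin m → ℤ) =>
        taylorFactor ω c q p * (mode ω p.2 ξ * (η : ℂ) ^ (p.1 - q.2)) *
        (x : ℂ) ^ q.1 * (y : ℂ) ^ q.2)
        ((∑' p, taylorFactor ω c q p * (mode ω p.2 ξ * (η : ℂ) ^ (p.1 - q.2))) *
        (x : ℂ) ^ q.1 * (y : ℂ) ^ q.2) := fun q =>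
      (((Summable.of_norm_bounded (hap q) fun p => hsmall q p ξ η hη).hasSum).mul_right
        _).mul_right _
    exact HasSum.prod_fiberwise (f := fun z : (ℕ × ℕ) × (ℕ × (Fin m → ℤ)) =>
        taylorFactor ω c z.1 z.2 * (mode ω z.2.2 ξ * (η : ℂ) ^ (z.2.1 - z.1.2)) *
        (x : ℂ) ^ z.1.1 * (y : ℂ) ^ z.1.2) hsum2 hq

/-! ### Composition and remainders -/

variable {t ρ K t' ρ' a b x y Z : ℝ} {s : ℕ}

/-- Composition with a map close to the identity. -/
theorem Rep.comp {f : ℝ → ℝ → ℂ} {u v : ℝ → ℝ → ℝ} (hf : Rep ω s t ρ K f)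
    (ht' : 0 ≤ t') (hρ' : 0 < ρ') (ha : 0 < a) (hb : 0 < b) (hta : t' + freqBound ω * a ≤ t)
    (hρb : ρ' + b ≤ ρ) (hu : RRep ω 0 t' ρ' a u) (hv : RRep ω 0 t' ρ' b v) :
    Rep ω 0 t' ρ' K (fun ξ η => f (ξ + u ξ η) (η + v ξ η)) := by
  obtain ⟨T, κ, hT, hκ, hκK, hsum⟩ := hf.exists_taylor ht' hρ' ha hb hta hρb
  refine (Rep.hasSum ht' hρ'.le hκ (H := fun q ξ η => T q ξ η * (u ξ η : ℂ) ^ q.1 *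
    (v ξ η : ℂ) ^ q.2) (fun q => ?_) fun ξ η hη => ?_).mono_const hκK
  · exact (((hT q).mono_order (Nat.zero_le _)).mul ht' hρ' (Rep.pow ht' hρ' hu q.1)).mul ht' hρ'
      (Rep.pow ht' hρ' hv q.2)
  · exact hsum ξ η _ _ hη (hu.abs_le ht' ξ hη) (hv.abs_le ht' ξ hη)

theorem HasSum.sub_finset {β : Type*} [DecidableEq β] {g : β → ℂ} {A : ℂ} (hg : HasSum g A)
    (S : Finset β) : HasSum (fun q => if q ∈ S then 0 else g q) (A - ∑ q ∈ S, g q) := by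
  have h1 : HasSum (fun q => if q ∈ S then g q else 0) (∑ q ∈ S, g q) := by
    have : HasSum (fun q => if q ∈ S then g q else 0) (∑ q ∈ S, if q ∈ S then g q else 0) :=
      hasSum_sum_of_ne_finset_zero (fun q hq => by simp [hq])
    rwa [Finset.sum_congr rfl (fun q hq => by simp [hq] : ∀ q ∈ S, _ = g q)] at this
  refine (hg.sub h1).congr_fun fun q => ?_
  by_cases hq : q ∈ S <;> simp [hq]

/-- The remainder of a Taylor expansion of order `p` along the curve `U + W`. -/
theorem Rep.remainder {s₁ : ℕ} {f : ℝ → ℝ → ℂ} {u v w₁ w₂ : ℝ → ℝ → ℝ} (hf : Rep ω s t ρ K f)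
    (ht' : 0 ≤ t') (hρ' : 0 < ρ') (ha : 0 < a) (hb : 0 < b) (hx : 0 < x) (hy : 0 < y) (hZ : 1 ≤ Z)
    (hta : t' + freqBound ω * (a + Z * x) ≤ t) (hρb : ρ' + (b + Z * y) ≤ ρ)
    (hu : RRep ω 0 t' ρ' a u) (hv : RRep ω 0 t' ρ' b v) (hw₁ : RRep ω s₁ t' ρ' x w₁)
    (hw₂ : RRep ω s₁ t' ρ' y w₂) :
    ∃ (T : ℕ × ℕ → ℝ → ℝ → ℂ) (κ : ℕ × ℕ → ℝ),
      (∀ q, Rep ω (s - q.2) (t' + freqBound ω * a) (ρ' + b) (κ q) (T q)) ∧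
      (Summable fun q => κ q * (Z * x) ^ q.1 * (Z * y) ^ q.2) ∧
      (∀ ξ η x' y' : ℝ, |η| < ρ' + b → |x'| ≤ Z * x → |y'| ≤ Z * y →
        HasSum (fun q => T q ξ η * (x' : ℂ) ^ q.1 * (y' : ℂ) ^ q.2) (f (ξ + x') (η + y'))) ∧
      ∀ (S : Finset (ℕ × ℕ)) (p : ℕ), (∀ q ∉ S, p ≤ q.1 + q.2) →
        Rep ω (s₁ * p) t' ρ' (K / Z ^ p) (fun ξ η =>
          f (ξ + u ξ η + w₁ ξ η) (η + v ξ η + w₂ ξ η) -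
            ∑ q ∈ S, T q (ξ + u ξ η) (η + v ξ η) * (w₁ ξ η : ℂ) ^ q.1 * (w₂ ξ η : ℂ) ^ q.2) := by
  have hΩ := freqBound_pos (ω := ω)
  have hZ0 : 0 < Z := by linarith
  obtain ⟨T, κ, hT, hκ, hκK, hsum⟩ := hf.exists_taylor (t' := t' + freqBound ω * a)
    (ρ' := ρ' + b) (X := Z * x) (Y := Z * y) (by positivity) (by positivity) (by positivity)
    (by positivity) (by linarith) (by linarith)
  refine ⟨T, κ, hT, hκ, hsum, fun S p hS => ?_⟩
  have hκ0 : ∀ q, 0 ≤ κ q := fun q => (hT q).nonneg (by positivity)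
  have hterm : ∀ q, Rep ω (s₁ * (q.1 + q.2)) t' ρ' (κ q * x ^ q.1 * y ^ q.2) (fun ξ η =>
      T q (ξ + u ξ η) (η + v ξ η) * (w₁ ξ η : ℂ) ^ q.1 * (w₂ ξ η : ℂ) ^ q.2) := fun q =>
    (((Rep.comp (hT q) ht' hρ' ha hb le_rfl le_rfl hu hv).mul ht' hρ'
      (Rep.pow_order ht' hρ' hw₁ q.1)).mul ht' hρ' (Rep.pow_order ht' hρ' hw₂ q.2)).mono_order
      (by rw [Nat.mul_add]; omega)
  -- The series still converges with both increments enlarged by `Z`, and a term outside `S`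
  -- contains at least `p` increments, each worth a factor `1 / Z`.
  have hle : ∀ q, (if q ∈ S then 0 else κ q * x ^ q.1 * y ^ q.2) ≤
      (Z ^ p)⁻¹ * (κ q * (Z * x) ^ q.1 * (Z * y) ^ q.2) := fun q => by
    have h0 := hκ0 q
    split_ifs with hq
    · positivity
    · rw [inv_mul_eq_div, le_div_iff₀ (by positivity)]
      calc κ q * x ^ q.1 * y ^ q.2 * Z ^ p ≤ κ q * x ^ q.1 * y ^ q.2 * Z ^ (q.1 + q.2) :=
            mul_le_mul_of_nonneg_left (pow_le_pow_right₀ hZ (hS q hq)) (by positivity)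
        _ = _ := by rw [mul_pow, mul_pow, pow_add]; ring
  have hsumm : Summable fun q => if q ∈ S then 0 else κ q * x ^ q.1 * y ^ q.2 := by
    refine Summable.of_nonneg_of_le (fun q => ?_) hle (hκ.mul_left _)
    have h0 := hκ0 q
    split_ifs <;> positivity
  have hbound : ∑' q, (if q ∈ S then 0 else κ q * x ^ q.1 * y ^ q.2) ≤ K / Z ^ p := by
    refine (hsumm.tsum_le_tsum hle (hκ.mul_left _)).trans ?_
    rw [tsum_mul_left, inv_mul_eq_div]
    gcongr
  refine (Rep.hasSum ht' hρ'.le hsumm (H := fun q ξ η => if q ∈ S then 0 else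
    T q (ξ + u ξ η) (η + v ξ η) * (w₁ ξ η : ℂ) ^ q.1 * (w₂ ξ η : ℂ) ^ q.2) (fun q => ?_)
    fun ξ η hη => ?_).mono_const hbound
  · split_ifs with hq
    · exact Rep.zero
    · exact (hterm q).mono_order (Nat.mul_le_mul_left _ (hS q hq))
  · have h1 := hv.abs_le ht' ξ hη
    have h2 := abs_add_le η (v ξ η)
    have h3 := hw₁.abs_le ht' ξ hη
    have h4 := hw₂.abs_le ht' ξ hη
    exact HasSum.sub_finset (hsum (ξ + u ξ η) (η + v ξ η) _ _ (by linarith)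
      (h3.trans (le_mul_of_one_le_left hx.le hZ)) (h4.trans (le_mul_of_one_le_left hy.le hZ))) S

theorem taylor_zero {T : ℕ × ℕ → ℝ → ℝ → ℂ} {f : ℝ → ℝ → ℂ} {ξ η : ℝ}
    (h : HasSum (fun q => T q ξ η * ((0 : ℝ) : ℂ) ^ q.1 * ((0 : ℝ) : ℂ) ^ q.2) (f (ξ + 0) (η + 0))) :
    T (0, 0) ξ η = f ξ η := by
  have h2 := hasSum_single (f := fun q : ℕ × ℕ => T q ξ η * ((0 : ℝ) : ℂ) ^ q.1 *
    ((0 : ℝ) : ℂ) ^ q.2) (0, 0) fun q hq => by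
      by_cases h1 : q.1 = 0
      · have : q.2 ≠ 0 := fun h2 => hq (Prod.ext h1 h2)
        simp [this]
      · simp [h1]
  have := h2.unique h
  simpa using this

/-! ### Derivatives -/

/-- The partial derivative in the first variable. -/
def dX (h : ℝ → ℝ → ℝ) (ξ η : ℝ) : ℝ := deriv (fun x => h x η) ξ

/-- The partial derivative in the second variable. -/
def dY (h : ℝ → ℝ → ℝ) (ξ η : ℝ) : ℝ := deriv (fun y => h ξ y) η

/-- The linear map with coefficients `A`, `B`. -/
def pairMap (A B : ℝ) : ℝ × ℝ →L[ℝ] ℝ :=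
  A • ContinuousLinearMap.fst ℝ ℝ ℝ + B • ContinuousLinearMap.snd ℝ ℝ ℝ

theorem pairMap_apply (A B : ℝ) (p : ℝ × ℝ) : pairMap A B p = A * p.1 + B * p.2 := by
  simp [pairMap]

/-- The terms of degree at least two sum to `O(‖z‖²)`. The coefficients are complex but `f` is real,
so the imaginary part of the linear term is a linear form that is `O(‖z‖²)`, hence zero. -/
theorem hasFDerivAt_of_taylor {f : ℝ → ℝ → ℝ} {T : ℕ × ℕ → ℂ} {κ : ℕ × ℕ → ℝ} {X ξ η : ℝ}
    (hX : 0 < X) (hκ : Summable fun q => κ q * X ^ q.1 * X ^ q.2) (hT : ∀ q, ‖T q‖ ≤ κ q)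
    (hsum : ∀ x y : ℝ, |x| ≤ X → |y| ≤ X →
      HasSum (fun q => T q * (x : ℂ) ^ q.1 * (y : ℂ) ^ q.2) ((f (ξ + x) (η + y) : ℝ) : ℂ)) :
    HasFDerivAt (fun p : ℝ × ℝ => f p.1 p.2) (pairMap (T (1, 0)).re (T (0, 1)).re) (ξ, η) ∧
      (T (1, 0)).im = 0 ∧ (T (0, 1)).im = 0 := by
  set S : Finset (ℕ × ℕ) := {(0, 0), (1, 0), (0, 1)} with hSdef
  have hS : ∀ q ∉ S, 2 ≤ q.1 + q.2 := by
    rintro ⟨n, l⟩ hq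
    by_contra hlt
    have : (n = 0 ∧ l = 0) ∨ (n = 1 ∧ l = 0) ∨ (n = 0 ∧ l = 1) := by simp only at hlt; omega
    apply hq
    rcases this with ⟨h1, h2⟩ | ⟨h1, h2⟩ | ⟨h1, h2⟩ <;> simp [hSdef, h1, h2]
  have hκ0 : ∀ q, 0 ≤ κ q := fun q => (norm_nonneg _).trans (hT q)
  have h00 : T (0, 0) = (f ξ η : ℂ) :=
    taylor_zero (T := fun q _ _ => T q) (f := fun a b => (f a b : ℂ))
      (hsum 0 0 (by simpa using hX.le) (by simpa using hX.le))
  set C := ∑' q, κ q * X ^ q.1 * X ^ q.2 with hC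
  have hest : ∀ z : ℝ × ℝ, ‖z‖ ≤ X → ‖((f (ξ + z.1) (η + z.2) : ℝ) : ℂ) - f ξ η - T (1, 0) * z.1 -
      T (0, 1) * z.2‖ ≤ C / X ^ 2 * ‖z‖ ^ 2 := fun z hz => by
    have h1 : |z.1| ≤ ‖z‖ := norm_fst_le z
    have h2 : |z.2| ≤ ‖z‖ := norm_snd_le z
    have hs := HasSum.sub_finset (hsum z.1 z.2 (h1.trans hz) (h2.trans hz)) S
    have he : ((f (ξ + z.1) (η + z.2) : ℝ) : ℂ) - ∑ q ∈ S, T q * (z.1 : ℂ) ^ q.1 * (z.2 : ℂ) ^ q.2 =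
        ((f (ξ + z.1) (η + z.2) : ℝ) : ℂ) - f ξ η - T (1, 0) * z.1 - T (0, 1) * z.2 := by
      rw [hSdef, Finset.sum_insert (by simp), Finset.sum_insert (by simp), Finset.sum_singleton,
        h00]
      simp; ring
    rw [he] at hs
    rw [← hs.tsum_eq]
    have hle : ∀ q, ‖(if q ∈ S then 0 else T q * (z.1 : ℂ) ^ q.1 * (z.2 : ℂ) ^ q.2)‖ ≤
        (‖z‖ ^ 2 / X ^ 2) * (κ q * X ^ q.1 * X ^ q.2) := fun q => by
      have h0 := hκ0 q
      split_ifs with hq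
      · rw [norm_zero]; positivity
      · rw [norm_mul, norm_mul, norm_pow, norm_pow, Complex.norm_real, Complex.norm_real,
          Real.norm_eq_abs, Real.norm_eq_abs]
        have hq1 : ‖z‖ / X ≤ 1 := (div_le_one hX).2 hz
        calc ‖T q‖ * |z.1| ^ q.1 * |z.2| ^ q.2 ≤ κ q * ‖z‖ ^ q.1 * ‖z‖ ^ q.2 :=
              mul_le_mul (mul_le_mul (hT q) (pow_le_pow_left₀ (abs_nonneg _) h1 _)
                (by positivity) h0) (pow_le_pow_left₀ (abs_nonneg _) h2 _) (by positivity)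
                (by positivity)
          _ = κ q * X ^ q.1 * X ^ q.2 * (‖z‖ / X) ^ (q.1 + q.2) := by
              rw [pow_add, div_pow, div_pow]; field_simp
          _ ≤ κ q * X ^ q.1 * X ^ q.2 * (‖z‖ / X) ^ 2 :=
              mul_le_mul_of_nonneg_left (pow_le_pow_of_le_one (by positivity) hq1 (hS q hq))
                (by positivity)
          _ = _ := by rw [div_pow]; ring
    refine (tsum_of_norm_bounded (hκ.hasSum.mul_left (‖z‖ ^ 2 / X ^ 2)) hle).trans ?_
    rw [← hC]; exact le_of_eq (by ring)
  have hO : ∀ g : ℝ × ℝ → ℝ, (∀ z : ℝ × ℝ, ‖z‖ ≤ X → |g z| ≤ C / X ^ 2 * ‖z‖ ^ 2) →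
      g =o[𝓝 0] (fun z : ℝ × ℝ => z) := fun g hg => by
    have h1 : g =O[𝓝 0] (fun z : ℝ × ℝ => ‖z‖ ^ 2) := by
      refine IsBigO.of_bound (C / X ^ 2) ?_
      filter_upwards [Metric.closedBall_mem_nhds (0 : ℝ × ℝ) hX] with z hz
      simpa using hg z (by simpa using hz)
    refine h1.trans_isLittleO ?_
    have := isLittleO_norm_pow_id (E' := ℝ × ℝ) one_lt_two
    simpa using this
  have hre : HasFDerivAt (fun p : ℝ × ℝ => f p.1 p.2) (pairMap (T (1, 0)).re (T (0, 1)).re)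
      (ξ, η) := by
    rw [hasFDerivAt_iff_isLittleO_nhds_zero]
    refine hO _ fun z hz => ?_
    have h1 := (Complex.abs_re_le_norm _).trans (hest z hz)
    simp only [Complex.sub_re, Complex.mul_re, Complex.ofReal_re, Complex.ofReal_im, mul_zero,
      sub_zero] at h1
    rw [pairMap_apply, show ((ξ, η) + z).1 = ξ + z.1 from rfl, show ((ξ, η) + z).2 = η + z.2 from rfl]
    exact (le_of_eq (congrArg abs (by ring))).trans h1
  have him : (fun z : ℝ × ℝ => (T (1, 0)).im * z.1 + (T (0, 1)).im * z.2) =o[𝓝 0]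
      (fun z : ℝ × ℝ => z) := by
    refine hO _ fun z hz => ?_
    have h1 := (Complex.abs_im_le_norm _).trans (hest z hz)
    simp only [Complex.sub_im, Complex.mul_im, Complex.ofReal_re, Complex.ofReal_im, mul_zero,
      sub_zero, zero_add, zero_sub] at h1
    rw [← abs_neg]
    exact (le_of_eq (congrArg abs (by ring))).trans h1
  have hz : pairMap (T (1, 0)).im (T (0, 1)).im = 0 := by
    have h1 : HasFDerivAt (fun _ : ℝ × ℝ => (0 : ℝ)) (pairMap (T (1, 0)).im (T (0, 1)).im) 0 := by
      rw [hasFDerivAt_iff_isLittleO_nhds_zero]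
      refine him.neg_left.congr_left fun z => ?_
      simp [pairMap_apply]
    exact h1.unique (hasFDerivAt_const 0 0)
  refine ⟨hre, ?_, ?_⟩
  · simpa [pairMap_apply] using DFunLike.congr_fun hz ((1, 0) : ℝ × ℝ)
  · simpa [pairMap_apply] using DFunLike.congr_fun hz ((0, 1) : ℝ × ℝ)

theorem taylor_deriv {f : ℝ → ℝ → ℝ} {T : ℕ × ℕ → ℂ} {κ : ℕ × ℕ → ℝ} {X Y ξ η : ℝ}
    (hX : 0 < X) (hY : 0 < Y) (hκ : Summable fun q => κ q * X ^ q.1 * Y ^ q.2)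
    (hT : ∀ q, ‖T q‖ ≤ κ q)
    (hsum : ∀ x y : ℝ, |x| ≤ X → |y| ≤ Y →
      HasSum (fun q => T q * (x : ℂ) ^ q.1 * (y : ℂ) ^ q.2) ((f (ξ + x) (η + y) : ℝ) : ℂ)) :
    HasFDerivAt (fun p : ℝ × ℝ => f p.1 p.2) (pairMap (dX f ξ η) (dY f ξ η)) (ξ, η) ∧
      T (0, 0) = f ξ η ∧ T (1, 0) = dX f ξ η ∧ T (0, 1) = dY f ξ η := by
  have hκ0 : ∀ q, 0 ≤ κ q := fun q => (norm_nonneg _).trans (hT q)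
  have hm : 0 < min X Y := lt_min hX hY
  have hκ' : Summable fun q => κ q * (min X Y) ^ q.1 * (min X Y) ^ q.2 := by
    refine Summable.of_nonneg_of_le (fun q => ?_) (fun q => ?_) hκ
    · have := hκ0 q; positivity
    · have := hκ0 q
      gcongr
      · exact min_le_left _ _
      · exact min_le_right _ _
  obtain ⟨h1, h2, h3⟩ := hasFDerivAt_of_taylor (f := f) (ξ := ξ) (η := η) hm hκ' hT
    fun x y hx hy => hsum x y (hx.trans (min_le_left _ _)) (hy.trans (min_le_right _ _))
  have h00 : T (0, 0) = (f ξ η : ℂ) :=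
    taylor_zero (T := fun q _ _ => T q) (f := fun a b => (f a b : ℂ))
      (hsum 0 0 (by simpa using hX.le) (by simpa using hY.le))
  have hx : dX f ξ η = (T (1, 0)).re := by
    have h4 : HasDerivAt (fun x : ℝ => (x, η)) ((1 : ℝ), (0 : ℝ)) ξ :=
      (hasDerivAt_id ξ).prodMk (hasDerivAt_const ξ η)
    have h5 := h1.comp_hasDerivAt ξ h4
    have := h5.deriv
    simpa [dX, dY, pairMap_apply, Function.comp_def] using this
  have hy : dY f ξ η = (T (0, 1)).re := by
    have h4 : HasDerivAt (fun y : ℝ => (ξ, y)) ((0 : ℝ), (1 : ℝ)) η :=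
      (hasDerivAt_const η ξ).prodMk (hasDerivAt_id η)
    have h5 := h1.comp_hasDerivAt η h4
    have := h5.deriv
    simpa [dX, dY, pairMap_apply, Function.comp_def] using this
  refine ⟨by rw [hx, hy]; exact h1, h00, ?_, ?_⟩
  · rw [hx]; exact Complex.ext (by simp) (by simp [h2])
  · rw [hy]; exact Complex.ext (by simp) (by simp [h3])

theorem RRep.hasFDerivAt {f : ℝ → ℝ → ℝ} (hf : RRep ω s t ρ K f) (ht : 0 < t) (ξ : ℝ) {η : ℝ}
    (hη : |η| < ρ) :
    HasFDerivAt (fun p : ℝ × ℝ => f p.1 p.2) (pairMap (dX f ξ η) (dY f ξ η)) (ξ, η) := by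
  have hΩ := freqBound_pos (ω := ω)
  have hη0 := abs_nonneg η
  obtain ⟨T, κ, hT, hκ, -, hsum⟩ := Rep.exists_taylor hf (t' := 0) (ρ' := (|η| + ρ) / 2)
    (X := t / freqBound ω) (Y := (ρ - |η|) / 2) le_rfl (by linarith) (by positivity) (by linarith)
    (by rw [mul_div_cancel₀ _ hΩ.ne', zero_add]) (by linarith)
  have hη' : |η| < (|η| + ρ) / 2 := by linarith
  exact (taylor_deriv (T := fun q => T q ξ η) (by positivity) (by linarith) hκ
    (fun q => (hT q).norm_le le_rfl ξ hη') fun x y hx hy => hsum ξ η x y hη' hx hy).1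

/-- Cauchy estimates: the whole Taylor sum is at most `K`, so its terms `(1, 0)` and `(0, 1)` are,
with the largest increments the domains allow. The derivative in `η` loses one order. -/
theorem RRep.deriv_bounds {f : ℝ → ℝ → ℝ} (hf : RRep ω s t ρ K f) (ht' : 0 ≤ t') (htt : t' < t)
    (hρ' : 0 < ρ') (hρρ : ρ' < ρ) :
    RRep ω s t' ρ' (freqBound ω * K / (t - t')) (dX f) ∧
      RRep ω (s - 1) t' ρ' (K / (ρ - ρ')) (dY f) := by
  have hΩ := freqBound_pos (ω := ω)
  have hX : 0 < (t - t') / freqBound ω := div_pos (by linarith) hΩ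
  obtain ⟨T, κ, hT, hκ, hκK, hsum⟩ := Rep.exists_taylor hf (t' := t') (ρ' := ρ')
    (X := (t - t') / freqBound ω) (Y := ρ - ρ') ht' hρ' hX (by linarith)
    (by rw [mul_div_cancel₀ _ hΩ.ne']; linarith) (by linarith)
  have hκ0 : ∀ q, 0 ≤ κ q := fun q => (hT q).nonneg hρ'.le
  have hY : 0 < ρ - ρ' := by linarith
  have hle : ∀ q : ℕ × ℕ, κ q * ((t - t') / freqBound ω) ^ q.1 * (ρ - ρ') ^ q.2 ≤ K := fun q =>
    (hκ.le_tsum q fun p _ => by have := hκ0 p; positivity).trans hκK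
  have hd : ∀ ξ η : ℝ, |η| < ρ' → T (1, 0) ξ η = dX f ξ η ∧ T (0, 1) ξ η = dY f ξ η :=
    fun ξ η hη => (taylor_deriv (T := fun q => T q ξ η) hX (by linarith) hκ
      (fun q => (hT q).norm_le ht' ξ hη) fun x y hx hy => hsum ξ η x y hη hx hy).2.2
  constructor
  · refine ((hT (1, 0)).mono_const ?_).congr fun ξ η hη => (hd ξ η hη).1.symm
    have := hle (1, 0)
    rw [pow_one, pow_zero, mul_one, mul_div_assoc', div_le_iff₀ hΩ] at this
    rw [le_div_iff₀ (by linarith)]; linarith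
  · refine ((hT (0, 1)).mono_const ?_).congr fun ξ η hη => (hd ξ η hη).2.symm
    have := hle (0, 1)
    rw [pow_one, pow_zero, mul_one] at this
    rwa [le_div_iff₀ (by linarith)]

theorem RRep.comp {f u v : ℝ → ℝ → ℝ} (hf : RRep ω s t ρ K f)
    (ht' : 0 ≤ t') (hρ' : 0 < ρ') (ha : 0 < a) (hb : 0 < b) (hta : t' + freqBound ω * a ≤ t)
    (hρb : ρ' + b ≤ ρ) (hu : RRep ω 0 t' ρ' a u) (hv : RRep ω 0 t' ρ' b v) :
    RRep ω 0 t' ρ' K (fun ξ η => f (ξ + u ξ η) (η + v ξ η)) :=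
  Rep.comp hf ht' hρ' ha hb hta hρb hu hv

/-- First and second order remainders of a Taylor expansion along a curve `U + W`. -/
theorem RRep.remainder {s₁ : ℕ} {f u v w₁ w₂ : ℝ → ℝ → ℝ} (hf : RRep ω s t ρ K f)
    (ht' : 0 ≤ t') (hρ' : 0 < ρ') (ha : 0 < a) (hb : 0 < b) (hx : 0 < x) (hy : 0 < y) (hZ : 1 ≤ Z)
    (hta : t' + freqBound ω * (a + Z * x) ≤ t) (hρb : ρ' + (b + Z * y) ≤ ρ)
    (hu : RRep ω 0 t' ρ' a u) (hv : RRep ω 0 t' ρ' b v) (hw₁ : RRep ω s₁ t' ρ' x w₁)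
    (hw₂ : RRep ω s₁ t' ρ' y w₂) :
    RRep ω s₁ t' ρ' (K / Z) (fun ξ η =>
      f (ξ + u ξ η + w₁ ξ η) (η + v ξ η + w₂ ξ η) - f (ξ + u ξ η) (η + v ξ η)) ∧
    RRep ω (s₁ * 2) t' ρ' (K / Z ^ 2) (fun ξ η =>
      f (ξ + u ξ η + w₁ ξ η) (η + v ξ η + w₂ ξ η) - f (ξ + u ξ η) (η + v ξ η) -
        (dX f (ξ + u ξ η) (η + v ξ η) * w₁ ξ η + dY f (ξ + u ξ η) (η + v ξ η) * w₂ ξ η)) := by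
  have hZ0 : 0 < Z := by linarith
  have hΩ := freqBound_pos (ω := ω)
  obtain ⟨T, κ, hT, hκ, hsum, hrem⟩ := Rep.remainder hf ht' hρ' ha hb hx hy hZ hta hρb hu hv hw₁ hw₂
  have hd : ∀ ξ η : ℝ, |η| < ρ' → T (0, 0) (ξ + u ξ η) (η + v ξ η) = f (ξ + u ξ η) (η + v ξ η) ∧
      T (1, 0) (ξ + u ξ η) (η + v ξ η) = dX f (ξ + u ξ η) (η + v ξ η) ∧
      T (0, 1) (ξ + u ξ η) (η + v ξ η) = dY f (ξ + u ξ η) (η + v ξ η) := fun ξ η hη => by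
    have h1 := hv.abs_le ht' ξ hη
    have h2 := abs_add_le η (v ξ η)
    have h3 : |η + v ξ η| < ρ' + b := by linarith
    exact (taylor_deriv (T := fun q => T q (ξ + u ξ η) (η + v ξ η)) (by positivity)
      (by positivity) hκ (fun q => (hT q).norm_le (by positivity) _ h3)
      fun x y hx hy => hsum _ _ x y h3 hx hy).2
  constructor
  · refine (((hrem {(0, 0)} 1 ?_).mono_const (by rw [pow_one])).mono_order
      (Nat.mul_one s₁).ge).congr fun ξ η hη => ?_
    · rintro ⟨n, l⟩ hq
      by_contra hlt
      have : n = 0 ∧ l = 0 := by simp only at hlt; omega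
      exact hq (by simp [this.1, this.2])
    · simp [(hd ξ η hη).1]
  · refine (hrem {(0, 0), (1, 0), (0, 1)} 2 ?_).congr fun ξ η hη => ?_
    · rintro ⟨n, l⟩ hq
      by_contra hlt
      have : (n = 0 ∧ l = 0) ∨ (n = 1 ∧ l = 0) ∨ (n = 0 ∧ l = 1) := by simp only at hlt; omega
      apply hq
      rcases this with ⟨h1, h2⟩ | ⟨h1, h2⟩ | ⟨h1, h2⟩ <;> simp [h1, h2]
    · rw [Finset.sum_insert (by simp), Finset.sum_insert (by simp), Finset.sum_singleton,
        (hd ξ η hη).1, (hd ξ η hη).2.1, (hd ξ η hη).2.2]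
      push_cast
      ring

end QPReversible

end

/-! ### Means along orbits, orders of vanishing, and the homological equation. -/

noncomputable section

namespace QPReversible

open Filter Topology Asymptotics

variable {m : ℕ} {ω : Fin m → ℝ} {γ : ℝ}

/-! ### Discrete means -/

theorem tendsto_geom_mean {z : ℂ} (hz : ‖z‖ = 1) (hz1 : z ≠ 1) :
    Tendsto (fun N : ℕ => (N : ℂ)⁻¹ * ∑ n ∈ Finset.range N, z ^ n) atTop (𝓝 0) := by
  have hz2 : z - 1 ≠ 0 := sub_ne_zero.2 hz1
  refine squeeze_zero_norm (a := fun N : ℕ => (N : ℝ)⁻¹ * (2 / ‖z - 1‖)) (fun N => ?_) ?_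
  · rw [geom_sum_eq hz1, norm_mul, norm_inv, Complex.norm_natCast, norm_div]
    refine mul_le_mul_of_nonneg_left ?_ (by positivity)
    refine div_le_div_of_nonneg_right ((norm_sub_le _ _).trans ?_) (norm_nonneg _)
    simp [hz]; norm_num
  · simpa using (tendsto_inv_atTop_nhds_zero_nat (𝕜 := ℝ)).mul_const (2 / ‖z - 1‖)

/-- The means of `H` along the orbits of the rotation converge to the constant coefficient,
uniformly. -/
theorem mean_zero_coeff (hγ : ∀ k : Fin m → ℤ, k ≠ 0 → mode ω k γ ≠ 1) {b : (Fin m → ℤ) → ℂ}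
    (hb : Summable fun j => ‖b j‖) {H : ℝ → ℂ} (hH : ∀ ξ, HasSum (fun j => b j * mode ω j ξ) (H ξ))
    {ε : ℝ} (hε : 0 < ε) :
    ∃ N₀ : ℕ, ∀ N ≥ N₀, ∀ ξ,
      ‖(N : ℂ)⁻¹ * ∑ n ∈ Finset.range N, H (ξ + n * γ) - b 0‖ ≤ ε := by
  classical
  set A : ℕ → (Fin m → ℤ) → ℂ := fun N j => (N : ℂ)⁻¹ * ∑ n ∈ Finset.range N, mode ω j γ ^ n with hA
  set e : (Fin m → ℤ) → ℂ := Pi.single 0 1 with he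
  have hA1 : ∀ N j, ‖A N j‖ ≤ 1 := fun N j => by
    rw [hA, norm_mul, norm_inv, Complex.norm_natCast]
    have h1 : ‖∑ n ∈ Finset.range N, mode ω j γ ^ n‖ ≤ N := by
      refine (norm_sum_le _ _).trans ?_
      simp [norm_mode]
    rcases Nat.eq_zero_or_pos N with h0 | h0
    · simp [h0]
    · have : (0 : ℝ) < N := by exact_mod_cast h0
      rw [inv_mul_le_iff₀ this]; simpa using h1
  have he1 : ∀ j, ‖e j‖ ≤ 1 := fun j => by
    by_cases hj : j = 0
    · subst hj; simp [he]
    · simp [he, Pi.single_eq_of_ne hj]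
  -- Modes have modulus one, so this bound for the error does not contain `ξ`; dominated convergence
  -- then gives one `N₀` for all `ξ`.
  have hlim : Tendsto (fun N => ∑' j, ‖b j‖ * ‖A N j - e j‖) atTop (𝓝 (∑' _ : Fin m → ℤ, (0 : ℝ))) := by
    refine tendsto_tsum_of_dominated_convergence (bound := fun j => ‖b j‖ * 2) (hb.mul_right 2)
      (fun j => ?_) (Eventually.of_forall fun N j => ?_)
    · have : Tendsto (fun N => A N j) atTop (𝓝 (e j)) := by
        by_cases hj : j = 0
        · subst hj
          refine tendsto_const_nhds.congr' ?_
          filter_upwards [eventually_gt_atTop 0] with N hN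
          have : (N : ℂ) ≠ 0 := by exact_mod_cast hN.ne'
          simp [hA, he, mode_zero, this]
        · rw [he, Pi.single_eq_of_ne hj]
          exact tendsto_geom_mean (norm_mode j γ) (hγ j hj)
      have h2 := ((this.sub_const (e j)).norm).const_mul ‖b j‖
      simpa using h2
    · rw [norm_mul, norm_norm, norm_norm]
      refine mul_le_mul_of_nonneg_left ((norm_sub_le _ _).trans ?_) (norm_nonneg _)
      linarith [hA1 N j, he1 j]
  rw [tsum_zero] at hlim
  obtain ⟨N₀, hN₀⟩ := eventually_atTop.1 (hlim.eventually (Iio_mem_nhds hε))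
  refine ⟨N₀, fun N hN ξ => ?_⟩
  have h1 : HasSum (fun j => b j * mode ω j ξ * A N j)
      ((N : ℂ)⁻¹ * ∑ n ∈ Finset.range N, H (ξ + n * γ)) := by
    have := (hasSum_sum (s := Finset.range N) fun n _ => hH (ξ + n * γ)).mul_left (N : ℂ)⁻¹
    refine this.congr_fun fun j => ?_
    simp only [hA]
    rw [mul_left_comm, ← mul_assoc, Finset.mul_sum, Finset.mul_sum]
    refine Finset.sum_congr rfl fun n _ => ?_
    rw [mode_apply_add, mode_apply_nat_mul]; ring
  have h2 : HasSum (fun j => b j * mode ω j ξ * e j) (b 0) := by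
    have := hasSum_single (f := fun j => b j * mode ω j ξ * e j) 0 fun j hj => by
      simp [he, Pi.single_eq_of_ne hj]
    simpa [he, mode_zero] using this
  have h3 := h1.sub h2
  rw [← h3.tsum_eq]
  have h4 : Summable fun j => ‖b j‖ * ‖A N j - e j‖ := by
    refine Summable.of_nonneg_of_le (fun j => by positivity) (fun j => ?_) (hb.mul_right 2)
    refine mul_le_mul_of_nonneg_left ((norm_sub_le _ _).trans ?_) (norm_nonneg _)
    linarith [hA1 N j, he1 j]
  refine (tsum_of_norm_bounded h4.hasSum fun j => ?_).trans (hN₀ N hN).le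
  rw [← mul_sub, norm_mul, norm_mul, norm_mode, mul_one]

/-- A coefficient is bounded by a mean of `|H|` along an orbit of the rotation. -/
theorem norm_coeff_le_mean (hγ : ∀ k : Fin m → ℤ, k ≠ 0 → mode ω k γ ≠ 1) {b : (Fin m → ℤ) → ℂ}
    (hb : Summable fun j => ‖b j‖) {H : ℝ → ℂ} (hH : ∀ ξ, HasSum (fun j => b j * mode ω j ξ) (H ξ))
    (j : Fin m → ℤ) {ε : ℝ} (hε : 0 < ε) :
    ∃ N : ℕ, ∀ ξ δ, (∀ n < N, ‖H (ξ + n * γ)‖ ≤ δ) → ‖b j‖ ≤ ε + δ := by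
  have h1 : Summable fun i => ‖b (i + j)‖ :=
    (Equiv.addRight j).summable_iff (f := fun i => ‖b i‖) |>.2 hb
  have h2 : ∀ ξ, HasSum (fun i => b (i + j) * mode ω i ξ) (H ξ * mode ω (-j) ξ) := fun ξ => by
    have e1 : HasSum (fun i => b (i + j) * mode ω (i + j) ξ) (H ξ) :=
      (Equiv.addRight j).hasSum_iff (f := fun i => b i * mode ω i ξ) |>.2 (hH ξ)
    have e2 : HasSum (fun i => b (i + j) * mode ω (i + j) ξ * mode ω (-j) ξ) (H ξ * mode ω (-j) ξ) :=
      e1.mul_right _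
    have hm : ∀ i, mode ω (i + j) ξ * mode ω (-j) ξ = mode ω i ξ := fun i => by
      rw [← mode_add, add_neg_cancel_right]
    simpa only [mul_assoc, hm] using e2
  -- Multiplication by `mode ω (-j)` has moved the coefficient `b j` to index zero. As `N₀` is
  -- uniform, `ξ` and `δ` may be chosen after it; `N₀ + 1` keeps the divisor nonzero.
  obtain ⟨N₀, hN₀⟩ := mean_zero_coeff hγ h1 h2 hε
  refine ⟨N₀ + 1, fun ξ δ hδ => ?_⟩
  have h3 := hN₀ (N₀ + 1) (by omega) ξ
  have h4 : ‖((N₀ + 1 : ℕ) : ℂ)⁻¹ * ∑ n ∈ Finset.range (N₀ + 1),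
      H (ξ + n * γ) * mode ω (-j) (ξ + n * γ)‖ ≤ δ := by
    rw [norm_mul, norm_inv, Complex.norm_natCast, inv_mul_le_iff₀ (by positivity)]
    refine (norm_sum_le _ _).trans ((Finset.sum_le_card_nsmul _ _ δ fun n hn => ?_).trans ?_)
    · rw [norm_mul, norm_mode, mul_one]; exact hδ n (Finset.mem_range.1 hn)
    · simp
  have h5 := norm_sub_le (((N₀ + 1 : ℕ) : ℂ)⁻¹ * ∑ n ∈ Finset.range (N₀ + 1),
      H (ξ + n * γ) * mode ω (-j) (ξ + n * γ)) (((N₀ + 1 : ℕ) : ℂ)⁻¹ * ∑ n ∈ Finset.range (N₀ + 1),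
      H (ξ + n * γ) * mode ω (-j) (ξ + n * γ) - b (0 + j))
  rw [sub_sub_cancel, zero_add] at h5
  rw [zero_add] at h3
  linarith

/-- Values on the forward orbit of `0` alone determine the Fourier coefficients, since those are
limits of means along it. The symmetry of the conjugacy is later deduced from this orbit. -/
theorem coeff_eq_zero (hγ : ∀ k : Fin m → ℤ, k ≠ 0 → mode ω k γ ≠ 1) {b : (Fin m → ℤ) → ℂ}
    (hb : Summable fun j => ‖b j‖) {H : ℝ → ℂ} (hH : ∀ ξ, HasSum (fun j => b j * mode ω j ξ) (H ξ))
    (h0 : ∀ n : ℕ, H (n * γ) = 0) (j : Fin m → ℤ) : b j = 0 := by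
  refine norm_le_zero_iff.1 (le_of_forall_pos_le_add fun ε hε => ?_)
  obtain ⟨N, hN⟩ := norm_coeff_le_mean hγ hb hH j hε
  have := hN 0 0 fun n _ => by simp [h0]
  linarith

/-! ### Orders of vanishing -/

/-- The neighbourhoods of the axis `η = 0`, uniform in `ξ`. -/
def nearAxis : Filter (ℝ × ℝ) := comap Prod.snd (𝓝 0)

theorem eventually_nearAxis {P : ℝ × ℝ → Prop} :
    (∀ᶠ p in nearAxis, P p) ↔ ∃ δ > 0, ∀ ξ η : ℝ, |η| < δ → P (ξ, η) := by
  rw [nearAxis, (Metric.nhds_basis_ball.comap Prod.snd).eventually_iff]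
  simp

/-- `h = O(η ^ s)` uniformly in `ξ`. -/
def OrdU (s : ℕ) (h : ℝ → ℝ → ℝ) : Prop :=
  (fun p : ℝ × ℝ => h p.1 p.2) =O[nearAxis] fun p => p.2 ^ s

theorem ordU_iff {s : ℕ} {h : ℝ → ℝ → ℝ} :
    OrdU s h ↔ ∃ C > 0, ∃ δ > 0, ∀ ξ η : ℝ, |η| < δ → |h ξ η| ≤ C * |η| ^ s := by
  unfold OrdU
  rw [isBigO_iff']
  simp only [eventually_nearAxis, Real.norm_eq_abs, abs_pow]

theorem Rep.norm_le_pow {s : ℕ} {t ρ K : ℝ} {h : ℝ → ℝ → ℂ} (hh : Rep ω s t ρ K h) (ht : 0 ≤ t)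
    (hρ : 0 < ρ) (ξ : ℝ) {η : ℝ} (hη : |η| < ρ) : ‖h ξ η‖ ≤ (|η| / ρ) ^ s * K := by
  obtain ⟨c, hc⟩ := hh
  rw [← (hc.hasSum ξ η hη).tsum_eq]
  have h1 : |η| / ρ ≤ 1 := (div_le_one hρ).2 hη.le
  refine (tsum_of_norm_bounded (hc.summable.hasSum.mul_left ((|η| / ρ) ^ s)) fun p => ?_).trans
    (mul_le_mul_of_nonneg_left hc.le (by positivity))
  by_cases hp : p.1 < s
  · simp [hc.low p hp]
  · rw [norm_mul, basic, norm_mul, norm_mode, norm_pow, Complex.norm_real, Real.norm_eq_abs, one_mul,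
      weight, mul_left_comm]
    refine mul_le_mul_of_nonneg_left ?_ (norm_nonneg _)
    have h2 : 1 ≤ Real.exp (t * order p.2) := Real.one_le_exp (mul_nonneg ht (order_nonneg _))
    calc |η| ^ p.1 = (|η| / ρ) ^ p.1 * ρ ^ p.1 := by
          rw [div_pow, div_mul_cancel₀ _ (by positivity)]
      _ ≤ (|η| / ρ) ^ s * ρ ^ p.1 := mul_le_mul_of_nonneg_right
          (pow_le_pow_of_le_one (by positivity) h1 (by omega)) (by positivity)
      _ ≤ (|η| / ρ) ^ s * (Real.exp (t * order p.2) * ρ ^ p.1) :=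
          mul_le_mul_of_nonneg_left (le_mul_of_one_le_left (by positivity) h2) (by positivity)

theorem RRep.ordU {s : ℕ} {t ρ K : ℝ} {h : ℝ → ℝ → ℝ} (hh : RRep ω s t ρ K h) (ht : 0 ≤ t)
    (hρ : 0 < ρ) : OrdU s h := by
  refine IsBigO.of_bound (K / ρ ^ s) (eventually_nearAxis.2 ⟨ρ, hρ, fun ξ η hη => ?_⟩)
  have := Rep.norm_le_pow hh ht hρ ξ hη
  rw [Complex.norm_real] at this
  refine this.trans (le_of_eq ?_)
  rw [div_pow, norm_pow, Real.norm_eq_abs]; ring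

/-- The coefficients of a power series that is `O(η ^ s)`. -/
theorem coeff_eq_zero_of_isBigO {a : ℕ → ℂ} {ρ : ℝ} (hρ : 0 < ρ)
    (ha : Summable fun k => ‖a k‖ * ρ ^ k) {h : ℝ → ℂ}
    (hs : ∀ η : ℝ, |η| < ρ → HasSum (fun k => a k * (η : ℂ) ^ k) (h η)) {s : ℕ}
    (hO : h =O[𝓝 0] fun η : ℝ => η ^ s) : ∀ k < s, a k = 0 := by
  intro k
  induction k using Nat.strong_induction_on with
  | _ k ih =>
    intro hk
    have h1 : (fun η : ℝ => h η - a k * (η : ℂ) ^ k) =O[𝓝 0] fun η : ℝ => η ^ (k + 1) := by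
      refine IsBigO.of_bound (∑' i, ‖a i‖ * ρ ^ i / ρ ^ (k + 1)) ?_
      filter_upwards [Metric.ball_mem_nhds (0 : ℝ) hρ] with η hη
      have hη' : |η| < ρ := by simpa using hη
      have hq : |η| / ρ ≤ 1 := (div_le_one hρ).2 hη'.le
      have h2 := HasSum.sub_finset (hs η hη') {k}
      rw [Finset.sum_singleton] at h2
      rw [← h2.tsum_eq, ← tsum_mul_right]
      have hsm : Summable fun i => ‖a i‖ * ρ ^ i / ρ ^ (k + 1) * ‖η ^ (k + 1)‖ :=
        (ha.div_const _).mul_right _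
      refine tsum_of_norm_bounded hsm.hasSum fun i => ?_
      split_ifs with hi
      · rw [norm_zero]; positivity
      · rcases lt_or_ge i k with hik | hik
        · rw [ih i hik (by omega)]; simp
        · have hik' : k + 1 ≤ i := by
            have : i ≠ k := by simpa using hi
            omega
          rw [norm_mul, norm_pow, norm_pow, Complex.norm_real, Real.norm_eq_abs, mul_div_assoc,
            mul_assoc]
          refine mul_le_mul_of_nonneg_left ?_ (norm_nonneg _)
          calc |η| ^ i = ρ ^ i * (|η| / ρ) ^ i := by
                rw [div_pow, mul_div_cancel₀ _ (by positivity)]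
            _ ≤ ρ ^ i * (|η| / ρ) ^ (k + 1) := mul_le_mul_of_nonneg_left
                (pow_le_pow_of_le_one (by positivity) hq hik') (by positivity)
            _ = _ := by rw [div_pow]; ring
    have h2 : h =O[𝓝 0] fun η : ℝ => η ^ (k + 1) := by
      refine hO.trans (IsBigO.of_bound 1 ?_)
      filter_upwards [Metric.ball_mem_nhds (0 : ℝ) one_pos] with η hη
      rw [one_mul, norm_pow, norm_pow]
      exact pow_le_pow_of_le_one (norm_nonneg _) (by simpa using (mem_ball_zero_iff.1 hη).le) hk
    have h3 : (fun η : ℝ => a k * (η : ℂ) ^ k) =O[𝓝 0] fun η : ℝ => η ^ (k + 1) :=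
      (h2.sub h1).congr_left fun η => by ring
    obtain ⟨C, hC0, hC⟩ := h3.exists_pos
    have hC' := hC.bound
    refine norm_le_zero_iff.1 (le_of_forall_pos_le_add fun ε hε => ?_)
    rw [zero_add]
    obtain ⟨δ, hδ, hδ'⟩ := Metric.eventually_nhds_iff.1 hC'
    set η := min (δ / 2) (ε / C) with hηd
    have hη0 : 0 < η := lt_min (by positivity) (by positivity)
    have h4 := hδ' (y := η) (by
      rw [Real.dist_eq, sub_zero, abs_of_pos hη0]
      exact (min_le_left _ _).trans_lt (by linarith))
    rw [norm_mul, norm_pow, norm_pow, Complex.norm_real, Real.norm_eq_abs, abs_of_pos hη0, pow_succ,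
      mul_left_comm, mul_comm] at h4
    have h5 := le_of_mul_le_mul_left h4 (by positivity)
    refine h5.trans ?_
    have := (min_le_right (δ / 2) (ε / C))
    rw [← hηd, le_div_iff₀ hC0] at this
    linarith

/-- For each `ξ` the series in `η` has no terms below degree `s`; by uniqueness of Fourier
coefficients the `c p` of these degrees vanish. No uniformity in `ξ` is required and `K` is kept, so
that order alone, through `Rep.shrink`, becomes a gain in size. -/
theorem HasCoeffs.upgrade {s : ℕ} {t ρ K : ℝ} {h : ℝ → ℝ → ℂ} {c : ℕ × (Fin m → ℤ) → ℂ}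
    (hγ : ∀ k : Fin m → ℤ, k ≠ 0 → mode ω k γ ≠ 1) (ht : 0 ≤ t) (hρ : 0 < ρ)
    (hc : HasCoeffs ω 0 t ρ K h c)
    (hO : ∀ ξ, (fun η : ℝ => h ξ η) =O[𝓝 0] fun η : ℝ => η ^ s) : HasCoeffs ω s t ρ K h c := by
  refine ⟨fun p hp => ?_, hc.summable, hc.le, hc.hasSum⟩
  have hnn : ∀ p, 0 ≤ ‖c p‖ * weight t ρ p := fun p =>
    mul_nonneg (norm_nonneg _) (weight_nonneg hρ.le p)
  have hle : ∀ k j, ‖c (k, j)‖ * ρ ^ k ≤ ‖c (k, j)‖ * weight t ρ (k, j) := fun k j => by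
    refine mul_le_mul_of_nonneg_left ?_ (norm_nonneg _)
    exact le_mul_of_one_le_left (by positivity)
      (Real.one_le_exp (mul_nonneg ht (order_nonneg _)))
  have hk : ∀ k, Summable fun j => ‖c (k, j)‖ := fun k => by
    have h1 := (hc.summable.prod_factor k).mul_right (ρ ^ k)⁻¹
    refine Summable.of_nonneg_of_le (fun j => norm_nonneg _) (fun j => ?_) h1
    rw [← div_eq_mul_inv, le_div_iff₀ (by positivity)]
    exact hle k j
  have hsum : Summable fun k => ‖∑' j, c (k, j)‖ * ρ ^ k := by
    refine Summable.of_nonneg_of_le (fun k => by positivity) (fun k => ?_)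
      ((summable_prod_of_nonneg hnn).1 hc.summable).2
    calc ‖∑' j, c (k, j)‖ * ρ ^ k ≤ (∑' j, ‖c (k, j)‖) * ρ ^ k :=
          mul_le_mul_of_nonneg_right (norm_tsum_le_tsum_norm (hk k)) (by positivity)
      _ = ∑' j, ‖c (k, j)‖ * ρ ^ k := tsum_mul_right.symm
      _ ≤ _ := ((hk k).mul_right _).tsum_le_tsum (hle k) (hc.summable.prod_factor k)
  have hmode : ∀ ξ k, Summable fun j => c (k, j) * mode ω j ξ := fun ξ k =>
    Summable.of_norm_bounded (hk k) fun j => by rw [norm_mul, norm_mode, mul_one]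
  have hsum' : ∀ ξ, Summable fun k => ‖∑' j, c (k, j) * mode ω j ξ‖ * ρ ^ k := fun ξ => by
    refine Summable.of_nonneg_of_le (fun k => by positivity) (fun k => ?_)
      ((summable_prod_of_nonneg hnn).1 hc.summable).2
    calc ‖∑' j, c (k, j) * mode ω j ξ‖ * ρ ^ k ≤ (∑' j, ‖c (k, j)‖) * ρ ^ k := by
          refine mul_le_mul_of_nonneg_right (tsum_of_norm_bounded (hk k).hasSum fun j => ?_)
            (by positivity)
          rw [norm_mul, norm_mode, mul_one]
      _ = ∑' j, ‖c (k, j)‖ * ρ ^ k := tsum_mul_right.symm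
      _ ≤ _ := ((hk k).mul_right _).tsum_le_tsum (hle k) (hc.summable.prod_factor k)
  have hzero : ∀ ξ, ∑' j, c (p.1, j) * mode ω j ξ = 0 := fun ξ => by
    refine coeff_eq_zero_of_isBigO hρ (hsum' ξ) (fun η hη => ?_) (hO ξ) p.1 hp
    refine HasSum.prod_fiberwise (hc.hasSum ξ η hη) fun k => ?_
    refine ((hmode ξ k).hasSum.mul_right ((η : ℂ) ^ k)).congr_fun fun j => ?_
    simp [basic, mul_assoc]
  exact coeff_eq_zero hγ (hk p.1) (H := fun _ => 0)
    (fun ξ => by rw [← hzero ξ]; exact (hmode ξ p.1).hasSum) (fun _ => rfl) p.2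

theorem OrdU.isBigO {s : ℕ} {h : ℝ → ℝ → ℝ} (hh : OrdU s h) (ξ : ℝ) :
    (fun η : ℝ => h ξ η) =O[𝓝 0] fun η : ℝ => η ^ s := by
  have : Tendsto (fun η : ℝ => (ξ, η)) (𝓝 0) nearAxis := by
    rw [nearAxis, tendsto_comap_iff]; exact tendsto_id
  exact hh.comp_tendsto this

theorem RRep.upgrade {s : ℕ} {t ρ K : ℝ} {h : ℝ → ℝ → ℝ}
    (hγ : ∀ k : Fin m → ℤ, k ≠ 0 → mode ω k γ ≠ 1)
    (ht : 0 ≤ t) (hρ : 0 < ρ) (hh : RRep ω 0 t ρ K h)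
    (hO : ∀ ξ, (fun η : ℝ => h ξ η) =O[𝓝 0] fun η : ℝ => η ^ s) : RRep ω s t ρ K h :=
  hh.imp fun _ hc => hc.upgrade hγ ht hρ fun ξ =>
    Complex.isBigO_ofReal_left.2 (hO ξ)

/-! ### The homological equation -/

/-- The small divisors of the rotation by `γ` decay at most polynomially. -/
def SmallDivisors (ω : Fin m → ℝ) (γ C₀ : ℝ) (τ : ℕ) : Prop :=
  0 < C₀ ∧ ∀ k : Fin m → ℤ, k ≠ 0 → 1 ≤ C₀ * order k ^ τ * ‖mode ω k γ - 1‖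

theorem SmallDivisors.ne_one {C₀ : ℝ} {τ : ℕ} (h : SmallDivisors ω γ C₀ τ) (k : Fin m → ℤ)
    (hk : k ≠ 0) : mode ω k γ ≠ 1 := fun h1 => by
  have := h.2 k hk
  rw [h1] at this; simp at this; linarith

/-- The inequality `x ^ τ / τ! ≤ exp x` at `x = δ |k|` exchanges polynomial growth for a loss `δ` of
the strip. -/
theorem SmallDivisors.inv_le {C₀ : ℝ} {τ : ℕ} (h : SmallDivisors ω γ C₀ τ) (k : Fin m → ℤ)
    (hk : k ≠ 0) {δ : ℝ} (hδ : 0 < δ) :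
    ‖(mode ω k γ - 1)⁻¹‖ ≤ C₀ * τ.factorial / δ ^ τ * Real.exp (δ * order k) := by
  have h1 := h.2 k hk
  have hpos : 0 < ‖mode ω k γ - 1‖ := norm_pos_iff.2 (sub_ne_zero.2 (h.ne_one k hk))
  have hC := h.1
  have h2 := Real.pow_div_factorial_le_exp (δ * order k) (mul_nonneg hδ.le (order_nonneg k)) τ
  rw [div_le_iff₀ (by positivity), mul_pow] at h2
  rw [norm_inv, inv_le_iff_one_le_mul₀ hpos]
  refine h1.trans (mul_le_mul_of_nonneg_right ?_ hpos.le)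
  rw [div_mul_eq_mul_div, le_div_iff₀ (by positivity)]
  calc C₀ * order k ^ τ * δ ^ τ = C₀ * (δ ^ τ * order k ^ τ) := by ring
    _ ≤ C₀ * (Real.exp (δ * order k) * τ.factorial) := mul_le_mul_of_nonneg_left h2 hC.le
    _ = _ := by ring

/-- The coefficients of the mean. -/
def meanCoeff (c : ℕ × (Fin m → ℤ) → ℂ) (p : ℕ × (Fin m → ℤ)) : ℂ :=
  open Classical in if p.2 = 0 then c p else 0

theorem Rep.mean {s : ℕ} {t ρ K : ℝ} {h : ℝ → ℝ → ℂ} {c : ℕ × (Fin m → ℤ) → ℂ}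
    (hc : HasCoeffs ω s t ρ K h c) (ht : 0 ≤ t) (hρ : 0 < ρ) :
    HasCoeffs ω s t ρ K (fun _ η => ∑' p, meanCoeff c p * basic ω 0 η p) (meanCoeff c) := by
  have := hc.of_le (h' := fun _ η => ∑' p, meanCoeff c p * basic ω 0 η p) (c' := meanCoeff c)
    (s' := s) ht hρ.le (fun p hp => by simp [meanCoeff, hc.low p hp]) zero_le_one
    (fun p => by
      have := weight_nonneg (t := t) hρ.le p
      unfold meanCoeff; split_ifs <;> simp; positivity)
    (fun ξ η hη hs => by
      have he : (fun p => meanCoeff c p * basic ω ξ η p) =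
          fun p => meanCoeff c p * basic ω 0 η p := by
        funext p
        by_cases hp : p.2 = 0
        · simp [basic, hp, mode_zero]
        · simp [meanCoeff, hp]
      rw [he] at hs ⊢
      exact hs.hasSum)
  simpa using this

/-- The homological equation `Y ∘ R - Y = B - [B]`. -/
theorem Rep.homological {C₀ : ℝ} {τ : ℕ} (hsd : SmallDivisors ω γ C₀ τ) {s : ℕ} {t ρ K t' : ℝ}
    {B : ℝ → ℝ → ℂ} (hB : Rep ω s t ρ K B) (hρ : 0 < ρ) (ht' : 0 ≤ t') (htt : t' < t) :
    ∃ (Y : ℝ → ℝ → ℂ) (Bm : ℝ → ℂ), Rep ω s t' ρ (C₀ * τ.factorial / (t - t') ^ τ * K) Y ∧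
      Rep ω s t ρ K (fun _ η => Bm η) ∧
      ∀ ξ η : ℝ, |η| < ρ → Y (ξ + γ) η - Y ξ η = B ξ η - Bm η := by
  classical
  obtain ⟨c, hc⟩ := hB
  have ht : 0 ≤ t := by linarith
  have hC₀ := hsd.1
  have htt0 : 0 < t - t' := by linarith
  have hm := Rep.mean hc ht hρ
  set d : ℕ × (Fin m → ℤ) → ℂ := fun p => if p.2 = 0 then 0 else c p * (mode ω p.2 γ - 1)⁻¹ with hd
  have hY := hc.of_le (h' := fun ξ η => ∑' p, d p * basic ω ξ η p) (c' := d) (s' := s)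
    (t' := t') (ρ' := ρ) (C := C₀ * τ.factorial / (t - t') ^ τ) ht' hρ.le
    (fun p hp => by simp [hd, hc.low p hp]) (by positivity)
    (fun p => by
      have hw := weight_nonneg (t := t) hρ.le p
      simp only [hd]
      split_ifs with hp
      · rw [norm_zero, zero_mul]; positivity
      · rw [norm_mul]
        calc ‖c p‖ * ‖(mode ω p.2 γ - 1)⁻¹‖ * weight t' ρ p ≤
            ‖c p‖ * (C₀ * τ.factorial / (t - t') ^ τ * Real.exp ((t - t') * order p.2)) *
              weight t' ρ p :=
              mul_le_mul_of_nonneg_right (mul_le_mul_of_nonneg_left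
                (hsd.inv_le p.2 hp htt0) (norm_nonneg _)) (weight_nonneg hρ.le p)
          _ = C₀ * τ.factorial / (t - t') ^ τ * (‖c p‖ * weight t ρ p) := by
              unfold weight
              rw [show t * order p.2 = (t - t') * order p.2 + t' * order p.2 by ring, Real.exp_add]
              ring)
    (fun ξ η hη hs => hs.hasSum)
  refine ⟨_, fun η => ∑' p, meanCoeff c p * basic ω 0 η p, ⟨d, hY⟩, ⟨_, hm⟩, fun ξ η hη => ?_⟩
  have h1 := (hY.hasSum (ξ + γ) η hη).sub (hY.hasSum ξ η hη)
  have h2 := (hc.hasSum ξ η hη).sub (hm.hasSum ξ η hη)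
  refine h1.unique (h2.congr_fun fun p => ?_)
  by_cases hp : p.2 = 0
  · simp [hd, meanCoeff, hp]
  · have := sub_ne_zero.2 (hsd.ne_one p.2 hp)
    simp only [hd, meanCoeff, hp, if_false, basic, mode_apply_add]
    field_simp
    ring

theorem RRep.homological {C₀ : ℝ} {τ : ℕ} (hsd : SmallDivisors ω γ C₀ τ) {s : ℕ} {t ρ K t' : ℝ}
    {B : ℝ → ℝ → ℝ} (hB : RRep ω s t ρ K B) (hρ : 0 < ρ) (ht' : 0 ≤ t') (htt : t' < t) :
    ∃ (Y : ℝ → ℝ → ℝ) (Bm : ℝ → ℝ), RRep ω s t' ρ (C₀ * τ.factorial / (t - t') ^ τ * K) Y ∧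
      RRep ω s t ρ K (fun _ η => Bm η) ∧
      ∀ ξ η : ℝ, |η| < ρ → Y (ξ + γ) η - Y ξ η = B ξ η - Bm η := by
  obtain ⟨Y, Bm, h1, h2, h3⟩ := Rep.homological hsd hB hρ ht' htt
  refine ⟨fun ξ η => (Y ξ η).re, fun η => (Bm η).re, h1.re ht' hρ.le,
    h2.re (ht'.trans htt.le) hρ.le, fun ξ η hη => ?_⟩
  have := congrArg Complex.re (h3 ξ η hη)
  simpa using this

/-- A function with a small coboundary is close to its mean. -/
theorem RRep.near_mean (hγ : ∀ k : Fin m → ℤ, k ≠ 0 → mode ω k γ ≠ 1) {s : ℕ} {t ρ K : ℝ}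
    {h : ℝ → ℝ → ℝ} (hh : RRep ω 0 t ρ K h) (ht : 0 ≤ t) (hρ : 0 < ρ)
    (hO : OrdU s fun ξ η => h (ξ + γ) η - h ξ η) :
    ∃ hm : ℝ → ℝ, RRep ω 0 t ρ K (fun _ η => hm η) ∧ OrdU s fun ξ η => h ξ η - hm η := by
  obtain ⟨c, hc⟩ := hh
  have hm := Rep.mean hc ht hρ
  have hd : HasCoeffs ω 0 t ρ (2 * K) (fun ξ η => ((h (ξ + γ) η - h ξ η : ℝ) : ℂ))
      (fun p => c p * (mode ω p.2 γ - 1)) :=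
    hc.of_le ht hρ.le (fun p hp => absurd hp (by simp)) zero_le_two
      (fun p => by
        have hw := weight_nonneg (t := t) hρ.le p
        rw [norm_mul]
        have : ‖mode ω p.2 γ - 1‖ ≤ 2 := (norm_sub_le _ _).trans (by simp [norm_mode]; norm_num)
        calc _ ≤ ‖c p‖ * 2 * weight t ρ p := by gcongr
          _ = _ := by ring)
      (fun ξ η hη _ => by
        push_cast
        refine ((hc.hasSum (ξ + γ) η hη).sub (hc.hasSum ξ η hη)).congr_fun fun p => ?_
        simp only [basic, mode_apply_add]; ring)
  -- The coboundary has coefficients `c p * (mode ω p.2 γ - 1)`, so its order kills `c p` at nonzero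
  -- frequencies in degree below `s`. Only nonvanishing of the divisors matters, not their size.
  have hlow := (hd.upgrade hγ ht hρ fun ξ =>
    Complex.isBigO_ofReal_left.2 (hO.isBigO ξ)).low
  have hr : HasCoeffs ω s t ρ (1 * K)
      (fun ξ η => (h ξ η : ℂ) - ∑' p, meanCoeff c p * basic ω 0 η p)
      (fun p => c p - meanCoeff c p) :=
    hc.of_le ht hρ.le
      (fun p hp => by
        by_cases hp2 : p.2 = 0
        · simp [meanCoeff, hp2]
        · have h1 := hlow p hp
          have h2 := (mul_eq_zero.1 h1).resolve_right (sub_ne_zero.2 (hγ p.2 hp2))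
          simp [meanCoeff, h2])
      zero_le_one
      (fun p => by
        have hw := weight_nonneg (t := t) hρ.le p
        by_cases hp2 : p.2 = 0
        · simp only [meanCoeff, hp2, if_true, sub_self, norm_zero, zero_mul]; positivity
        · simp [meanCoeff, hp2])
      (fun ξ η hη _ => by
        refine ((hc.hasSum ξ η hη).sub (hm.hasSum ξ η hη)).congr_fun fun p => ?_
        ring)
  refine ⟨fun η => (∑' p, meanCoeff c p * basic ω 0 η p).re, Rep.re ⟨_, hm⟩ ht hρ.le, ?_⟩
  have := (Rep.re ⟨_, hr⟩ ht hρ.le).ordU ht hρ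
  simpa using this

/-- A bound for the mean of a function that is a coboundary up to a small error. -/
theorem abs_mean_le {B Y Z H : ℝ → ℝ} {Bm y z δ : ℝ} (hY : ∀ ξ, |Y ξ| ≤ y) (hZ : ∀ ξ, |Z ξ| ≤ z)
    (hH : ∀ ξ, |H ξ| ≤ δ) (h1 : ∀ ξ, Y (ξ + γ) - Y ξ = B ξ - Bm)
    (h2 : ∀ ξ, B ξ = Z (ξ + γ) - Z ξ + H ξ) : |Bm| ≤ δ := by
  -- Both expressions of `B` are summed along the orbit of `0`. The coboundaries telescope to
  -- bounded terms, which disappear after division by `N`.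
  have htel : ∀ N : ℕ, N * Bm = (Z (N * γ) - Y (N * γ)) - (Z 0 - Y 0) +
      ∑ n ∈ Finset.range N, H (n * γ) := fun N => by
    induction N with
    | zero => simp
    | succ N ih =>
      rw [Finset.sum_range_succ]
      have e : ((N + 1 : ℕ) : ℝ) * γ = N * γ + γ := by push_cast; ring
      rw [e]
      have := h1 (N * γ)
      have := h2 (N * γ)
      push_cast
      linarith
  have hb : ∀ N : ℕ, N * |Bm| ≤ 2 * (z + y) + N * δ := fun N => by
    have e : N * |Bm| = |N * Bm| := by rw [abs_mul, Nat.abs_cast]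
    rw [e, htel]
    have hs : |∑ n ∈ Finset.range N, H (n * γ)| ≤ N * δ := by
      refine (Finset.abs_sum_le_sum_abs _ _).trans ((Finset.sum_le_card_nsmul _ _ δ
        fun n _ => hH _).trans ?_)
      simp
    have a1 := hZ (N * γ)
    have a2 := hY (N * γ)
    have a3 := hZ 0
    have a4 := hY 0
    rw [abs_le] at *
    constructor <;> linarith
  by_contra hlt
  push Not at hlt
  obtain ⟨N, hN⟩ := exists_nat_gt (2 * (z + y) / (|Bm| - δ))
  rw [div_lt_iff₀ (by linarith)] at hN
  have := hb N
  nlinarith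

end QPReversible

end

/-! ### Germs of quasi-periodic maps along the axis. -/

noncomputable section

namespace QPReversible

open Filter Topology Asymptotics

variable {m : ℕ} {ω : Fin m → ℝ} {γ : ℝ}

/-! ### Germs of analytic quasi-periodic functions -/

theorem isQPAnalytic_iff {f : ℝ → ℝ → ℝ} :
    IsQPAnalytic ω f ↔ ∃ t > 0, ∃ ρ > 0, ∃ K, RRep ω 0 t ρ K f := by
  constructor
  · rintro ⟨t, ht, ρ, hρ, c, hc, hs⟩
    refine ⟨t, ht, ρ, hρ, _, fun p => c p.1 p.2, fun p hp => absurd hp (by simp), ?_, le_rfl,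
      fun θ r hr => ?_⟩
    · simpa only [weight, mul_assoc] using hc
    · simpa only [basic, mul_assoc] using hs θ r hr
  · rintro ⟨t, ht, ρ, hρ, K, c, hc⟩
    refine ⟨t, ht, ρ, hρ, fun k j => c (k, j), ?_, fun θ r hr => ?_⟩
    · simpa only [weight, mul_assoc] using hc.summable
    · simpa only [basic, mul_assoc] using hc.hasSum θ r hr

theorem RRep.mono {s s' : ℕ} {t t' ρ ρ' K K' : ℝ} {f : ℝ → ℝ → ℝ} (hf : RRep ω s t ρ K f)
    (hs : s' ≤ s) (ht' : 0 ≤ t') (htt : t' ≤ t) (hρ' : 0 ≤ ρ') (hρρ : ρ' ≤ ρ) (hK : K ≤ K') :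
    RRep ω s' t' ρ' K' f :=
  Rep.mono hf hs ht' htt hρ' hρρ hK

theorem RRep.mono_const {s : ℕ} {t ρ K K' : ℝ} {f : ℝ → ℝ → ℝ} (hf : RRep ω s t ρ K f)
    (hK : K ≤ K') : RRep ω s t ρ K' f :=
  Rep.mono_const hf hK

theorem RRep.isQPAnalytic {s : ℕ} {t ρ K : ℝ} {f : ℝ → ℝ → ℝ} (hf : RRep ω s t ρ K f) (ht : 0 < t)
    (hρ : 0 < ρ) : IsQPAnalytic ω f :=
  isQPAnalytic_iff.2 ⟨t, ht, ρ, hρ, K, Rep.mono_order hf (Nat.zero_le _)⟩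

theorem IsQPAnalytic.exists_common {f g : ℝ → ℝ → ℝ} (hf : IsQPAnalytic ω f)
    (hg : IsQPAnalytic ω g) :
    ∃ t > 0, ∃ ρ > 0, ∃ K > 0, RRep ω 0 t ρ K f ∧ RRep ω 0 t ρ K g := by
  obtain ⟨t₁, ht₁, ρ₁, hρ₁, K₁, h₁⟩ := isQPAnalytic_iff.1 hf
  obtain ⟨t₂, ht₂, ρ₂, hρ₂, K₂, h₂⟩ := isQPAnalytic_iff.1 hg
  refine ⟨min t₁ t₂, lt_min ht₁ ht₂, min ρ₁ ρ₂, lt_min hρ₁ hρ₂, |K₁| + |K₂| + 1, by positivity,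
    h₁.mono le_rfl (by positivity) (min_le_left _ _) (by positivity) (min_le_left _ _) ?_,
    h₂.mono le_rfl (by positivity) (min_le_right _ _) (by positivity) (min_le_right _ _) ?_⟩
  · linarith [le_abs_self K₁, abs_nonneg K₂]
  · linarith [le_abs_self K₂, abs_nonneg K₁]

theorem IsQPAnalytic.congr {f g : ℝ → ℝ → ℝ} (hf : IsQPAnalytic ω f)
    (h : ∀ᶠ p : ℝ × ℝ in nearAxis, g p.1 p.2 = f p.1 p.2) : IsQPAnalytic ω g := by
  obtain ⟨t, ht, ρ, hρ, K, hK⟩ := isQPAnalytic_iff.1 hf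
  obtain ⟨δ, hδ, hδ'⟩ := eventually_nearAxis.1 h
  refine isQPAnalytic_iff.2 ⟨t, ht, min ρ δ, lt_min hρ hδ, K, ?_⟩
  exact (hK.mono le_rfl ht.le le_rfl (by positivity) (min_le_left _ _) le_rfl).congr
    fun θ r hr => hδ' θ r (hr.trans_le (min_le_right _ _))

theorem IsQPAnalytic.add {f g : ℝ → ℝ → ℝ} (hf : IsQPAnalytic ω f) (hg : IsQPAnalytic ω g) :
    IsQPAnalytic ω fun ξ η => f ξ η + g ξ η := by
  obtain ⟨t, ht, ρ, hρ, K, -, h₁, h₂⟩ := hf.exists_common hg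
  exact (h₁.add ht.le hρ.le h₂).isQPAnalytic ht hρ

theorem IsQPAnalytic.sub {f g : ℝ → ℝ → ℝ} (hf : IsQPAnalytic ω f) (hg : IsQPAnalytic ω g) :
    IsQPAnalytic ω fun ξ η => f ξ η - g ξ η := by
  obtain ⟨t, ht, ρ, hρ, K, -, h₁, h₂⟩ := hf.exists_common hg
  exact (h₁.sub ht.le hρ.le h₂).isQPAnalytic ht hρ

theorem IsQPAnalytic.mul {f g : ℝ → ℝ → ℝ} (hf : IsQPAnalytic ω f) (hg : IsQPAnalytic ω g) :
    IsQPAnalytic ω fun ξ η => f ξ η * g ξ η := by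
  obtain ⟨t, ht, ρ, hρ, K, -, h₁, h₂⟩ := hf.exists_common hg
  exact (h₁.mul ht.le hρ h₂).isQPAnalytic ht hρ

theorem IsQPAnalytic.const (a : ℝ) : IsQPAnalytic ω fun _ _ => a :=
  (RRep.const a).isQPAnalytic one_pos one_pos

theorem IsQPAnalytic.snd : IsQPAnalytic ω fun _ η => η :=
  RRep.isQPAnalytic (s := 1) (t := 1) (ρ := 1) (K := 1) Rep.snd one_pos one_pos

theorem IsQPAnalytic.shift {f : ℝ → ℝ → ℝ} (hf : IsQPAnalytic ω f) (γ : ℝ) :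
    IsQPAnalytic ω fun ξ η => f (ξ + γ) η := by
  obtain ⟨t, ht, ρ, hρ, K, hK⟩ := isQPAnalytic_iff.1 hf
  exact (hK.shift ht.le hρ.le γ).isQPAnalytic ht hρ

theorem IsQPAnalytic.finset_sum {β : Type*} (S : Finset β) {f : β → ℝ → ℝ → ℝ}
    (hf : ∀ b ∈ S, IsQPAnalytic ω (f b)) : IsQPAnalytic ω fun ξ η => ∑ b ∈ S, f b ξ η := by
  classical
  induction S using Finset.induction_on with
  | empty => simpa using IsQPAnalytic.const (ω := ω) 0
  | insert a S ha ih =>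
    simp only [Finset.sum_insert ha]
    exact (hf a (by simp)).add (ih fun b hb => hf b (by simp [hb]))

theorem IsQPAnalytic.pow {f : ℝ → ℝ → ℝ} (hf : IsQPAnalytic ω f) (n : ℕ) :
    IsQPAnalytic ω fun ξ η => f ξ η ^ n := by
  obtain ⟨t, ht, ρ, hρ, K, hK⟩ := isQPAnalytic_iff.1 hf
  exact (hK.pow ht.le hρ n).isQPAnalytic ht hρ

/-- The terms of degree zero sum to `h ξ 0 = 0` for every `ξ`, so deleting them leaves `h`
unchanged. This avoids uniqueness of coefficients and hence any condition on the rotation. -/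
theorem RRep.order_one {t ρ K : ℝ} {h : ℝ → ℝ → ℝ} (hh : RRep ω 0 t ρ K h) (ht : 0 ≤ t)
    (hρ : 0 < ρ) (h0 : ∀ ξ, h ξ 0 = 0) : RRep ω 1 t ρ K h := by
  obtain ⟨c, hc⟩ := hh
  have := hc.of_le (h' := fun ξ η => (h ξ η : ℂ)) (c' := fun p => if p.1 = 0 then 0 else c p)
    (s' := 1) ht hρ.le (fun p hp => by simp [Nat.lt_one_iff.1 hp]) zero_le_one
    (fun p => by
      have := weight_nonneg (t := t) hρ.le p
      split_ifs
      · rw [norm_zero, zero_mul]; positivity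
      · simp)
    (fun ξ η hη _ => by
      have h1 := (hc.hasSum ξ η hη).sub (hc.hasSum ξ 0 (by simpa using hρ))
      have h2 : HasSum (fun p => c p * basic ω ξ 0 p - if p.1 = 0 then c p * basic ω ξ 0 p else 0)
          0 := by
        refine hasSum_zero.congr_fun fun p => ?_
        by_cases hp : p.1 = 0 <;> simp [hp, basic]
      have h3 := h1.add h2
      simp only [h0, Complex.ofReal_zero, sub_zero, add_zero] at h3
      refine h3.congr_fun fun p => ?_
      by_cases hp : p.1 = 0 <;> simp [hp, basic])
  exact ⟨_, by simpa using this⟩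

theorem RRep.shrink {s : ℕ} {t ρ K ρ' q : ℝ} {h : ℝ → ℝ → ℝ} (hh : RRep ω s t ρ K h) (ht : 0 ≤ t)
    (hρ' : 0 ≤ ρ') (hρ : 0 ≤ ρ) (hq : q ≤ 1) (hq0 : 0 ≤ q) (hρρ : ρ' ≤ q * ρ) :
    RRep ω s t ρ' (q ^ s * K) h :=
  Rep.shrink hh ht hρ' hρ hq hq0 hρρ

theorem RRep.lipschitz {s : ℕ} {t ρ K ρ' : ℝ} {f : ℝ → ℝ → ℝ} (hf : RRep ω s t ρ K f) (ht : 0 < t)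
    (hρ' : 0 < ρ') (hρρ : ρ' < ρ) {p q : ℝ × ℝ} (hp : |p.2| < ρ') (hq : |q.2| < ρ') :
    |f p.1 p.2 - f q.1 q.2| ≤ (freqBound ω * K / t + K / (ρ - ρ')) * ‖p - q‖ := by
  obtain ⟨h1, h2⟩ := hf.deriv_bounds le_rfl ht hρ' hρρ
  rw [sub_zero] at h1
  have hconv : Convex ℝ {z : ℝ × ℝ | |z.2| < ρ'} := by
    have : {z : ℝ × ℝ | |z.2| < ρ'} = Prod.snd ⁻¹' (Metric.ball (0 : ℝ) ρ') := by ext z; simp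
    rw [this]
    exact (convex_ball (0 : ℝ) ρ').linear_preimage (LinearMap.snd ℝ ℝ ℝ)
  refine hconv.norm_image_sub_le_of_norm_hasFDerivWithin_le (f := fun z : ℝ × ℝ => f z.1 z.2)
    (f' := fun z => pairMap (dX f z.1 z.2) (dY f z.1 z.2))
    (fun z hz => (hf.hasFDerivAt ht z.1 ((show |z.2| < ρ' from hz).trans hρρ)).hasFDerivWithinAt)
    (fun z hz => ?_) hq hp
  have hz : |z.2| < ρ' := hz
  have a1 := h1.abs_le le_rfl z.1 hz
  have a2 := h2.abs_le le_rfl z.1 hz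
  refine ContinuousLinearMap.opNorm_le_bound _ (by
    linarith [abs_nonneg (dX f z.1 z.2), abs_nonneg (dY f z.1 z.2)]) fun w => ?_
  rw [pairMap_apply, Real.norm_eq_abs]
  have b1 : |w.1| ≤ ‖w‖ := norm_fst_le w
  have b2 : |w.2| ≤ ‖w‖ := norm_snd_le w
  calc |dX f z.1 z.2 * w.1 + dY f z.1 z.2 * w.2|
      ≤ |dX f z.1 z.2| * |w.1| + |dY f z.1 z.2| * |w.2| := by
        rw [← abs_mul, ← abs_mul]; exact abs_add_le _ _
    _ ≤ (freqBound ω * K / t) * ‖w‖ + (K / (ρ - ρ')) * ‖w‖ := by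
        gcongr
        · exact (abs_nonneg _).trans a1
        · exact (abs_nonneg _).trans a2
    _ = _ := by ring

theorem IsQPAnalytic.lipschitz {f : ℝ → ℝ → ℝ} (hf : IsQPAnalytic ω f) :
    ∃ L > 0, ∃ δ > 0, ∀ p q : ℝ × ℝ, |p.2| < δ → |q.2| < δ →
      |f p.1 p.2 - f q.1 q.2| ≤ L * ‖p - q‖ := by
  obtain ⟨t, ht, ρ, hρ, K, hK, hf', -⟩ := hf.exists_common hf
  have hΩ := freqBound_pos (ω := ω)
  refine ⟨freqBound ω * K / t + K / (ρ - ρ / 2), ?_, ρ / 2, by positivity, fun p q hp hq =>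
    hf'.lipschitz ht (by positivity) (by linarith) hp hq⟩
  have : 0 < ρ - ρ / 2 := by linarith
  positivity

theorem IsQPAnalytic.derivs {f : ℝ → ℝ → ℝ} (hf : IsQPAnalytic ω f) :
    IsQPAnalytic ω (dX f) ∧ IsQPAnalytic ω (dY f) := by
  obtain ⟨t, ht, ρ, hρ, K, hK⟩ := isQPAnalytic_iff.1 hf
  obtain ⟨h1, h2⟩ := hK.deriv_bounds (t' := t / 2) (ρ' := ρ / 2) (by positivity) (by linarith)
    (by positivity) (by linarith)
  exact ⟨h1.isQPAnalytic (by positivity) (by positivity),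
    h2.isQPAnalytic (by positivity) (by positivity)⟩

theorem IsQPAnalytic.hasFDerivAt {f : ℝ → ℝ → ℝ} (hf : IsQPAnalytic ω f) :
    ∀ᶠ p : ℝ × ℝ in nearAxis, HasFDerivAt (fun p : ℝ × ℝ => f p.1 p.2)
      (pairMap (dX f p.1 p.2) (dY f p.1 p.2)) p := by
  obtain ⟨t, ht, ρ, hρ, K, hK⟩ := isQPAnalytic_iff.1 hf
  exact eventually_nearAxis.2 ⟨ρ, hρ, fun ξ η hη => hK.hasFDerivAt ht ξ hη⟩

theorem OrdU.mono {s s' : ℕ} {h : ℝ → ℝ → ℝ} (hh : OrdU s h) (hs : s' ≤ s) : OrdU s' h := by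
  refine hh.trans (IsBigO.of_bound 1 (eventually_nearAxis.2 ⟨1, one_pos, fun ξ η hη => ?_⟩))
  rw [one_mul, norm_pow, norm_pow]
  exact pow_le_pow_of_le_one (norm_nonneg _) hη.le hs

theorem OrdU.mul {s s' : ℕ} {h h' : ℝ → ℝ → ℝ} (hh : OrdU s h) (hh' : OrdU s' h') :
    OrdU (s + s') fun ξ η => h ξ η * h' ξ η := by
  unfold OrdU
  simp only [pow_add]
  exact IsBigO.mul hh hh'

theorem OrdU.add {s : ℕ} {h h' : ℝ → ℝ → ℝ} (hh : OrdU s h) (hh' : OrdU s h') :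
    OrdU s fun ξ η => h ξ η + h' ξ η := IsBigO.add hh hh'

theorem OrdU.sub {s : ℕ} {h h' : ℝ → ℝ → ℝ} (hh : OrdU s h) (hh' : OrdU s h') :
    OrdU s fun ξ η => h ξ η - h' ξ η := IsBigO.sub hh hh'

theorem OrdU.congr {s : ℕ} {h h' : ℝ → ℝ → ℝ} (hh : OrdU s h)
    (he : ∀ᶠ p : ℝ × ℝ in nearAxis, h' p.1 p.2 = h p.1 p.2) : OrdU s h' :=
  hh.congr' (he.mono fun _ hp => hp.symm) EventuallyEq.rfl

theorem IsQPAnalytic.ordU_zero {f : ℝ → ℝ → ℝ} (hf : IsQPAnalytic ω f) : OrdU 0 f := by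
  obtain ⟨t, ht, ρ, hρ, K, hK⟩ := isQPAnalytic_iff.1 hf
  exact hK.ordU ht.le hρ

theorem IsQPAnalytic.ordU_one {f : ℝ → ℝ → ℝ} (hf : IsQPAnalytic ω f) (h0 : ∀ ξ, f ξ 0 = 0) :
    OrdU 1 f := by
  obtain ⟨t, ht, ρ, hρ, K, hK⟩ := isQPAnalytic_iff.1 hf
  exact (hK.order_one ht.le hρ h0).ordU ht.le hρ

theorem OrdU.apply_zero {s : ℕ} {h : ℝ → ℝ → ℝ} (hh : OrdU (s + 1) h) (ξ : ℝ) : h ξ 0 = 0 := by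
  obtain ⟨C, _, δ, hδ, hb⟩ := ordU_iff.1 hh
  have := hb ξ 0 (by simpa using hδ)
  simpa using this

/-! ### Analytic quasi-periodic maps that fix the axis -/

/-- `P = I + (u, v)` with `u`, `v` analytic quasi-periodic near the axis, and zero on it. -/
def QPMap (ω : Fin m → ℝ) (P : ℝ × ℝ → ℝ × ℝ) : Prop :=
  IsAnalyticQPPair ω (fun ξ η => (P (ξ, η)).1 - ξ) (fun ξ η => (P (ξ, η)).2 - η)

theorem qpMap_nearIdentity {u v : ℝ → ℝ → ℝ} :
    QPMap ω (nearIdentity u v) ↔ IsAnalyticQPPair ω u v := by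
  simp [QPMap, nearIdentity]

theorem QPMap.eq_nearIdentity {P : ℝ × ℝ → ℝ × ℝ} :
    P = nearIdentity (fun ξ η => (P (ξ, η)).1 - ξ) (fun ξ η => (P (ξ, η)).2 - η) := by
  funext p; simp [nearIdentity]

theorem QPMap.snd_ordU {P : ℝ × ℝ → ℝ × ℝ} (hP : QPMap ω P) :
    OrdU 1 fun ξ η => (P (ξ, η)).2 := by
  refine IsQPAnalytic.ordU_one ((hP.2.1.add IsQPAnalytic.snd).congr ?_) fun ξ => ?_
  · exact Eventually.of_forall fun p => by simp
  · simpa using (hP.2.2 ξ).2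

theorem QPMap.tendsto {P : ℝ × ℝ → ℝ × ℝ} (hP : QPMap ω P) : Tendsto P nearAxis nearAxis := by
  have h1 : (fun p => (P p).2) =O[nearAxis] fun p : ℝ × ℝ => p.2 := by
    simpa [OrdU] using hP.snd_ordU
  exact tendsto_comap_iff.2 (h1.trans_tendsto tendsto_comap)

/-- The increments of `P` vanish on the axis, so shrinking the radius by `q` multiplies their norms
by `q`. The choice of `q` fits them into half the strip and into the radius of `f`. -/
theorem IsQPAnalytic.comp {f : ℝ → ℝ → ℝ} (hf : IsQPAnalytic ω f) {P : ℝ × ℝ → ℝ × ℝ}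
    (hP : QPMap ω P) : IsQPAnalytic ω fun ξ η => f (P (ξ, η)).1 (P (ξ, η)).2 := by
  obtain ⟨t, ht, ρ, hρ, K, hK⟩ := isQPAnalytic_iff.1 hf
  obtain ⟨t₁, ht₁, ρ₁, hρ₁, K₁, hK₁, hu, hv⟩ := hP.1.exists_common hP.2.1
  have hΩ := freqBound_pos (ω := ω)
  have hu' := hu.order_one ht₁.le hρ₁ fun ξ => (hP.2.2 ξ).1
  have hv' := hv.order_one ht₁.le hρ₁ fun ξ => (hP.2.2 ξ).2
  set q := min 1 (min (t / (2 * (freqBound ω * K₁))) (ρ / (ρ₁ + K₁))) with hq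
  have hq0 : 0 < q := lt_min one_pos (lt_min (by positivity) (by positivity))
  have hq1 : q ≤ 1 := min_le_left _ _
  have hq2 : freqBound ω * (q * K₁) ≤ t / 2 := by
    have : q ≤ t / (2 * (freqBound ω * K₁)) := (min_le_right _ _).trans (min_le_left _ _)
    rw [le_div_iff₀ (by positivity)] at this
    linarith
  have hq3 : q * ρ₁ + q * K₁ ≤ ρ := by
    have : q ≤ ρ / (ρ₁ + K₁) := (min_le_right _ _).trans (min_le_right _ _)
    rw [le_div_iff₀ (by positivity)] at this
    linarith
  have hu2 := ((hu'.shrink ht₁.le (ρ' := q * ρ₁) (by positivity) hρ₁.le hq1 hq0.le le_rfl).mono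
    (t' := min t₁ (t / 2)) (Nat.zero_le _) (by positivity) (min_le_left _ _) (by positivity) le_rfl
    le_rfl)
  have hv2 := ((hv'.shrink ht₁.le (ρ' := q * ρ₁) (by positivity) hρ₁.le hq1 hq0.le le_rfl).mono
    (t' := min t₁ (t / 2)) (Nat.zero_le _) (by positivity) (min_le_left _ _) (by positivity) le_rfl
    le_rfl)
  rw [pow_one] at hu2 hv2
  have := hK.comp (by positivity) (by positivity) (by positivity) (by positivity)
    (by linarith [min_le_right t₁ (t / 2)]) hq3 hu2 hv2
  refine (this.congr fun ξ η _ => ?_).isQPAnalytic (lt_min ht₁ (by positivity)) (by positivity)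
  simp

theorem QPMap.comp {P Q : ℝ × ℝ → ℝ × ℝ} (hP : QPMap ω P) (hQ : QPMap ω Q) :
    QPMap ω (P ∘ Q) := by
  refine ⟨((hP.1.comp hQ).add hQ.1).congr (Eventually.of_forall fun p => ?_),
    ((hP.2.1.comp hQ).add hQ.2.1).congr (Eventually.of_forall fun p => ?_), fun ξ => ?_⟩
  · simp
  · simp
  · have h1 := hQ.2.2 ξ
    have h2 : Q (ξ, 0) = (ξ, 0) := Prod.ext (by linarith [h1.1]) (by linarith [h1.2])
    have h3 := hP.2.2 ξ
    simpa [h2] using h3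

/-- A rotation generally moves the points of the axis and so is not a `QPMap`, but conjugation by it
preserves the class. This allows the rotation to be factored out of conjugates of `M`. -/
theorem QPMap.conj_rotation {P : ℝ × ℝ → ℝ × ℝ} (hP : QPMap ω P) (γ : ℝ) :
    QPMap ω (fun p => rotation (-γ) (P (rotation γ p))) := by
  refine ⟨(hP.1.shift γ).congr (Eventually.of_forall fun p => ?_),
    (hP.2.1.shift γ).congr (Eventually.of_forall fun p => ?_), fun ξ => ?_⟩
  · simp [rotation]; ring
  · simp [rotation]
  · have := hP.2.2 (ξ + γ)
    simp only [rotation]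
    exact ⟨by linarith [this.1], this.2⟩

theorem QPMap.lipschitz {P : ℝ × ℝ → ℝ × ℝ} (hP : QPMap ω P) :
    ∃ L > 0, ∃ δ > 0, ∀ p q : ℝ × ℝ, |p.2| < δ → |q.2| < δ → ‖P p - P q‖ ≤ L * ‖p - q‖ := by
  obtain ⟨L₁, hL₁, δ₁, hδ₁, h₁⟩ := hP.1.lipschitz
  obtain ⟨L₂, hL₂, δ₂, hδ₂, h₂⟩ := hP.2.1.lipschitz
  refine ⟨1 + L₁ + L₂, by positivity, min δ₁ δ₂, lt_min hδ₁ hδ₂, fun p q hp hq => ?_⟩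
  have a1 := h₁ p q (hp.trans_le (min_le_left _ _)) (hq.trans_le (min_le_left _ _))
  have a2 := h₂ p q (hp.trans_le (min_le_right _ _)) (hq.trans_le (min_le_right _ _))
  have b1 : |p.1 - q.1| ≤ ‖p - q‖ := norm_fst_le (p - q)
  have b2 : |p.2 - q.2| ≤ ‖p - q‖ := norm_snd_le (p - q)
  have hn := norm_nonneg (p - q)
  have c1 := mul_nonneg hL₁.le hn
  have c2 := mul_nonneg hL₂.le hn
  rw [norm_prod_le_iff, Prod.fst_sub, Prod.snd_sub, Real.norm_eq_abs, Real.norm_eq_abs]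
  constructor
  · have e : (P p).1 - (P q).1 = (p.1 - q.1) + (((P (p.1, p.2)).1 - p.1) -
        ((P (q.1, q.2)).1 - q.1)) := by ring
    rw [e]
    refine (abs_add_le _ _).trans ?_
    nlinarith
  · have e : (P p).2 - (P q).2 = (p.2 - q.2) + (((P (p.1, p.2)).2 - p.2) -
        ((P (q.1, q.2)).2 - q.2)) := by ring
    rw [e]
    refine (abs_add_le _ _).trans ?_
    nlinarith

/-- The difference of two maps after composition with an analytic quasi-periodic map. -/
theorem QPMap.comp_sub_isBigO {P A B : ℝ × ℝ → ℝ × ℝ} (hP : QPMap ω P)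
    (hA : Tendsto A nearAxis nearAxis) (hB : Tendsto B nearAxis nearAxis) :
    (fun p => P (A p) - P (B p)) =O[nearAxis] fun p => A p - B p := by
  obtain ⟨L, hL, δ, hδ, h⟩ := hP.lipschitz
  have hmem : ∀ᶠ p in nearAxis, |p.2| < δ := eventually_nearAxis.2 ⟨δ, hδ, fun ξ η hη => hη⟩
  refine IsBigO.of_bound L ?_
  filter_upwards [hA.eventually hmem, hB.eventually hmem] with p h1 h2
  exact h _ _ h1 h2

/-- An analytic quasi-periodic map with an analytic quasi-periodic inverse germ. -/
def QPDiffeo (ω : Fin m → ℝ) (P : ℝ × ℝ → ℝ × ℝ) : Prop :=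
  QPMap ω P ∧ ∃ Q, QPMap ω Q ∧ (∀ᶠ p in nearAxis, Q (P p) = p) ∧ ∀ᶠ p in nearAxis, P (Q p) = p

theorem QPDiffeo.comp {P Q : ℝ × ℝ → ℝ × ℝ} (hP : QPDiffeo ω P) (hQ : QPDiffeo ω Q) :
    QPDiffeo ω (P ∘ Q) := by
  obtain ⟨hP, P', hP', h1, h2⟩ := hP
  obtain ⟨hQ, Q', hQ', h3, h4⟩ := hQ
  refine ⟨hP.comp hQ, Q' ∘ P', hQ'.comp hP', ?_, ?_⟩
  · filter_upwards [hQ.tendsto.eventually h1, h3] with p h5 h6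
    simp [h5, h6]
  · filter_upwards [hP'.tendsto.eventually h4, h2] with p h5 h6
    simp [h5, h6]

end QPReversible

end

/-! ### Inverse function theorem for quasi-periodic germs. -/

noncomputable section

namespace QPReversible

open Filter Topology Asymptotics

variable {m : ℕ} {ω : Fin m → ℝ} {γ : ℝ}

/-! ### Inverse maps -/

theorem hasSum_half_pow : HasSum (fun n : ℕ => ((1 : ℝ) / 2) ^ (n + 1)) 1 := by
  have := (hasSum_geometric_two).mul_left ((1 : ℝ) / 2)
  simpa [pow_succ, mul_comm] using this

/-- The iteration `(x, y) ↦ - (u, v) ∘ (I + (x, y))`. -/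
def inverseIter (u v : ℝ → ℝ → ℝ) : ℕ → (ℝ → ℝ → ℝ) × (ℝ → ℝ → ℝ)
  | 0 => (fun _ _ => 0, fun _ _ => 0)
  | n + 1 => (fun ξ η => -u (ξ + (inverseIter u v n).1 ξ η) (η + (inverseIter u v n).2 ξ η),
      fun ξ η => -v (ξ + (inverseIter u v n).1 ξ η) (η + (inverseIter u v n).2 ξ η))

theorem RRep.continuousAt {s : ℕ} {t ρ K : ℝ} {f : ℝ → ℝ → ℝ} (hf : RRep ω s t ρ K f) (ht : 0 < t)
    {ξ η : ℝ} (hη : |η| < ρ) : ContinuousAt (fun p : ℝ × ℝ => f p.1 p.2) (ξ, η) :=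
  (hf.hasFDerivAt ht ξ hη).continuousAt

/-- A fixed point of `(x, y) ↦ -(u, v) ∘ (I + (x, y))` makes `I + (x, y)` a right inverse of `I +
(u, v)`. Giving up half of the domain makes successive differences of the iterates decrease at least
like `2⁻ⁿ`. -/
theorem exists_right_inverse_small {t b ε : ℝ} {u v : ℝ → ℝ → ℝ} (ht : 0 < t) (hb : 0 < b)
    (hbt : freqBound ω * (2 * b) ≤ t) (hb1 : 2 * b ≤ 1) (hε : ε ≤ b / 2)
    (hu : RRep ω 0 (2 * t) 2 ε u) (hv : RRep ω 0 (2 * t) 2 ε v)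
    (hu0 : ∀ ξ, u ξ 0 = 0) (hv0 : ∀ ξ, v ξ 0 = 0) :
    ∃ x y : ℝ → ℝ → ℝ, RRep ω 0 t 1 b x ∧ RRep ω 0 t 1 b y ∧ (∀ ξ, x ξ 0 = 0 ∧ y ξ 0 = 0) ∧
      ∀ ξ η : ℝ, |η| < 1 → x ξ η = -u (ξ + x ξ η) (η + y ξ η) ∧
        y ξ η = -v (ξ + x ξ η) (η + y ξ η) := by
  have hΩ := freqBound_pos (ω := ω)
  set X : ℕ → ℝ → ℝ → ℝ := fun n => (inverseIter u v n).1 with hX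
  set Y : ℕ → ℝ → ℝ → ℝ := fun n => (inverseIter u v n).2 with hY
  have hXs : ∀ n ξ η, X (n + 1) ξ η = -u (ξ + X n ξ η) (η + Y n ξ η) := fun n ξ η => rfl
  have hYs : ∀ n ξ η, Y (n + 1) ξ η = -v (ξ + X n ξ η) (η + Y n ξ η) := fun n ξ η => rfl
  have hX0 : ∀ ξ η, X 0 ξ η = 0 := fun ξ η => rfl
  have hY0 : ∀ ξ η, Y 0 ξ η = 0 := fun ξ η => rfl
  have hinv : ∀ n : ℕ, (RRep ω 0 t 1 (b * (1 - (1 / 2) ^ n)) (X n) ∧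
      RRep ω 0 t 1 (b * (1 - (1 / 2) ^ n)) (Y n)) ∧
      RRep ω 0 t 1 (b * (1 / 2) ^ (n + 1)) (fun ξ η => X (n + 1) ξ η - X n ξ η) ∧
      RRep ω 0 t 1 (b * (1 / 2) ^ (n + 1)) (fun ξ η => Y (n + 1) ξ η - Y n ξ η) := by
    intro n
    induction n with
    | zero =>
      have h0 : ∀ w : ℝ → ℝ → ℝ, RRep ω 0 (2 * t) 2 ε w →
          RRep ω 0 t 1 (b * (1 / 2) ^ (0 + 1)) (fun ξ η => -w ξ η) := fun w hw =>
        (hw.neg (by positivity) (by positivity)).mono le_rfl ht.le (by linarith) (by norm_num)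
          (by norm_num) (by simpa [div_eq_mul_inv] using hε)
      refine ⟨⟨(RRep.zero).mono_const (by simp), (RRep.zero).mono_const (by simp)⟩, ?_, ?_⟩
      · exact (h0 u hu).congr fun ξ η _ => by simp [hXs, hX0, hY0]
      · exact (h0 v hv).congr fun ξ η _ => by simp [hYs, hX0, hY0]
    | succ n ih =>
      obtain ⟨⟨h1, h2⟩, h3, h4⟩ := ih
      have hle : ∀ n : ℕ, b * (1 - (1 / 2) ^ n) ≤ b := fun n => by
        have : (0 : ℝ) ≤ (1 / 2) ^ n := by positivity
        nlinarith
      have hstep : ∀ W : ℕ → ℝ → ℝ → ℝ, RRep ω 0 t 1 (b * (1 - (1 / 2) ^ n)) (W n) →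
          RRep ω 0 t 1 (b * (1 / 2) ^ (n + 1)) (fun ξ η => W (n + 1) ξ η - W n ξ η) →
          RRep ω 0 t 1 (b * (1 - (1 / 2) ^ (n + 1))) (W (n + 1)) := fun W h h' =>
        ((h.add ht.le zero_le_one h').mono_const (by rw [pow_succ]; linarith)).congr
          fun ξ η _ => by ring
      -- Enlarged by `Z = 2 ^ (n + 1)` the last increment is bounded by `b`, for which there is
      -- room, and the first order remainder `ε / Z` is at most `b / 2 ^ (n + 2)`.
      have hZ : (1 : ℝ) ≤ 2 ^ (n + 1) := one_le_pow₀ one_le_two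
      have hZb : (2 : ℝ) ^ (n + 1) * (b * (1 / 2) ^ (n + 1)) = b := by
        rw [one_div, inv_pow]; field_simp
      have hfin : ∀ w : ℝ → ℝ → ℝ, RRep ω 0 (2 * t) 2 ε w → RRep ω 0 t 1 (b * (1 / 2) ^ (n + 1 + 1))
          (fun ξ η => -w (ξ + X (n + 1) ξ η) (η + Y (n + 1) ξ η) -
            -w (ξ + X n ξ η) (η + Y n ξ η)) := fun w hw => by
        have := (hw.remainder ht.le one_pos hb hb (by positivity) (by positivity) hZ
          (by rw [hZb]; linarith) (by rw [hZb]; linarith) (h1.mono_const (hle n))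
          (h2.mono_const (hle n)) h3 h4).1
        refine ((this.neg ht.le zero_le_one).mono_const ?_).congr fun ξ η _ => ?_
        · rw [div_le_iff₀ (by positivity), pow_succ _ (n + 1), one_div, inv_pow]
          have : b * ((2 ^ (n + 1))⁻¹ * 2⁻¹) * 2 ^ (n + 1) = b / 2 := by field_simp
          rw [this]; exact hε
        · rw [show ξ + X (n + 1) ξ η = ξ + X n ξ η + (X (n + 1) ξ η - X n ξ η) by ring,
            show η + Y (n + 1) ξ η = η + Y n ξ η + (Y (n + 1) ξ η - Y n ξ η) by ring]
          ring
      exact ⟨⟨hstep X h1 h3, hstep Y h2 h4⟩, (hfin u hu), (hfin v hv)⟩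
  have hlim : ∀ W : ℕ → ℝ → ℝ → ℝ, (∀ ξ η, W 0 ξ η = 0) →
      (∀ n, RRep ω 0 t 1 (b * (1 / 2) ^ (n + 1)) (fun ξ η => W (n + 1) ξ η - W n ξ η)) →
      ∃ w : ℝ → ℝ → ℝ, RRep ω 0 t 1 b w ∧
        ∀ ξ η : ℝ, |η| < 1 → Tendsto (fun n => W n ξ η) atTop (𝓝 (w ξ η)) := fun W hW0 hW => by
    have hg := hasSum_half_pow.mul_left b
    have hsm : ∀ ξ η : ℝ, |η| < 1 → Summable fun n => W (n + 1) ξ η - W n ξ η := fun ξ η hη =>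
      Summable.of_norm_bounded hg.summable fun n => (hW n).abs_le ht.le ξ hη
    refine ⟨fun ξ η => ∑' n, (W (n + 1) ξ η - W n ξ η), ?_, fun ξ η hη => ?_⟩
    · exact (RRep.hasSum ht.le zero_le_one hg.summable hW fun ξ η hη =>
        (hsm ξ η hη).hasSum).mono_const (by rw [hg.tsum_eq, mul_one])
    · have h1 := (hsm ξ η hη).hasSum.tendsto_sum_nat
      refine h1.congr fun n => ?_
      rw [Finset.sum_range_sub (fun n => W n ξ η), hW0, sub_zero]
  obtain ⟨x, hx, hxl⟩ := hlim X hX0 fun n => (hinv n).2.1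
  obtain ⟨y, hy, hyl⟩ := hlim Y hY0 fun n => (hinv n).2.2
  have hz : ∀ n ξ, X n ξ 0 = 0 ∧ Y n ξ 0 = 0 := fun n => by
    induction n with
    | zero => exact fun ξ => ⟨rfl, rfl⟩
    | succ n ih =>
      intro ξ
      rw [hXs, hYs, (ih ξ).1, (ih ξ).2]
      simp [hu0, hv0]
  refine ⟨x, y, hx, hy, fun ξ => ⟨?_, ?_⟩, fun ξ η hη => ?_⟩
  · refine tendsto_nhds_unique (hxl ξ 0 (by simp)) (tendsto_const_nhds.congr fun n => ?_)
    exact (hz n ξ).1.symm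
  · refine tendsto_nhds_unique (hyl ξ 0 (by simp)) (tendsto_const_nhds.congr fun n => ?_)
    exact (hz n ξ).2.symm
  · have hy1 := hy.abs_le ht.le ξ hη
    have hy2 := abs_add_le η (y ξ η)
    have hlt : |η + y ξ η| < 2 := by linarith
    have hpt : Tendsto (fun n => (ξ + X n ξ η, η + Y n ξ η)) atTop (𝓝 (ξ + x ξ η, η + y ξ η)) :=
      ((hxl ξ η hη).const_add ξ).prodMk_nhds ((hyl ξ η hη).const_add η)
    have hu' := ((hu.continuousAt (by positivity) hlt).tendsto.comp hpt).neg
    have hv' := ((hv.continuousAt (by positivity) hlt).tendsto.comp hpt).neg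
    exact ⟨tendsto_nhds_unique ((tendsto_add_atTop_iff_nat 1).2 (hxl ξ η hη)) hu',
      tendsto_nhds_unique ((tendsto_add_atTop_iff_nat 1).2 (hyl ξ η hη)) hv'⟩

theorem RRep.scale {s : ℕ} {t ρ K lam : ℝ} {f : ℝ → ℝ → ℝ} (hf : RRep ω s t ρ K f) (ht : 0 ≤ t)
    (hρ : 0 ≤ ρ) (hl : 0 < lam) : RRep ω s t (ρ / lam) K (fun ξ η => f ξ (lam * η)) := by
  obtain ⟨c, hc⟩ := hf
  have := hc.of_le (h' := fun ξ η => (f ξ (lam * η) : ℂ)) (c' := fun p => c p * (lam : ℂ) ^ p.1)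
    (s' := s) (t' := t) (ρ' := ρ / lam) (C := 1) ht (by positivity)
    (fun p hp => by simp [hc.low p hp]) zero_le_one
    (fun p => by
      rw [norm_mul, norm_pow, Complex.norm_real, Real.norm_of_nonneg hl.le, one_mul, weight, div_pow,
        weight]
      exact le_of_eq (by field_simp))
    (fun ξ η hη _ => by
      have h1 : |lam * η| < ρ := by
        rw [abs_mul, abs_of_pos hl, mul_comm]; rwa [lt_div_iff₀ hl] at hη
      refine (hc.hasSum ξ (lam * η) h1).congr_fun fun p => ?_
      simp only [basic]; push_cast; ring)
  exact ⟨_, by simpa using this⟩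

/-- The map `(ξ, η) ↦ (ξ, λ η)`. -/
def dilation (lam : ℝ) (p : ℝ × ℝ) : ℝ × ℝ := (p.1, lam * p.2)

theorem tendsto_dilation (lam : ℝ) : Tendsto (dilation lam) nearAxis nearAxis := by
  refine tendsto_comap_iff.2 ?_
  have : Tendsto (fun η : ℝ => lam * η) (𝓝 0) (𝓝 0) := by
    simpa using (continuous_const_mul lam).tendsto (0 : ℝ)
  exact this.comp tendsto_comap

/-- A map of the form `I + (O(η), O(η²))` has an inverse of the same kind. -/
theorem QPMap.qpDiffeo_of_ordU {P : ℝ × ℝ → ℝ × ℝ} (hγ : ∀ k : Fin m → ℤ, k ≠ 0 → mode ω k γ ≠ 1)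
    (hP : QPMap ω P) (hv2 : OrdU 2 fun ξ η => (P (ξ, η)).2 - η) : QPDiffeo ω P := by
  have hΩ := freqBound_pos (ω := ω)
  refine ⟨hP, ?_⟩
  obtain ⟨t₀, ht₀, ρ, hρ, K, hK, hu, hv⟩ := hP.1.exists_common hP.2.1
  have hu1 := hu.order_one ht₀.le hρ fun ξ => (hP.2.2 ξ).1
  have hv1 := hv.upgrade hγ ht₀.le hρ fun ξ => hv2.isBigO ξ
  set u : ℝ → ℝ → ℝ := fun ξ η => (P (ξ, η)).1 - ξ with hud
  set v : ℝ → ℝ → ℝ := fun ξ η => (P (ξ, η)).2 - η with hvd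
  set t := t₀ / 2 with htd
  have ht : 0 < t := by positivity
  set b := min (1 / 2) (t / (2 * freqBound ω)) with hbd
  have hb : 0 < b := by positivity
  have hbt : freqBound ω * (2 * b) ≤ t := by
    have : b ≤ t / (2 * freqBound ω) := min_le_right _ _
    rw [le_div_iff₀ (by positivity)] at this; linarith
  have hb1 : 2 * b ≤ 1 := by
    have : b ≤ 1 / 2 := min_le_left _ _
    linarith
  -- The first bound serves the iteration, the second makes the rescaled increments Lipschitz with
  -- constant `1 / 2`.
  set ε := min (b / 2) (1 / (2 * (freqBound ω / (2 * t) + 1))) with hεd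
  have hε : 0 < ε := by positivity
  have hε2 : (freqBound ω / (2 * t) + 1) * ε ≤ 1 / 2 := by
    have : ε ≤ 1 / (2 * (freqBound ω / (2 * t) + 1)) := min_le_right _ _
    rw [le_div_iff₀ (by positivity)] at this; linarith
  -- The dilation makes `u ξ (lam * η)` of size `lam` and, as `v` has order two, `lam⁻¹ * v ξ (lam *
  -- η)` of size `lam` as well. The bound `ρ / 2` leaves a radius of at least `2`.
  set lam := min (ρ / 2) (min (ε * ρ / (2 * K)) (ε * ρ ^ 2 / (4 * K))) with hld
  have hl : 0 < lam := by positivity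
  have hl1 : 2 * lam / ρ ≤ 1 := by
    have : lam ≤ ρ / 2 := min_le_left _ _
    rw [div_le_one hρ]; linarith
  have hl2 : 2 * lam / ρ * K ≤ ε := by
    have : lam ≤ ε * ρ / (2 * K) := (min_le_right _ _).trans (min_le_left _ _)
    rw [le_div_iff₀ (by positivity)] at this
    rw [div_mul_eq_mul_div, div_le_iff₀ hρ]; linarith
  have hl3 : lam⁻¹ * ((2 * lam / ρ) ^ 2 * K) ≤ ε := by
    have : lam ≤ ε * ρ ^ 2 / (4 * K) := (min_le_right _ _).trans (min_le_right _ _)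
    rw [le_div_iff₀ (by positivity)] at this
    have e : lam⁻¹ * ((2 * lam / ρ) ^ 2 * K) = lam * (4 * K) / ρ ^ 2 := by field_simp; ring
    rw [e, div_le_iff₀ (by positivity)]; linarith
  have e2 : 2 * lam / ρ * (ρ / lam) = 2 := by field_simp
  have ht2 : 2 * t = t₀ := by rw [htd]; ring
  have hus : RRep ω 0 (2 * t) 2 ε (fun ξ η => u ξ (lam * η)) := by
    have := (hu1.scale ht₀.le hρ.le hl).shrink ht₀.le (ρ' := 2) zero_le_two (by positivity) hl1
      (by positivity) e2.ge
    rw [ht2]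
    exact this.mono (Nat.zero_le _) ht₀.le le_rfl zero_le_two le_rfl (by rwa [pow_one])
  have hvs : RRep ω 0 (2 * t) 2 ε (fun ξ η => lam⁻¹ * v ξ (lam * η)) := by
    have := ((hv1.scale ht₀.le hρ.le hl).shrink ht₀.le (ρ' := 2) zero_le_two (by positivity) hl1
      (by positivity) e2.ge).const_mul ht₀.le zero_le_two lam⁻¹
    rw [ht2]
    exact this.mono (Nat.zero_le _) ht₀.le le_rfl zero_le_two le_rfl
      (by rwa [abs_of_pos (inv_pos.2 hl)])
  obtain ⟨x, y, hx, hy, h0, hxy⟩ := exists_right_inverse_small (ω := ω) ht hb hbt hb1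
    (min_le_left _ _) hus hvs (fun ξ => by simpa using (hP.2.2 ξ).1)
    (fun ξ => by rw [mul_zero, show v ξ 0 = 0 from (hP.2.2 ξ).2, mul_zero])
  set Q : ℝ × ℝ → ℝ × ℝ := nearIdentity (fun ξ η => x ξ (lam⁻¹ * η))
    (fun ξ η => lam * y ξ (lam⁻¹ * η)) with hQd
  have hQ : QPMap ω Q := by
    rw [qpMap_nearIdentity]
    have h1 := hx.scale ht.le zero_le_one (inv_pos.2 hl)
    have h2 := (hy.scale ht.le zero_le_one (inv_pos.2 hl)).const_mul ht.le (by positivity) lam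
    exact ⟨h1.isQPAnalytic ht (by positivity), h2.isQPAnalytic ht (by positivity),
      fun ξ => by simp [h0]⟩
  have hPQ : ∀ᶠ p in nearAxis, P (Q p) = p := by
    refine eventually_nearAxis.2 ⟨lam, hl, fun ξ η hη => ?_⟩
    have hη' : |lam⁻¹ * η| < 1 := by
      rw [abs_mul, abs_of_pos (inv_pos.2 hl), inv_mul_lt_iff₀ hl, mul_one]; exact hη
    obtain ⟨h1, h2⟩ := hxy ξ (lam⁻¹ * η) hη'
    rw [QPMap.eq_nearIdentity (P := P)]
    have e3 : lam * (lam⁻¹ * η + y ξ (lam⁻¹ * η)) = η + lam * y ξ (lam⁻¹ * η) := by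
      rw [mul_add, mul_inv_cancel_left₀ hl.ne']
    rw [e3] at h1 h2
    simp only [hQd, nearIdentity]
    refine Prod.ext ?_ ?_
    · show ξ + x ξ (lam⁻¹ * η) + u (ξ + x ξ (lam⁻¹ * η)) (η + lam * y ξ (lam⁻¹ * η)) = ξ
      linarith
    · show η + lam * y ξ (lam⁻¹ * η) + v (ξ + x ξ (lam⁻¹ * η)) (η + lam * y ξ (lam⁻¹ * η)) = η
      have : lam * y ξ (lam⁻¹ * η) = -v (ξ + x ξ (lam⁻¹ * η)) (η + lam * y ξ (lam⁻¹ * η)) := by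
        conv_lhs => rw [h2]
        rw [mul_neg, mul_inv_cancel_left₀ hl.ne']
      linarith
  -- In dilated coordinates `P - I` contracts by `1 / 2`, so `P` is injective near the axis. Applied
  -- to `P (Q (P p)) = P p`, this makes the right inverse a left inverse.
  have hinj : ∀ p q : ℝ × ℝ, |p.2| < lam → |q.2| < lam → P p = P q → p = q := by
    intro p q hp hq he
    have hs : ∀ z : ℝ × ℝ, |z.2| < lam → |lam⁻¹ * z.2| < 1 := fun z hz => by
      rw [abs_mul, abs_of_pos (inv_pos.2 hl), inv_mul_lt_iff₀ hl, mul_one]; exact hz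
    have hlip : ∀ w : ℝ → ℝ → ℝ, RRep ω 0 (2 * t) 2 ε w →
        |w p.1 (lam⁻¹ * p.2) - w q.1 (lam⁻¹ * q.2)| ≤
          1 / 2 * ‖((p.1, lam⁻¹ * p.2) : ℝ × ℝ) - (q.1, lam⁻¹ * q.2)‖ := fun w hw => by
      have := hw.lipschitz (ρ' := 1) (p := (p.1, lam⁻¹ * p.2)) (q := (q.1, lam⁻¹ * q.2))
        (by positivity) one_pos (by norm_num) (hs p hp) (hs q hq)
      refine this.trans (mul_le_mul_of_nonneg_right ?_ (norm_nonneg _))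
      refine le_trans (le_of_eq ?_) hε2
      norm_num; ring
    have h1 := hlip _ hus
    have h2 := hlip _ hvs
    simp only [mul_inv_cancel_left₀ hl.ne'] at h1 h2
    have a1 : u p.1 p.2 - u q.1 q.2 = -(p.1 - q.1) := by
      have := congrArg Prod.fst he
      simp only [hud]; linarith
    have a2 : lam⁻¹ * v p.1 p.2 - lam⁻¹ * v q.1 q.2 = -(lam⁻¹ * p.2 - lam⁻¹ * q.2) := by
      have : v p.1 p.2 - v q.1 q.2 = -(p.2 - q.2) := by
        have := congrArg Prod.snd he
        simp only [hvd]; linarith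
      rw [← mul_sub, this]; ring
    rw [a1, abs_neg] at h1
    rw [a2, abs_neg] at h2
    have h3 : ‖((p.1, lam⁻¹ * p.2) : ℝ × ℝ) - (q.1, lam⁻¹ * q.2)‖ ≤
        1 / 2 * ‖((p.1, lam⁻¹ * p.2) : ℝ × ℝ) - (q.1, lam⁻¹ * q.2)‖ := by
      conv_lhs => rw [Prod.norm_def]
      exact max_le h1 h2
    have h4 : ‖((p.1, lam⁻¹ * p.2) : ℝ × ℝ) - (q.1, lam⁻¹ * q.2)‖ = 0 := by
      linarith [norm_nonneg (((p.1, lam⁻¹ * p.2) : ℝ × ℝ) - (q.1, lam⁻¹ * q.2))]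
    have h5 := sub_eq_zero.1 (norm_eq_zero.1 h4)
    have h6 : p.1 = q.1 := (Prod.ext_iff.1 h5).1
    have h7 : lam⁻¹ * p.2 = lam⁻¹ * q.2 := (Prod.ext_iff.1 h5).2
    exact Prod.ext h6 (mul_left_cancel₀ (inv_pos.2 hl).ne' h7)
  refine ⟨Q, hQ, ?_, hPQ⟩
  have hmem : ∀ᶠ p in nearAxis, |p.2| < lam := eventually_nearAxis.2 ⟨lam, hl, fun ξ η hη => hη⟩
  filter_upwards [hP.tendsto.eventually hPQ, hmem, (hQ.comp hP).tendsto.eventually hmem]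
    with p h1 h2 h3
  exact hinj _ _ h3 h2 h1

/-- A map whose linear part in `η` is invertible has an inverse of the same kind. -/
theorem QPMap.qpDiffeo {P : ℝ × ℝ → ℝ × ℝ} (hγ : ∀ k : Fin m → ℤ, k ≠ 0 → mode ω k γ ≠ 1)
    (hP : QPMap ω P) {a b : ℝ → ℝ} (ha : IsQPAnalytic ω fun ξ _ => a ξ)
    (hb : IsQPAnalytic ω fun ξ _ => b ξ) (hab : ∀ ξ, a ξ * b ξ = 1)
    (hO : OrdU 2 fun ξ η => (P (ξ, η)).2 - a ξ * η) : QPDiffeo ω P := by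
  have hlin : ∀ c : ℝ → ℝ, (IsQPAnalytic ω fun ξ _ => c ξ) →
      QPMap ω (nearIdentity (fun _ _ => 0) (fun ξ η => c ξ * η - η)) := fun c hc => by
    rw [qpMap_nearIdentity]
    exact ⟨IsQPAnalytic.const 0, (hc.mul IsQPAnalytic.snd).sub IsQPAnalytic.snd, by simp⟩
  set L := nearIdentity (fun _ _ => 0) (fun ξ η => a ξ * η - η) with hL
  set L' := nearIdentity (fun _ _ => 0) (fun ξ η => b ξ * η - η) with hL'
  have hL1 : ∀ p, L p = (p.1, a p.1 * p.2) := fun p => by simp [hL, nearIdentity]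
  have hL2 : ∀ p, L' p = (p.1, b p.1 * p.2) := fun p => by simp [hL', nearIdentity]
  have hLL : ∀ p, L (L' p) = p := fun p => by
    simp [hL1, hL2, ← mul_assoc, hab]
  have hLL' : ∀ p, L' (L p) = p := fun p => by
    refine Prod.ext (by simp [hL1, hL2]) ?_
    simp only [hL1, hL2]
    rw [← mul_assoc, mul_comm (b _), hab, one_mul]
  have hLd : QPDiffeo ω L := ⟨hlin a ha, L', hlin b hb, Eventually.of_forall hLL',
    Eventually.of_forall hLL⟩
  -- Removing the linear factor leaves `η + O(η²)`: replacing `b (P (ξ, η)).1` by `b ξ` changes a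
  -- factor by `O(η)`, and it multiplies the `O(η)` second component.
  have hQ : QPDiffeo ω (L' ∘ P) := by
    refine QPMap.qpDiffeo_of_ordU hγ ((hlin b hb).comp hP) ?_
    have h1 : OrdU 1 fun ξ η => b (P (ξ, η)).1 - b ξ := by
      refine IsQPAnalytic.ordU_one ((hb.comp hP).sub hb) fun ξ => ?_
      have := (hP.2.2 ξ).1
      rw [show (P (ξ, 0)).1 = ξ by linarith, sub_self]
    have h2 : OrdU 2 fun ξ η => b ξ * ((P (ξ, η)).2 - a ξ * η) :=
      OrdU.mul (s := 0) (s' := 2) hb.ordU_zero hO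
    refine (OrdU.add (s := 2) (h1.mul hP.snd_ordU) h2).congr
      (Eventually.of_forall fun p => ?_)
    have := hab p.1
    simp only [Function.comp, hL2]
    linear_combination p.2 * this
  have : P = L ∘ (L' ∘ P) := by funext p; simp [hLL]
  rw [this]
  exact hLd.comp hQ

end QPReversible

end

/-! ### The Newton identity, and the cohomology class of the defect. -/

noncomputable section

namespace QPReversible

open Filter Topology Asymptotics

variable {m : ℕ} {ω : Fin m → ℝ} {γ : ℝ}

/-! ### The defect of an approximate conjugacy and its Newton correction -/

/-- For `U = I + (u, v)`, the components of `M ∘ U - U ∘ (I + β)` are `defect γ f u v u` and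
`defect γ g u v v`. -/
def defect (γ : ℝ) (h u v w : ℝ → ℝ → ℝ) (ξ η : ℝ) : ℝ :=
  w ξ η + h (ξ + u ξ η) (η + v ξ η) - w (ξ + γ) η

/-- The second order remainder of the Taylor expansion of `h` along `I + (u, v)`. -/
def taylorRem (h u v w₁ w₂ : ℝ → ℝ → ℝ) (ξ η : ℝ) : ℝ :=
  h (ξ + u ξ η + w₁ ξ η) (η + v ξ η + w₂ ξ η) - h (ξ + u ξ η) (η + v ξ η) -
    (dX h (ξ + u ξ η) (η + v ξ η) * w₁ ξ η + dY h (ξ + u ξ η) (η + v ξ η) * w₂ ξ η)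

/-- `h` is differentiable at `(ξ, η)`. -/
def HasPartials (h : ℝ → ℝ → ℝ) (ξ η : ℝ) : Prop :=
  HasFDerivAt (fun p : ℝ × ℝ => h p.1 p.2) (pairMap (dX h ξ η) (dY h ξ η)) (ξ, η)

theorem HasPartials.chain {h : ℝ → ℝ → ℝ} {x y : ℝ → ℝ} {x' y' τ : ℝ}
    (hh : HasPartials h (x τ) (y τ)) (hx : HasDerivAt x x' τ) (hy : HasDerivAt y y' τ) :
    HasDerivAt (fun s => h (x s) (y s)) (dX h (x τ) (y τ) * x' + dY h (x τ) (y τ) * y') τ := by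
  have := HasFDerivAt.comp_hasDerivAt τ (f := fun s => (x s, y s)) hh (hx.prodMk hy)
  simpa [pairMap_apply, Function.comp_def] using this

theorem HasPartials.fst {h : ℝ → ℝ → ℝ} {ξ η : ℝ} (hh : HasPartials h ξ η) :
    HasDerivAt (fun x => h x η) (dX h ξ η) ξ := by
  simpa using hh.chain (x := fun x => x) (y := fun _ => η) (hasDerivAt_id ξ) (hasDerivAt_const ξ η)

theorem HasPartials.snd {h : ℝ → ℝ → ℝ} {ξ η : ℝ} (hh : HasPartials h ξ η) :
    HasDerivAt (fun y => h ξ y) (dY h ξ η) η := by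
  simpa using hh.chain (x := fun _ => ξ) (y := fun y => y) (hasDerivAt_const η ξ) (hasDerivAt_id η)

theorem defect_partials {h u v w : ℝ → ℝ → ℝ} {ξ η : ℝ}
    (hh : HasPartials h (ξ + u ξ η) (η + v ξ η)) (hu : HasPartials u ξ η) (hv : HasPartials v ξ η)
    (hw : HasPartials w ξ η) (hw' : HasPartials w (ξ + γ) η) :
    dX (defect γ h u v w) ξ η = dX w ξ η + (dX h (ξ + u ξ η) (η + v ξ η) * (1 + dX u ξ η) +
        dY h (ξ + u ξ η) (η + v ξ η) * dX v ξ η) - dX w (ξ + γ) η ∧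
      dY (defect γ h u v w) ξ η = dY w ξ η + (dX h (ξ + u ξ η) (η + v ξ η) * dY u ξ η +
        dY h (ξ + u ξ η) (η + v ξ η) * (1 + dY v ξ η)) - dY w (ξ + γ) η := by
  constructor
  · have h1 := hh.chain (x := fun x => x + u x η) (y := fun x => η + v x η)
      ((hasDerivAt_id' ξ).add hu.fst) (hv.fst.const_add η)
    exact ((hw.fst.add h1).sub (hw'.fst.comp_add_const ξ γ)).deriv
  · have h1 := hh.chain (x := fun y => ξ + u ξ y) (y := fun y => y + v ξ y)
      (hu.snd.const_add ξ) ((hasDerivAt_id' η).add hv.snd)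
    exact ((hw.snd.add h1).sub hw'.snd).deriv

/-- The defect of `U + DU · Y`. -/
theorem defect_newton {h u v w Y₁ Y₂ w₁ w₂ w₀ : ℝ → ℝ → ℝ} {ξ η : ℝ} (α β : ℝ)
    (hh : HasPartials h (ξ + u ξ η) (η + v ξ η)) (hu : HasPartials u ξ η) (hv : HasPartials v ξ η)
    (hw : HasPartials w ξ η) (hw' : HasPartials w (ξ + γ) η)
    (h1 : w₁ ξ η = (1 + dX u ξ η) * Y₁ ξ η + dY u ξ η * Y₂ ξ η)
    (h2 : w₂ ξ η = dX v ξ η * Y₁ ξ η + (1 + dY v ξ η) * Y₂ ξ η)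
    (h3 : w₀ ξ η = (α + dX w ξ η) * Y₁ ξ η + (β + dY w ξ η) * Y₂ ξ η)
    (h4 : w₀ (ξ + γ) η =
      (α + dX w (ξ + γ) η) * Y₁ (ξ + γ) η + (β + dY w (ξ + γ) η) * Y₂ (ξ + γ) η) :
    defect γ h (fun ξ η => u ξ η + w₁ ξ η) (fun ξ η => v ξ η + w₂ ξ η) (fun ξ η => w ξ η + w₀ ξ η)
        ξ η =
      defect γ h u v w ξ η + taylorRem h u v w₁ w₂ ξ η +
        (Y₁ ξ η * dX (defect γ h u v w) ξ η + Y₂ ξ η * dY (defect γ h u v w) ξ η) -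
        ((α + dX w (ξ + γ) η) * (Y₁ (ξ + γ) η - Y₁ ξ η) +
          (β + dY w (ξ + γ) η) * (Y₂ (ξ + γ) η - Y₂ ξ η)) := by
  -- These formulas are the rows of `DM(U) · DU = DU ∘ R + DE`. They turn the linear response to `DU
  -- · Y` into `DE · Y - (DU ∘ R)(Y ∘ R - Y)` exactly; `(α, β)` is the row of the identity matrix
  -- contained in `DU`.
  obtain ⟨e1, e2⟩ := defect_partials (γ := γ) hh hu hv hw hw'
  rw [e1, e2]
  simp only [defect, taylorRem, ← add_assoc]
  rw [h3, h4]
  linear_combination dX h (ξ + u ξ η) (η + v ξ η) * h1 + dY h (ξ + u ξ η) (η + v ξ η) * h2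

theorem IsQPAnalytic.hasPartials {f : ℝ → ℝ → ℝ} (hf : IsQPAnalytic ω f) :
    ∀ᶠ p : ℝ × ℝ in nearAxis, HasPartials f p.1 p.2 := hf.hasFDerivAt

theorem IsQPAnalytic.defect {h u v w : ℝ → ℝ → ℝ} (hh : IsQPAnalytic ω h)
    (hU : QPMap ω (nearIdentity u v)) (hw : IsQPAnalytic ω w) :
    IsQPAnalytic ω (defect γ h u v w) :=
  (hw.add (hh.comp hU)).sub (hw.shift γ)

theorem OrdU.derivs (hγ : ∀ k : Fin m → ℤ, k ≠ 0 → mode ω k γ ≠ 1) {s : ℕ} {h : ℝ → ℝ → ℝ}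
    (hh : IsQPAnalytic ω h) (hO : OrdU s h) : OrdU s (dX h) ∧ OrdU (s - 1) (dY h) := by
  obtain ⟨t, ht, ρ, hρ, K, hK⟩ := isQPAnalytic_iff.1 hh
  obtain ⟨h1, h2⟩ := (hK.upgrade hγ ht.le hρ fun ξ => hO.isBigO ξ).deriv_bounds (t' := t / 2)
    (ρ' := ρ / 2) (by positivity) (by linarith) (by positivity) (by linarith)
  exact ⟨h1.ordU (by positivity) (by positivity), h2.ordU (by positivity) (by positivity)⟩

/-- Only the order matters here, so `Z = 1` suffices in `RRep.remainder`; the factor `q` shrinks the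
radius until all increments fit into the domain of `h`. -/
theorem OrdU.taylorRem (hγ : ∀ k : Fin m → ℤ, k ≠ 0 → mode ω k γ ≠ 1) {s : ℕ}
    {h u v w₁ w₂ : ℝ → ℝ → ℝ} (hh : IsQPAnalytic ω h) (hU : QPMap ω (nearIdentity u v))
    (hw₁ : IsQPAnalytic ω w₁) (hw₂ : IsQPAnalytic ω w₂) (hs : 1 ≤ s) (h1 : OrdU s w₁)
    (h2 : OrdU s w₂) : OrdU (s * 2) (taylorRem h u v w₁ w₂) := by
  have hΩ := freqBound_pos (ω := ω)
  rw [qpMap_nearIdentity] at hU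
  obtain ⟨t, ht, ρ, hρ, K, hK⟩ := isQPAnalytic_iff.1 hh
  obtain ⟨t₁, ht₁, ρ₁, hρ₁, K₁, hK₁, hu, hv⟩ := hU.1.exists_common hU.2.1
  obtain ⟨t₂, ht₂, ρ₂, hρ₂, K₂, hK₂, hx, hy⟩ := hw₁.exists_common hw₂
  set t' := min (t / 2) (min t₁ t₂) with ht'd
  have ht' : 0 < t' := by positivity
  set ρ' := min ρ₁ ρ₂ with hρ'd
  have hρ' : 0 < ρ' := by positivity
  set q := min 1 (min (t / (2 * (freqBound ω * (K₁ + 1 * K₂)))) (ρ / (ρ' + (K₁ + 1 * K₂)))) with hq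
  have hq0 : 0 < q := by positivity
  have hq1 : q ≤ 1 := min_le_left _ _
  have hqt : q * (2 * (freqBound ω * (K₁ + 1 * K₂))) ≤ t := by
    rw [← le_div_iff₀ (by positivity)]
    exact (min_le_right _ _).trans (min_le_left _ _)
  have hqρ : q * (ρ' + (K₁ + 1 * K₂)) ≤ ρ := by
    rw [← le_div_iff₀ (by positivity)]
    exact (min_le_right _ _).trans (min_le_right _ _)
  have red : ∀ {t₁ ρ₁ K₁ : ℝ} {s : ℕ} {w : ℝ → ℝ → ℝ}, t' ≤ t₁ → ρ' ≤ ρ₁ → 0 < K₁ → 0 < ρ₁ →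
      0 ≤ t₁ → RRep ω 0 t₁ ρ₁ K₁ w → OrdU s w → 1 ≤ s → RRep ω s t' (q * ρ') (q * K₁) w := by
    intro t₁ ρ₁ K₁ s w a1 a2 a3 a4 a5 hw hO hs
    have h3 := ((hw.mono le_rfl ht'.le a1 hρ'.le a2 le_rfl).upgrade hγ ht'.le hρ'
      fun ξ => hO.isBigO ξ).shrink ht'.le (by positivity : 0 ≤ q * ρ') hρ'.le hq1 hq0.le le_rfl
    refine h3.mono_const (mul_le_mul_of_nonneg_right ?_ a3.le)
    simpa using pow_le_pow_of_le_one hq0.le hq1 hs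
  have l1 : t' ≤ t₁ := (min_le_right _ _).trans (min_le_left _ _)
  have l2 : t' ≤ t₂ := (min_le_right _ _).trans (min_le_right _ _)
  have hu' := red l1 (min_le_left _ _) hK₁ hρ₁ ht₁.le hu
    (hU.1.ordU_one fun ξ => (hU.2.2 ξ).1) le_rfl
  have hv' := red l1 (min_le_left _ _) hK₁ hρ₁ ht₁.le hv
    (hU.2.1.ordU_one fun ξ => (hU.2.2 ξ).2) le_rfl
  have hx' := red l2 (min_le_right _ _) hK₂ hρ₂ ht₂.le hx h1 hs
  have hy' := red l2 (min_le_right _ _) hK₂ hρ₂ ht₂.le hy h2 hs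
  have ht2 : t' ≤ t / 2 := min_le_left _ _
  have := (hK.remainder ht'.le (ρ' := q * ρ') (by positivity) (a := q * K₁) (b := q * K₁)
    (x := q * K₂) (y := q * K₂) (Z := 1) (by positivity) (by positivity) (by positivity)
    (by positivity) le_rfl (by linarith) (by linarith)
    (Rep.mono_order hu' (Nat.zero_le _)) (Rep.mono_order hv' (Nat.zero_le _)) hx' hy').2
  exact this.ordU ht'.le (by positivity)

/-! ### The mean of the defect of an approximate conjugacy -/

theorem tendsto_rotation (γ : ℝ) : Tendsto (rotation γ) nearAxis nearAxis :=
  tendsto_comap_iff.2 tendsto_comap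

theorem mapM_eq (γ : ℝ) (f g : ℝ → ℝ → ℝ) (p : ℝ × ℝ) :
    mapM γ f g p = rotation γ (nearIdentity f g p) := by
  simp [mapM, rotation, nearIdentity, add_right_comm]

theorem tendsto_mapM {f g : ℝ → ℝ → ℝ} (hM : QPMap ω (nearIdentity f g)) :
    Tendsto (mapM γ f g) nearAxis nearAxis := by
  rw [show mapM γ f g = rotation γ ∘ nearIdentity f g from funext fun p => mapM_eq γ f g p]
  exact (tendsto_rotation γ).comp hM.tendsto

theorem ordU_prod {s : ℕ} {A : ℝ × ℝ → ℝ × ℝ}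
    (hA : A =O[nearAxis] fun p : ℝ × ℝ => p.2 ^ s) :
    OrdU s (fun ξ η => (A (ξ, η)).1) ∧ OrdU s (fun ξ η => (A (ξ, η)).2) :=
  ⟨(IsBigO.of_norm_left (isBigO_fst_prod.norm_left)).trans hA, isBigO_snd_prod.trans hA⟩

/-- The first component of `DU⁻¹ ∘ R` applied to `(E₁, E₂)`, where `U = I + (u, v)` and `i` is the
inverse of the determinant of `DU`. -/
def pullFst (γ : ℝ) (i u v E₁ E₂ : ℝ → ℝ → ℝ) (ξ η : ℝ) : ℝ :=
  i (ξ + γ) η * ((1 + dY v (ξ + γ) η) * E₁ ξ η - dY u (ξ + γ) η * E₂ ξ η)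

/-- The second component of `DU⁻¹ ∘ R` applied to `(E₁, E₂)`. -/
def pullSnd (γ : ℝ) (i u v E₁ E₂ : ℝ → ℝ → ℝ) (ξ η : ℝ) : ℝ :=
  i (ξ + γ) η * ((1 + dX u (ξ + γ) η) * E₂ ξ η - dX v (ξ + γ) η * E₁ ξ η)

/-- If an invertible `P` conjugates `M` to the rotation up to `O(η ^ (2 * s - 1))`, then the
pulled back defect of any conjugacy up to `O(η ^ s)` is a coboundary up to `O(η ^ (2 * s - 1))`. -/
theorem exists_near_coboundary (hγ : ∀ k : Fin m → ℤ, k ≠ 0 → mode ω k γ ≠ 1) {s : ℕ} (hs : 1 ≤ s)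
    {f g u v i : ℝ → ℝ → ℝ} (hM : QPMap ω (nearIdentity f g)) (hU : QPMap ω (nearIdentity u v))
    (hE₁ : OrdU s (defect γ f u v u)) (hE₂ : OrdU s (defect γ g u v v)) (hi : IsQPAnalytic ω i)
    (hid : ∀ᶠ p : ℝ × ℝ in nearAxis, i p.1 p.2 *
      ((1 + dX u p.1 p.2) * (1 + dY v p.1 p.2) - dY u p.1 p.2 * dX v p.1 p.2) = 1)
    {P : ℝ × ℝ → ℝ × ℝ} (hP : QPDiffeo ω P)
    (hPM : (fun p => mapM γ f g (P p) - P (rotation γ p)) =O[nearAxis]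
      fun p : ℝ × ℝ => p.2 ^ (2 * s - 1)) :
    ∃ Z₁ Z₂ : ℝ → ℝ → ℝ, IsQPAnalytic ω Z₁ ∧ IsQPAnalytic ω Z₂ ∧
      OrdU (2 * s - 1) (fun ξ η => pullFst γ i u v (defect γ f u v u) (defect γ g u v v) ξ η -
        (Z₁ (ξ + γ) η - Z₁ ξ η)) ∧
      OrdU (2 * s - 1) (fun ξ η => pullSnd γ i u v (defect γ f u v u) (defect γ g u v v) ξ η -
        (Z₂ (ξ + γ) η - Z₂ ξ η)) := by
  have hM' := hM
  have hU' := hU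
  rw [qpMap_nearIdentity] at hM' hU'
  obtain ⟨hf, hg, -⟩ := hM'
  obtain ⟨hu, hv, -⟩ := hU'
  obtain ⟨hP, Q, hQ, hQP, hPQ⟩ := hP
  set U := nearIdentity u v with hUd
  set M := mapM γ f g with hMd
  set R := rotation γ with hRd
  have hR : Tendsto R nearAxis nearAxis := tendsto_rotation γ
  have hMt : Tendsto M nearAxis nearAxis := tendsto_mapM hM
  have hUE : (fun p => M (U p) - U (R p)) =O[nearAxis] fun p : ℝ × ℝ => p.2 ^ s := by
    have := IsBigO.prod_left hE₁ hE₂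
    refine this.congr_left fun p => ?_
    simp [M, U, R, mapM, nearIdentity, rotation, defect]
    constructor <;> ring
  -- `C = P⁻¹ ∘ U` commutes with `R` up to `O(η ^ s)`, because `U` and `P` both conjugate `M` to `R`
  -- at least to this order (`s ≤ 2 * s - 1`).
  set C := Q ∘ U with hCd
  have hC : QPMap ω C := hQ.comp hU
  have hPC : ∀ᶠ p in nearAxis, P (C p) = U p := hU.tendsto.eventually hPQ
  have hCR : (fun p => C (R p) - R (C p)) =O[nearAxis] fun p : ℝ × ℝ => p.2 ^ s := by
    have e1 : (fun p => Q (U (R p)) - Q (M (U p))) =O[nearAxis] fun p : ℝ × ℝ => p.2 ^ s :=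
      (hQ.comp_sub_isBigO (hU.tendsto.comp hR) (hMt.comp hU.tendsto)).trans
        (hUE.neg_left.congr_left fun p => by simp)
    have e2 : (fun p => Q (M (P p)) - Q (P (R p))) =O[nearAxis]
        fun p : ℝ × ℝ => p.2 ^ (2 * s - 1) :=
      (hQ.comp_sub_isBigO (hMt.comp hP.tendsto) (hP.tendsto.comp hR)).trans hPM
    have e3 : (fun p => Q (M (P (C p))) - Q (P (R (C p)))) =O[nearAxis]
        fun p : ℝ × ℝ => p.2 ^ s := by
      refine (e2.comp_tendsto hC.tendsto).trans ?_
      have e4 := hC.snd_ordU.pow (2 * s - 1)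
      simp only [pow_one] at e4
      exact e4.trans (IsBigO.of_bound 1 (eventually_nearAxis.2 ⟨1, one_pos, fun ξ η hη => by
        rw [one_mul, norm_pow, norm_pow]
        exact pow_le_pow_of_le_one (norm_nonneg _) hη.le (by omega)⟩))
    refine (e1.add e3).congr' ?_ EventuallyEq.rfl
    filter_upwards [hPC, hC.tendsto.eventually (hR.eventually hQP)] with p h1 h2
    rw [h1, h2]
    simp [C]
  obtain ⟨t, ht, ρ, hρ, K, -, hc1, hc2⟩ := hC.1.exists_common hC.2.1
  obtain ⟨hCR1, hCR2⟩ := ordU_prod hCR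
  -- The displacement of `C` is thus independent of `ξ` up to `O(η ^ s)`. Its means define a map `T`
  -- that commutes with `R` exactly, so that `P ∘ T` conjugates to the same order as `P` and is `O(η
  -- ^ s)`-close to `U`.
  obtain ⟨d₁, hd1, hd1'⟩ := hc1.near_mean hγ ht.le hρ
    (hCR1.congr (Eventually.of_forall fun p => by simp [R, rotation]; ring))
  obtain ⟨d₂, hd2, hd2'⟩ := hc2.near_mean hγ ht.le hρ
    (hCR2.congr (Eventually.of_forall fun p => by simp [R, rotation]))
  set T := nearIdentity (fun _ η => d₁ η) (fun _ η => d₂ η) with hTd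
  have hT : QPMap ω T := by
    rw [hTd, qpMap_nearIdentity]
    refine ⟨hd1.isQPAnalytic ht hρ, hd2.isQPAnalytic ht hρ, fun ξ => ?_⟩
    obtain ⟨s', rfl⟩ : ∃ s', s = s' + 1 := ⟨s - 1, by omega⟩
    have a1 := hd1'.apply_zero ξ
    have a2 := hd2'.apply_zero ξ
    have a3 := hC.2.2 ξ
    exact ⟨by linarith [a3.1], by linarith [a3.2]⟩
  have hTC : (fun p => T p - C p) =O[nearAxis] fun p : ℝ × ℝ => p.2 ^ s := by
    refine (IsBigO.prod_left hd1' hd2').neg_left.congr_left fun p => ?_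
    ext <;> simp [T, nearIdentity] <;> ring
  have hTR : ∀ p, T (R p) = R (T p) := fun p => by
    simp [T, R, nearIdentity, rotation]; ring
  have hPT := hP.comp hT
  have hW : (fun p => P (T p) - U p) =O[nearAxis] fun p : ℝ × ℝ => p.2 ^ s := by
    refine ((hP.comp_sub_isBigO hT.tendsto hC.tendsto).trans hTC).congr' ?_ EventuallyEq.rfl
    filter_upwards [hPC] with p hp
    rw [hp]
  obtain ⟨hw1, hw2⟩ := ordU_prod hW
  set w₁ : ℝ → ℝ → ℝ := fun ξ η => (P (T (ξ, η)) - U (ξ, η)).1 with hw1d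
  set w₂ : ℝ → ℝ → ℝ := fun ξ η => (P (T (ξ, η)) - U (ξ, η)).2 with hw2d
  have hw1a : IsQPAnalytic ω w₁ := (hPT.1.sub hu).congr (Eventually.of_forall fun p => by
    simp [w₁, U, nearIdentity]; ring)
  have hw2a : IsQPAnalytic ω w₂ := (hPT.2.1.sub hv).congr (Eventually.of_forall fun p => by
    simp [w₂, U, nearIdentity]; ring)
  obtain ⟨hux, huy⟩ := hu.derivs
  obtain ⟨hvx, hvy⟩ := hv.derivs
  -- Cramer's rule for `w = DU · Z`, with `w = P ∘ T - U`; this `Z` is the required primitive.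
  set Z₁ : ℝ → ℝ → ℝ := fun ξ η => i ξ η * ((1 + dY v ξ η) * w₁ ξ η - dY u ξ η * w₂ ξ η) with hZ1
  set Z₂ : ℝ → ℝ → ℝ := fun ξ η => i ξ η * ((1 + dX u ξ η) * w₂ ξ η - dX v ξ η * w₁ ξ η) with hZ2
  have h1 := IsQPAnalytic.const (ω := ω) 1
  have hZ1a : IsQPAnalytic ω Z₁ := hi.mul (((h1.add hvy).mul hw1a).sub (huy.mul hw2a))
  have hZ2a : IsQPAnalytic ω Z₂ := hi.mul (((h1.add hux).mul hw2a).sub (hvx.mul hw1a))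
  have mul0 : ∀ {a b : ℝ → ℝ → ℝ} {n : ℕ}, IsQPAnalytic ω a → OrdU n b →
      OrdU n fun ξ η => a ξ η * b ξ η := fun ha hb => by
    simpa using ha.ordU_zero.mul hb
  have hZ1o : OrdU s Z₁ := mul0 hi ((mul0 (h1.add hvy) hw1).sub (mul0 huy hw2))
  have hZ2o : OrdU s Z₂ := mul0 hi ((mul0 (h1.add hux) hw2).sub (mul0 hvx hw1))
  have hWZ : ∀ᶠ p : ℝ × ℝ in nearAxis,
      w₁ p.1 p.2 = (1 + dX u p.1 p.2) * Z₁ p.1 p.2 + dY u p.1 p.2 * Z₂ p.1 p.2 ∧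
      w₂ p.1 p.2 = dX v p.1 p.2 * Z₁ p.1 p.2 + (1 + dY v p.1 p.2) * Z₂ p.1 p.2 := by
    filter_upwards [hid] with p hp
    constructor
    · simp only [hZ1, hZ2]; linear_combination (-w₁ p.1 p.2) * hp
    · simp only [hZ1, hZ2]; linear_combination (-w₂ p.1 p.2) * hp
  -- The Newton identity is read backwards at `U + w = P ∘ T`, whose defect is `O(η ^ (2s - 1))`.
  -- The remainder is `O(η ^ (2s))` and `DE · Z` is `O(η ^ (2s - 1))`, one order being lost to the
  -- derivative in `η`. Hence `E` is `(DU ∘ R)(Z ∘ R - Z)` to this order.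
  have hres : ∀ {h w w₀ : ℝ → ℝ → ℝ} (α β : ℝ), IsQPAnalytic ω h → IsQPAnalytic ω w →
      OrdU s (defect γ h u v w) →
      (∀ᶠ p : ℝ × ℝ in nearAxis, w₀ p.1 p.2 =
        (α + dX w p.1 p.2) * Z₁ p.1 p.2 + (β + dY w p.1 p.2) * Z₂ p.1 p.2) →
      OrdU (2 * s - 1) (defect γ h (fun ξ η => u ξ η + w₁ ξ η) (fun ξ η => v ξ η + w₂ ξ η)
        (fun ξ η => w ξ η + w₀ ξ η)) →
      OrdU (2 * s - 1) (fun ξ η => defect γ h u v w ξ η -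
        ((α + dX w (ξ + γ) η) * (Z₁ (ξ + γ) η - Z₁ ξ η) +
          (β + dY w (ξ + γ) η) * (Z₂ (ξ + γ) η - Z₂ ξ η))) := by
    intro h w w₀ α β hh hw hE hw₀ hN
    obtain ⟨hEx, hEy⟩ := OrdU.derivs hγ (hh.defect (γ := γ) hU hw) hE
    have o1 := (OrdU.taylorRem hγ hh hU hw1a hw2a hs hw1 hw2).mono (s' := 2 * s - 1) (by omega)
    have o2 := (hZ1o.mul hEx).mono (s' := 2 * s - 1) (by omega)
    have o3 := (hZ2o.mul hEy).mono (s' := 2 * s - 1) (by omega)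
    refine ((hN.sub o1).sub (o2.add o3)).congr ?_
    filter_upwards [hU.tendsto.eventually hh.hasPartials, hu.hasPartials, hv.hasPartials,
      hw.hasPartials, hR.eventually hw.hasPartials, hWZ, hw₀, hR.eventually hw₀]
      with p a1 a2 a3 a4 a5 a6 a7 a8
    have := defect_newton (γ := γ) (Y₁ := Z₁) (Y₂ := Z₂) (w₁ := w₁) (w₂ := w₂) (w₀ := w₀) α β
      a1 a2 a3 a4 a5 a6.1 a6.2 a7 a8
    linarith
  have hu1 : ∀ ξ η, ξ + (u ξ η + w₁ ξ η) = (P (T (ξ, η))).1 := fun ξ η => by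
    simp [w₁, U, nearIdentity]; ring
  have hv1 : ∀ ξ η, η + (v ξ η + w₂ ξ η) = (P (T (ξ, η))).2 := fun ξ η => by
    simp [w₂, U, nearIdentity]; ring
  have hPMT : (fun p => M (P (T p)) - P (T (R p))) =O[nearAxis]
      fun p : ℝ × ℝ => p.2 ^ (2 * s - 1) := by
    have e := (hPM.comp_tendsto hT.tendsto).trans
      (by simpa [Function.comp_def, OrdU] using hT.snd_ordU.pow (2 * s - 1))
    refine e.congr_left fun p => ?_
    rw [hTR]; rfl
  obtain ⟨hN1, hN2⟩ := ordU_prod hPMT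
  have r1 := hres (w₀ := w₁) 1 0 hf hu hE₁ (hWZ.mono fun p hp => by rw [hp.1]; ring)
    (hN1.congr (Eventually.of_forall fun p => by
      have e1 := hu1 p.1 p.2
      have e2 := hu1 (p.1 + γ) p.2
      simp only [defect, hu1, hv1, M, mapM, Prod.fst_sub, R, rotation]
      linarith))
  have r2 := hres (w₀ := w₂) 0 1 hg hv hE₂ (hWZ.mono fun p hp => by rw [hp.2]; ring)
    (hN2.congr (Eventually.of_forall fun p => by
      have e1 := hv1 p.1 p.2
      have e2 := hv1 (p.1 + γ) p.2
      simp only [defect, hu1, hv1, M, mapM, Prod.snd_sub, R, rotation]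
      linarith))
  refine ⟨Z₁, Z₂, hZ1a, hZ2a, ?_, ?_⟩
  · refine (mul0 (hi.shift γ) ((mul0 (h1.add (hvy.shift γ)) r1).sub
      (mul0 (huy.shift γ) r2))).congr ?_
    filter_upwards [hR.eventually hid] with p hp
    simp only [hRd, QPReversible.rotation] at hp
    simp only [pullFst]
    linear_combination (Z₁ (p.1 + γ) p.2 - Z₁ p.1 p.2) * hp
  · refine (mul0 (hi.shift γ) ((mul0 (h1.add (hux.shift γ)) r2).sub
      (mul0 (hvx.shift γ) r1))).congr ?_
    filter_upwards [hR.eventually hid] with p hp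
    simp only [hRd, QPReversible.rotation] at hp
    simp only [pullSnd]
    linear_combination (Z₂ (p.1 + γ) p.2 - Z₂ p.1 p.2) * hp

end QPReversible

end

/-! ### One Newton step with estimates. -/

noncomputable section

namespace QPReversible

open Filter Topology Asymptotics

variable {m : ℕ} {ω : Fin m → ℝ} {γ : ℝ}

/-! ### The Newton step -/

theorem RRep.inv_one_add {t ρ q : ℝ} {d : ℝ → ℝ → ℝ} (ht : 0 ≤ t) (hρ : 0 < ρ) (hq : q ≤ 1 / 2)
    (hd : RRep ω 0 t ρ q d) :
    RRep ω 0 t ρ 2 (fun ξ η => (1 + d ξ η)⁻¹) ∧ ∀ ξ η : ℝ, |η| < ρ → 1 + d ξ η ≠ 0 := by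
  have hq0 : 0 ≤ q := Rep.nonneg hρ.le hd
  have hq1 : q < 1 := by linarith
  have hlt : ∀ ξ η : ℝ, |η| < ρ → |d ξ η| < 1 := fun ξ η hη => (hd.abs_le ht ξ hη).trans_lt hq1
  constructor
  · have hs := summable_geometric_of_lt_one hq0 hq1
    refine (RRep.hasSum ht hρ.le hs (H := fun n ξ η => (-d ξ η) ^ n)
      (fun n => (hd.neg ht hρ.le).pow ht hρ n) fun ξ η hη => ?_).mono_const ?_
    · have := hasSum_geometric_of_abs_lt_one (r := -d ξ η) (by rw [abs_neg]; exact hlt ξ η hη)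
      rwa [sub_neg_eq_add] at this
    · rw [tsum_geometric_of_lt_one hq0 hq1, inv_le_comm₀ (by linarith) two_pos]
      linarith
  · intro ξ η hη
    have := (abs_lt.1 (hlt ξ η hη)).1
    linarith

/-- `U = I + (u, v)` conjugates `M` to the rotation up to an error of size `ε` divisible by
`η ^ s`. -/
structure Approx (ω : Fin m → ℝ) (γ : ℝ) (f g : ℝ → ℝ → ℝ) (s : ℕ) (t ρ a ε : ℝ)
    (u v : ℝ → ℝ → ℝ) : Prop where
  fst : RRep ω 2 t ρ a u
  snd : RRep ω 2 t ρ a v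
  fst_dX : RRep ω 0 t ρ a (dX u)
  fst_dY : RRep ω 0 t ρ a (dY u)
  snd_dX : RRep ω 0 t ρ a (dX v)
  snd_dY : RRep ω 0 t ρ a (dY v)
  defect_fst : RRep ω s t ρ ε (defect γ f u v u)
  defect_snd : RRep ω s t ρ ε (defect γ g u v v)

theorem RRep.bounded_mul_sub {s : ℕ} {t ρ a ε c : ℝ} {i x y E₁ E₂ : ℝ → ℝ → ℝ} (ht : 0 ≤ t)
    (hρ : 0 < ρ) (hi : RRep ω 0 t ρ c i) (hx : RRep ω 0 t ρ a x) (hy : RRep ω 0 t ρ a y)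
    (h₁ : RRep ω s t ρ ε E₁) (h₂ : RRep ω s t ρ ε E₂) :
    RRep ω s t ρ (c * ((1 + a) * ε + a * ε))
      fun ξ η => i ξ η * ((1 + x ξ η) * E₁ ξ η - y ξ η * E₂ ξ η) := by
  have e1 := (RRep.const (ω := ω) (t := t) (ρ := ρ) 1).add ht hρ.le hx
  have := hi.mul ht hρ ((e1.mul ht hρ h₁).sub ht hρ.le
    (by simpa using hy.mul ht hρ h₂))
  simpa using this

/-- The mean of the pulled back defect is of quadratic order. -/
theorem mean_ordU {s : ℕ} {t' ρ K : ℝ} {B Y Z : ℝ → ℝ → ℝ} {Bm : ℝ → ℝ} (ht' : 0 ≤ t')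
    (hρ : 0 < ρ) (hY : RRep ω 0 t' ρ K Y)
    (hYB : ∀ ξ η : ℝ, |η| < ρ → Y (ξ + γ) η - Y ξ η = B ξ η - Bm η)
    (hZ : IsQPAnalytic ω Z)
    (hO : OrdU s fun ξ η => B ξ η - (Z (ξ + γ) η - Z ξ η)) :
    OrdU s fun _ η => Bm η := by
  obtain ⟨C, hC, δ, hδ, hb⟩ := ordU_iff.1 hO
  obtain ⟨C', hC', δ', hδ', hb'⟩ := ordU_iff.1 hZ.ordU_zero
  refine ordU_iff.2 ⟨C, hC, min ρ (min δ δ'), by positivity, fun _ η hη => ?_⟩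
  have h1 : |η| < ρ := hη.trans_le (min_le_left _ _)
  have h2 : |η| < δ := hη.trans_le ((min_le_right _ _).trans (min_le_left _ _))
  have h3 : |η| < δ' := hη.trans_le ((min_le_right _ _).trans (min_le_right _ _))
  exact abs_mean_le (γ := γ) (B := fun ξ => B ξ η) (Y := fun ξ => Y ξ η) (Z := fun ξ => Z ξ η)
    (H := fun ξ => B ξ η - (Z (ξ + γ) η - Z ξ η)) (fun ξ => hY.abs_le ht' ξ h1)
    (fun ξ => hb' ξ η h3) (fun ξ => hb ξ η h2) (fun ξ => hYB ξ η h1) (fun ξ => by ring)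

/-- The summands are the Taylor remainder with `Z = c / w`, the two parts of `DE · Y`, and `DU ∘ R`
applied to the mean. All but the last are quadratic in `w`; the last is linear in `ε`, with the
factor `ϑ` won by shrinking the radius. -/
theorem newton_bound {Ω a c w δ ρ ρ' y ε ϑ α β : ℝ} (hc : 0 < c) (hw : 0 < w) (hδ : 0 < δ)
    (hδρ : ρ' + δ ≤ ρ) (hy : 0 < y) (hε : 0 < ε) (hεw : ε ≤ w) (hyΩ : Ω * (2 * y) / δ ≤ w)
    (hy1 : 2 * y / δ ≤ w) (hϑ : 0 ≤ ϑ) (hαβ : |α| + |β| ≤ 1) (ha : a ≤ 1 / 2) :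
    1 / (c / w) ^ 2 + y * (Ω * ε / (2 * δ)) + y * (ε / (ρ - ρ')) +
      ((|α| + a) * (ϑ * (4 * ε)) + (|β| + a) * (ϑ * (4 * ε))) ≤
      (1 / c ^ 2 + 1) * w ^ 2 + 8 * (ϑ * ε) := by
  have b1 : 1 / (c / w) ^ 2 = 1 / c ^ 2 * w ^ 2 := by field_simp
  have b2 : y * (Ω * ε / (2 * δ)) ≤ w * ε / 4 := by
    have := mul_le_mul_of_nonneg_right hyΩ hε.le
    calc _ = Ω * (2 * y) / δ * ε / 4 := by field_simp; ring
      _ ≤ _ := by linarith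
  have b3 : y * (ε / (ρ - ρ')) ≤ w * ε / 2 := by
    have h1 : ε / (ρ - ρ') ≤ ε / δ := div_le_div_of_nonneg_left hε.le hδ (by linarith)
    have := mul_le_mul_of_nonneg_right hy1 hε.le
    calc _ ≤ y * (ε / δ) := mul_le_mul_of_nonneg_left h1 hy.le
      _ = 2 * y / δ * ε / 2 := by field_simp
      _ ≤ _ := by linarith
  have b4 : w * ε ≤ w ^ 2 := by rw [sq]; exact mul_le_mul_of_nonneg_left hεw hw.le
  have b5 : (|α| + |β| + 2 * a) * (ϑ * ε) ≤ 2 * (ϑ * ε) :=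
    mul_le_mul_of_nonneg_right (by linarith) (by positivity)
  have b6 : 0 ≤ w * ε := by positivity
  rw [b1]
  linarith

-- Of the strip loss `2 * δ`, one `δ` pays for the small divisors and one for derivatives of the
-- correction. The homological equation leaves the mean of the pulled back defect; the hypothesis
-- `happ` gives it order `2 * s - 1`, so it is small on the radius `ρ'`. The number `c` is the
-- margin reserved in the domain of `f` and `g`, once for `U` and once for the enlarged correction.
set_option maxHeartbeats 1600000 in
theorem Approx.step {C₀ : ℝ} {τ : ℕ} (hsd : SmallDivisors ω γ C₀ τ) {f g : ℝ → ℝ → ℝ}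
    {t₀ t ρ ρ' δ θ a c ε w : ℝ} {s : ℕ} {u v : ℝ → ℝ → ℝ}
    (hf : RRep ω 2 t₀ 2 1 f) (hg : RRep ω 2 t₀ 2 1 g) (hs : 2 ≤ s)
    (happ : ∃ P, QPDiffeo ω P ∧ (fun p => mapM γ f g (P p) - P (rotation γ p)) =O[nearAxis]
      fun p : ℝ × ℝ => p.2 ^ (2 * s - 1))
    (h : Approx ω γ f g s t ρ a ε u v) (hc : 0 < c) (hc1 : c ≤ 1 / 16)
    (hct : t + freqBound ω * (2 * c) ≤ t₀) (hδ : 0 < δ) (hδ1 : δ ≤ 1) (hδt : 2 * δ < t)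
    (hρ : ρ ≤ 1) (hρ' : 0 < ρ') (hρθ : ρ' ≤ θ * ρ) (hθ0 : 0 ≤ θ) (hθ1 : θ ≤ 1)
    (hδρ : ρ' + δ ≤ ρ) (ha : a ≤ c) (hε : 0 < ε)
    (hw : w = (8 * C₀ * τ.factorial * (freqBound ω + 1) + 1) * (ε / δ ^ (τ + 1))) (hwc : w ≤ c) :
    ∃ u' v', Approx ω γ f g (2 * s - 1) (t - 2 * δ) ρ' (a + w)
        ((1 / c ^ 2 + 1) * w ^ 2 + 8 * (θ ^ (2 * s - 1) * ε)) u' v' ∧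
      RRep ω 2 (t - 2 * δ) ρ' w (fun ξ η => u' ξ η - u ξ η) ∧
      RRep ω 2 (t - 2 * δ) ρ' w (fun ξ η => v' ξ η - v ξ η) := by
  have hΩ := freqBound_pos (ω := ω)
  have hγ := hsd.ne_one
  have hC₀ := hsd.1
  have ht : 0 < t := by linarith
  have hρ0 : 0 < ρ := by linarith
  have ha0 : 0 ≤ a := Rep.nonneg hρ0.le h.fst
  -- the determinant
  set d : ℝ → ℝ → ℝ := fun ξ η => dX u ξ η + dY v ξ η + (dX u ξ η * dY v ξ η - dY u ξ η * dX v ξ η)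
    with hd
  -- The determinant of `DU` is `1 + d` with `d` of norm at most `2a + 2a²`, and `a ≤ 1 / 16`.
  have hdR : RRep ω 0 t ρ (1 / 2) d := by
    refine (((h.fst_dX.add ht.le hρ0.le h.snd_dY).add ht.le hρ0.le
      ((h.fst_dX.mul ht.le hρ0 h.snd_dY).sub ht.le hρ0.le
        (h.fst_dY.mul ht.le hρ0 h.snd_dX)))).mono_const ?_
    nlinarith
  obtain ⟨hi, hid⟩ := hdR.inv_one_add ht.le hρ0 le_rfl
  set i : ℝ → ℝ → ℝ := fun ξ η => (1 + d ξ η)⁻¹ with hidef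
  -- the pulled back defect
  set E₁ := defect γ f u v u with hE1
  set E₂ := defect γ g u v v with hE2
  have hB₁ : RRep ω s t ρ (4 * ε) (pullFst γ i u v E₁ E₂) := by
    refine ((hi.shift ht.le hρ0.le γ).bounded_mul_sub ht.le hρ0 (h.snd_dY.shift ht.le hρ0.le γ)
      (h.fst_dY.shift ht.le hρ0.le γ) h.defect_fst h.defect_snd).mono_const ?_
    nlinarith
  have hB₂ : RRep ω s t ρ (4 * ε) (pullSnd γ i u v E₁ E₂) := by
    refine ((hi.shift ht.le hρ0.le γ).bounded_mul_sub ht.le hρ0 (h.fst_dX.shift ht.le hρ0.le γ)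
      (h.snd_dX.shift ht.le hρ0.le γ) h.defect_snd h.defect_fst).mono_const ?_
    nlinarith
  obtain ⟨Y₁, m₁, hY₁, hm₁, hYm₁⟩ := hB₁.homological hsd hρ0 (t' := t - δ) (by linarith)
    (by linarith)
  obtain ⟨Y₂, m₂, hY₂, hm₂, hYm₂⟩ := hB₂.homological hsd hρ0 (t' := t - δ) (by linarith)
    (by linarith)
  rw [sub_sub_cancel] at hY₁ hY₂
  set y := C₀ * τ.factorial / δ ^ τ * (4 * ε) with hy
  have hy0 : 0 < y := by positivity
  -- Here `y` bounds `Y₁` and `Y₂`, and `2 * y` the correction. The definition of `w` makes it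
  -- dominate `2 * y * (freqBound ω + 1) / δ`, hence the correction and its derivatives; the summand
  -- `1` in its constant gives `ε ≤ w`.
  have hw0 : 0 < w := by rw [hw]; positivity
  have hεw : ε ≤ w := by
    have h1 : ε ≤ ε / δ ^ (τ + 1) := by
      rw [le_div_iff₀ (by positivity)]
      exact mul_le_of_le_one_right hε.le (pow_le_one₀ hδ.le hδ1)
    have h2 : 0 ≤ 8 * C₀ * τ.factorial * (freqBound ω + 1) * (ε / δ ^ (τ + 1)) := by positivity
    rw [hw, add_mul, one_mul]
    linarith
  have hyw : 2 * y * (freqBound ω + 1) / δ ≤ w := by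
    have h1 : 2 * y * (freqBound ω + 1) / δ =
        8 * C₀ * τ.factorial * (freqBound ω + 1) * (ε / δ ^ (τ + 1)) := by
      rw [hy]; field_simp; ring
    have h2 : 0 ≤ ε / δ ^ (τ + 1) := by positivity
    rw [h1, hw, add_mul, one_mul]
    linarith
  have hsplit : 2 * y * (freqBound ω + 1) / δ = freqBound ω * (2 * y) / δ + 2 * y / δ := by ring
  have hyΩ0 : 0 ≤ freqBound ω * (2 * y) / δ := by positivity
  have hy10 : 0 ≤ 2 * y / δ := by positivity
  have hyΩ : freqBound ω * (2 * y) / δ ≤ w := by linarith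
  have hy1 : 2 * y / δ ≤ w := by linarith
  have hy2 : 2 * y ≤ w := by
    refine le_trans ?_ hy1
    rw [le_div_iff₀ hδ]
    nlinarith
  -- the correction
  have htδ : 0 ≤ t - δ := by linarith
  have lift : ∀ {n : ℕ} {K : ℝ} {x : ℝ → ℝ → ℝ}, RRep ω n t ρ K x → RRep ω n (t - δ) ρ K x :=
    fun hx => hx.mono le_rfl htδ (by linarith) hρ0.le le_rfl le_rfl
  set w₁ : ℝ → ℝ → ℝ := fun ξ η => (1 + dX u ξ η) * Y₁ ξ η + dY u ξ η * Y₂ ξ η with hw1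
  set w₂ : ℝ → ℝ → ℝ := fun ξ η => dX v ξ η * Y₁ ξ η + (1 + dY v ξ η) * Y₂ ξ η with hw2
  have hone := RRep.const (ω := ω) (t := t - δ) (ρ := ρ) 1
  have hw₁ : RRep ω s (t - δ) ρ (2 * y) w₁ := by
    have := (((hone.add htδ hρ0.le (lift h.fst_dX)).mul htδ hρ0 hY₁)).add htδ hρ0.le
      ((lift h.fst_dY).mul htδ hρ0 hY₂)
    rw [zero_add] at this
    refine this.mono_const ?_
    rw [abs_one]; nlinarith
  have hw₂ : RRep ω s (t - δ) ρ (2 * y) w₂ := by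
    have := ((lift h.snd_dX).mul htδ hρ0 hY₁).add htδ hρ0.le
      ((hone.add htδ hρ0.le (lift h.snd_dY)).mul htδ hρ0 hY₂)
    rw [zero_add] at this
    refine this.mono_const ?_
    rw [abs_one]; nlinarith
  have ht2 : 0 ≤ t - 2 * δ := by linarith
  have low : ∀ {n n' : ℕ} {K K' : ℝ} {x : ℝ → ℝ → ℝ}, RRep ω n (t - δ) ρ K x → n' ≤ n → K ≤ K' →
      RRep ω n' (t - 2 * δ) ρ' K' x :=
    fun hx hn hK => hx.mono hn ht2 (by linarith) hρ'.le (by linarith) hK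
  have der : ∀ {x : ℝ → ℝ → ℝ}, RRep ω s (t - δ) ρ (2 * y) x →
      RRep ω 0 (t - 2 * δ) ρ' w (dX x) ∧ RRep ω 0 (t - 2 * δ) ρ' w (dY x) := fun hx => by
    obtain ⟨h1, h2⟩ := hx.deriv_bounds ht2 (by linarith) hρ' (by linarith)
    rw [show t - δ - (t - 2 * δ) = δ by ring] at h1
    refine ⟨Rep.mono_order (h1.mono_const hyΩ) (Nat.zero_le _),
      Rep.mono_order (h2.mono_const (le_trans ?_ hy1)) (Nat.zero_le _)⟩
    gcongr
    linarith
  obtain ⟨dw₁x, dw₁y⟩ := der hw₁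
  obtain ⟨dw₂x, dw₂y⟩ := der hw₂
  have addder : ∀ {x z : ℝ → ℝ → ℝ}, RRep ω 2 t ρ a x → RRep ω s (t - δ) ρ (2 * y) z →
      ∀ ξ η : ℝ, |η| < ρ' → dX (fun ξ η => x ξ η + z ξ η) ξ η = dX x ξ η + dX z ξ η ∧
        dY (fun ξ η => x ξ η + z ξ η) ξ η = dY x ξ η + dY z ξ η := fun {x z} hx hz ξ η hη => by
    have a1 : HasPartials x ξ η := hx.hasFDerivAt ht ξ (by linarith)
    have a2 : HasPartials z ξ η := hz.hasFDerivAt (by linarith) ξ (by linarith)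
    exact ⟨(a1.fst.add a2.fst).deriv, (a1.snd.add a2.snd).deriv⟩
  -- the mean
  have hMqp : QPMap ω (nearIdentity f g) := by
    rw [qpMap_nearIdentity]
    have ht₀ : 0 < t₀ := by nlinarith
    refine ⟨hf.isQPAnalytic ht₀ two_pos, hg.isQPAnalytic ht₀ two_pos, fun ξ =>
      ⟨(hf.ordU ht₀.le two_pos).apply_zero ξ, (hg.ordU ht₀.le two_pos).apply_zero ξ⟩⟩
  have hUqp : QPMap ω (nearIdentity u v) := by
    rw [qpMap_nearIdentity]
    refine ⟨h.fst.isQPAnalytic ht hρ0, h.snd.isQPAnalytic ht hρ0, fun ξ =>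
      ⟨(h.fst.ordU ht.le hρ0).apply_zero ξ, (h.snd.ordU ht.le hρ0).apply_zero ξ⟩⟩
  obtain ⟨P, hP, hPM⟩ := happ
  obtain ⟨Z₁, Z₂, hZ₁, hZ₂, hZB₁, hZB₂⟩ := exists_near_coboundary hγ (by omega : 1 ≤ s) hMqp hUqp
    (h.defect_fst.ordU ht.le hρ0) (h.defect_snd.ordU ht.le hρ0) (hi.isQPAnalytic ht hρ0)
    (eventually_nearAxis.2 ⟨ρ, hρ0, fun ξ η hη => by
      have := hid ξ η hη
      simp only [hidef]
      rw [inv_mul_eq_one₀ this, hd]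
      ring⟩) hP hPM
  -- The qualitative order of the mean is converted into size: its order is raised at the same norm,
  -- and the smaller radius contributes `θ ^ (2 * s - 1)`.
  have hmean : ∀ {B Y Z : ℝ → ℝ → ℝ} {Bm : ℝ → ℝ}, RRep ω s (t - δ) ρ y Y →
      (∀ ξ η : ℝ, |η| < ρ → Y (ξ + γ) η - Y ξ η = B ξ η - Bm η) →
      RRep ω s t ρ (4 * ε) (fun _ η => Bm η) → IsQPAnalytic ω Z →
      OrdU (2 * s - 1) (fun ξ η => B ξ η - (Z (ξ + γ) η - Z ξ η)) →
      RRep ω (2 * s - 1) (t - 2 * δ) ρ' (θ ^ (2 * s - 1) * (4 * ε)) (fun _ η => Bm η) := by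
    intro B Y Z Bm hY hYB hBm hZ hO
    have o1 := mean_ordU htδ hρ0 (Rep.mono_order hY (Nat.zero_le _)) hYB
      hZ hO
    have := (RRep.upgrade hγ ht.le hρ0 (Rep.mono_order hBm (Nat.zero_le _))
      fun ξ => o1.isBigO ξ).shrink ht.le hρ'.le hρ0.le hθ1 hθ0 hρθ
    exact this.mono le_rfl ht2 (by linarith) hρ'.le le_rfl le_rfl
  have hm₁' := hmean hY₁ hYm₁ hm₁ hZ₁ hZB₁
  have hm₂' := hmean hY₂ hYm₂ hm₂ hZ₂ hZB₂
  -- the new defect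
  have hlow : ∀ {n : ℕ} {K : ℝ} {x : ℝ → ℝ → ℝ}, RRep ω n t ρ K x → RRep ω n (t - 2 * δ) ρ' K x :=
    fun hx => hx.mono le_rfl ht2 (by linarith) hρ'.le (by linarith) le_rfl
  have hone' := RRep.const (ω := ω) (t := t - 2 * δ) (ρ := ρ') 1
  have hnew : ∀ {k x z : ℝ → ℝ → ℝ} (α β : ℝ), |α| + |β| ≤ 1 → RRep ω 2 t₀ 2 1 k →
      RRep ω 2 t ρ a x → RRep ω 0 t ρ a (dX x) → RRep ω 0 t ρ a (dY x) →
      RRep ω s t ρ ε (defect γ k u v x) →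
      (∀ ξ η, z ξ η = (α + dX x ξ η) * Y₁ ξ η + (β + dY x ξ η) * Y₂ ξ η) →
      (∀ ξ η : ℝ, |η| < ρ → (α + dX x (ξ + γ) η) * pullFst γ i u v E₁ E₂ ξ η +
        (β + dY x (ξ + γ) η) * pullSnd γ i u v E₁ E₂ ξ η = defect γ k u v x ξ η) →
      RRep ω (2 * s - 1) (t - 2 * δ) ρ' ((1 / c ^ 2 + 1) * w ^ 2 + 8 * (θ ^ (2 * s - 1) * ε))
        (defect γ k (fun ξ η => u ξ η + w₁ ξ η) (fun ξ η => v ξ η + w₂ ξ η)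
          (fun ξ η => x ξ η + z ξ η)) := by
    intro k x z α β hαβ hk hx hxx hxy hE hz hpull
    have hα := abs_nonneg α
    have hβ := abs_nonneg β
    obtain ⟨hEx, hEy⟩ := hE.deriv_bounds ht2 (by linarith) hρ' (by linarith)
    rw [sub_sub_cancel] at hEx
    -- The correction, bounded by `w`, may be enlarged by `Z = c / w` up to the margin `c`; this
    -- makes the remainder `w² / c²`.
    have q1 := (hk.remainder ht2 hρ' hc hc hw0 hw0 (Z := c / w) (by rwa [one_le_div hw0])
      (by rw [div_mul_cancel₀ _ hw0.ne']; linarith) (by rw [div_mul_cancel₀ _ hw0.ne']; linarith)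
      (Rep.mono_order ((hlow h.fst).mono_const ha) (Nat.zero_le _))
      (Rep.mono_order ((hlow h.snd).mono_const ha) (Nat.zero_le _))
      (low hw₁ le_rfl hy2) (low hw₂ le_rfl hy2)).2
    have q1' := Rep.mono_order q1 (by omega : 2 * s - 1 ≤ s * 2)
    have q2 : RRep ω (2 * s - 1) (t - 2 * δ) ρ' (y * (freqBound ω * ε / (2 * δ)))
        (fun ξ η => Y₁ ξ η * dX (defect γ k u v x) ξ η) :=
      Rep.mono_order ((low hY₁ le_rfl le_rfl).mul ht2 hρ' hEx) (by omega)
    have q3 : RRep ω (2 * s - 1) (t - 2 * δ) ρ' (y * (ε / (ρ - ρ')))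
        (fun ξ η => Y₂ ξ η * dY (defect γ k u v x) ξ η) :=
      Rep.mono_order ((low hY₂ le_rfl le_rfl).mul ht2 hρ' hEy) (by omega)
    have q4 := ((((RRep.const (ω := ω) (t := t - 2 * δ) (ρ := ρ') α).add ht2 hρ'.le
      ((hlow hxx).shift ht2 hρ'.le γ)).mul ht2 hρ' hm₁').add ht2 hρ'.le
      (((RRep.const (ω := ω) (t := t - 2 * δ) (ρ := ρ') β).add ht2 hρ'.le
      ((hlow hxy).shift ht2 hρ'.le γ)).mul ht2 hρ' hm₂'))
    rw [zero_add] at q4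
    refine ((((RRep.add ht2 hρ'.le q1' q2).add ht2 hρ'.le q3).add ht2 hρ'.le q4).mono_const
      ?_).congr fun ξ η hη => ?_
    · exact newton_bound hc hw0 hδ hδρ hy0 hε hεw hyΩ hy1 (pow_nonneg hθ0 _) hαβ (by linarith)
    · have hη1 : |η| < ρ := by linarith
      have hv1 := h.snd.abs_le ht.le ξ hη1
      have hv2 := abs_add_le η (v ξ η)
      have := defect_newton (γ := γ) (h := k) (u := u) (v := v) (w := x) (Y₁ := Y₁) (Y₂ := Y₂)
        (w₁ := w₁) (w₂ := w₂) (w₀ := z) (ξ := ξ) (η := η) α β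
        (hk.hasFDerivAt (by nlinarith) _ (by linarith)) (h.fst.hasFDerivAt ht ξ hη1)
        (h.snd.hasFDerivAt ht ξ hη1) (hx.hasFDerivAt ht ξ hη1) (hx.hasFDerivAt ht _ hη1)
        rfl rfl (hz ξ η) (hz (ξ + γ) η)
      rw [this, hYm₁ ξ η hη1, hYm₂ ξ η hη1, taylorRem]
      -- `DU ∘ R` undoes the pull back, so the old defect cancels and the homological equation
      -- leaves only the means.
      linear_combination -hpull ξ η hη1
  refine ⟨fun ξ η => u ξ η + w₁ ξ η, fun ξ η => v ξ η + w₂ ξ η, ⟨?_, ?_, ?_, ?_, ?_, ?_, ?_, ?_⟩,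
    ?_, ?_⟩
  · exact (hlow h.fst).add ht2 hρ'.le (low hw₁ hs hy2)
  · exact (hlow h.snd).add ht2 hρ'.le (low hw₂ hs hy2)
  · exact ((hlow h.fst_dX).add ht2 hρ'.le dw₁x).congr fun ξ η hη => (addder h.fst hw₁ ξ η hη).1
  · exact ((hlow h.fst_dY).add ht2 hρ'.le dw₁y).congr fun ξ η hη => (addder h.fst hw₁ ξ η hη).2
  · exact ((hlow h.snd_dX).add ht2 hρ'.le dw₂x).congr fun ξ η hη => (addder h.snd hw₂ ξ η hη).1
  · exact ((hlow h.snd_dY).add ht2 hρ'.le dw₂y).congr fun ξ η hη => (addder h.snd hw₂ ξ η hη).2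
  · refine hnew 1 0 (by simp) hf h.fst h.fst_dX h.fst_dY h.defect_fst (fun ξ η => by
      simp only [hw1]; ring) fun ξ η hη => ?_
    have e := inv_mul_cancel₀ (hid (ξ + γ) η hη)
    simp only [pullFst, pullSnd, hidef]
    simp only [hd] at e ⊢
    linear_combination E₁ ξ η * e
  · refine hnew 0 1 (by simp) hg h.snd h.snd_dX h.snd_dY h.defect_snd (fun ξ η => by
      simp only [hw2]; ring) fun ξ η hη => ?_
    have e := inv_mul_cancel₀ (hid (ξ + γ) η hη)
    simp only [pullFst, pullSnd, hidef]
    simp only [hd] at e ⊢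
    linear_combination E₂ ξ η * e
  · exact (low hw₁ hs hy2).congr fun ξ η _ => by ring
  · exact (low hw₂ hs hy2).congr fun ξ η _ => by ring

end QPReversible

end

/-! ### Choice of parameters and convergence. -/

noncomputable section

namespace QPReversible

open Filter Topology Asymptotics

variable {m : ℕ} {ω : Fin m → ℝ} {γ : ℝ}

/-! ### Convergence of the Newton iteration -/

theorem exists_seq_of_step {α : Type*} {P : ℕ → α → Prop} {Q : ℕ → α → α → Prop} {a : α}
    (h0 : P 0 a) (hs : ∀ n x, P n x → ∃ y, P (n + 1) y ∧ Q n x y) :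
    ∃ x : ℕ → α, x 0 = a ∧ (∀ n, P n (x n)) ∧ ∀ n, Q n (x n) (x (n + 1)) := by
  choose! F hF using hs
  let x : ℕ → α := fun n => Nat.rec a (fun k y => F k y) n
  have hx : ∀ n, P n (x n) := fun n => by
    induction n with
    | zero => exact h0
    | succ n ih => exact (hF n _ ih).1
  exact ⟨x, rfl, hx, fun n => (hF n _ (hx n)).2⟩

theorem Approx.mono_const {f g u v : ℝ → ℝ → ℝ} {s : ℕ} {t ρ a a' ε ε' : ℝ}
    (h : Approx ω γ f g s t ρ a ε u v) (ha : a ≤ a') (hε : ε ≤ ε') :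
    Approx ω γ f g s t ρ a' ε' u v :=
  ⟨h.fst.mono_const ha, h.snd.mono_const ha, h.fst_dX.mono_const ha, h.fst_dY.mono_const ha,
    h.snd_dX.mono_const ha, h.snd_dY.mono_const ha, h.defect_fst.mono_const hε,
    h.defect_snd.mono_const hε⟩

theorem approx_zero {f g : ℝ → ℝ → ℝ} {t ρ ε : ℝ} (hf : RRep ω 2 t ρ ε f) (hg : RRep ω 2 t ρ ε g) :
    Approx ω γ f g 2 t ρ 0 ε (fun _ _ => 0) (fun _ _ => 0) := by
  have hx : dX (fun _ _ => (0 : ℝ)) = fun _ _ => 0 := by funext ξ η; simp [dX]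
  have hy : dY (fun _ _ => (0 : ℝ)) = fun _ _ => 0 := by funext ξ η; simp [dY]
  refine ⟨RRep.zero, RRep.zero, ?_, ?_, ?_, ?_, hf.congr fun ξ η _ => ?_,
    hg.congr fun ξ η _ => ?_⟩ <;> simp only [hx, hy, defect]
  iterate 4 exact RRep.zero
  all_goals simp

/-- The radii `exp (A (2⁻ⁿ - 1))`. -/
theorem radius_step {A : ℝ} (hA : 0 < A) (n : ℕ) :
    Real.exp (A * ((1 / 2) ^ (n + 1) - 1)) + Real.exp (-(2 * A)) * A / 2 * (1 / 2) ^ n ≤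
        Real.exp (A * ((1 / 2) ^ n - 1)) ∧
      Real.exp (A * ((1 / 2) ^ (n + 1) - 1)) ≤
        Real.exp (-(A * (1 / 2) ^ (n + 1))) * Real.exp (A * ((1 / 2) ^ n - 1)) ∧
      Real.exp (-(A * (1 / 2) ^ (n + 1))) ^ (2 * (2 ^ n + 1) - 1) ≤ Real.exp (-A) := by
  set x := A * (1 / 2) ^ (n + 1) with hx
  have hx0 : 0 < x := by positivity
  have hxA : x ≤ A := mul_le_of_le_one_right hA.le (pow_le_one₀ (by norm_num) (by norm_num))
  have hn : A * ((1 / 2) ^ n - 1) = 2 * x - A := by rw [hx, pow_succ]; ring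
  have hn1 : A * ((1 / 2) ^ (n + 1) - 1) = -x + (2 * x - A) := by rw [hx]; ring
  refine ⟨?_, ?_, ?_⟩
  · have h1 : A / 2 * (1 / 2) ^ n = x := by rw [hx, pow_succ]; ring
    -- The quotient of successive radii is `exp (-x)`; this inequality bounds the gap between them
    -- below by a multiple of `2⁻ⁿ`, which is what the losses `δ` require.
    have h2 : Real.exp (-x) * x ≤ 1 - Real.exp (-x) := by
      have e := Real.add_one_le_exp x
      have e2 := mul_le_mul_of_nonneg_left e (Real.exp_pos (-x)).le
      rw [← Real.exp_add, neg_add_cancel, Real.exp_zero] at e2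
      linarith
    have h3 : Real.exp (-(2 * A)) * x ≤ Real.exp (2 * x - A) * (Real.exp (-x) * x) := by
      rw [← mul_assoc (Real.exp (2 * x - A)), ← Real.exp_add]
      refine mul_le_mul_of_nonneg_right (Real.exp_le_exp.2 ?_) hx0.le
      linarith
    have h4 := mul_le_mul_of_nonneg_left h2 (Real.exp_pos (2 * x - A)).le
    rw [hn, hn1, Real.exp_add, mul_div_assoc, mul_assoc, h1]
    linarith
  · rw [hn, hn1, Real.exp_add]
  · rw [← Real.exp_nat_mul]
    refine Real.exp_le_exp.2 ?_
    have h1 : ((2 * (2 ^ n + 1) - 1 : ℕ) : ℝ) = 2 ^ (n + 1) + 1 := by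
      rw [show 2 * (2 ^ n + 1) - 1 = 2 ^ (n + 1) + 1 by rw [pow_succ]; omega]
      push_cast; ring
    have h2 : (2 : ℝ) ^ (n + 1) * x = A := by
      rw [hx, mul_left_comm, ← mul_pow]; norm_num
    rw [h1]
    nlinarith

-- The orders `sₙ = 2 ^ n + 1` satisfy `sₙ₊₁ = 2sₙ - 1`. The radii decrease from `1` to the positive
-- limit `exp (-A)`, yet their quotients raised to the power `sₙ₊₁` stay below `exp (-A)`, so the
-- means gain a fixed factor per step. Convergence is geometric: with `δₙ = d / 2 ^ n` the power `δₙ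
-- ^ (τ + 1)` decays like `β ^ n`, the defects like `β ^ (2n)`, and the corrections `wₙ` like `β ^
-- n`.
set_option maxHeartbeats 1000000 in
theorem exists_conjugacy_of_small {C₀ : ℝ} {τ : ℕ} (hsd : SmallDivisors ω γ C₀ τ) {t₀ : ℝ}
    (ht₀ : 0 < t₀) :
    ∃ ε₁ > 0, ∀ f g : ℝ → ℝ → ℝ, RRep ω 2 t₀ 2 ε₁ f → RRep ω 2 t₀ 2 ε₁ g →
      (∀ N : ℕ, ∃ P, QPDiffeo ω P ∧ (fun p => mapM γ f g (P p) - P (rotation γ p)) =O[nearAxis]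
        fun p : ℝ × ℝ => p.2 ^ N) →
      ∃ u v : ℝ → ℝ → ℝ, IsQPAnalytic ω u ∧ IsQPAnalytic ω v ∧ OrdU 2 u ∧ OrdU 2 v ∧
        ∀ᶠ p in nearAxis, mapM γ f g (nearIdentity u v p) = nearIdentity u v (rotation γ p) := by
  have hΩ := freqBound_pos (ω := ω)
  have hC₀ := hsd.1
  obtain ⟨β, hβ⟩ : ∃ β : ℝ, β = (1 / 2) ^ (τ + 1) := ⟨_, rfl⟩
  have hβ0 : 0 < β := by rw [hβ]; positivity
  have hβ1 : β ≤ 1 / 2 := by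
    rw [hβ]; exact pow_le_of_le_one (by norm_num) (by norm_num) (by omega)
  -- With `exp (-A) = β² / 16`, the mean term `8 * θ ^ (2s - 1) * ε` is at most `β² ε / 2`, half of
  -- the next admissible defect.
  set A : ℝ := Real.log (16 / β ^ 2) with hA
  have hA0 : 0 < A := by
    refine Real.log_pos ?_
    rw [lt_div_iff₀ (by positivity)]; nlinarith
  have hAexp : Real.exp (-A) = β ^ 2 / 16 := by
    rw [Real.exp_neg, hA, Real.exp_log (by positivity), inv_div]
  set c := min (1 / 16) (t₀ / (8 * freqBound ω)) with hc
  have hc0 : 0 < c := by positivity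
  have hcΩ : freqBound ω * (2 * c) ≤ t₀ / 4 := by
    have : c ≤ t₀ / (8 * freqBound ω) := min_le_right _ _
    rw [le_div_iff₀ (by positivity)] at this
    linarith
  -- The second bound keeps every strip above `t₀ / 4`, which exceeds `2δₙ`; the third keeps `δₙ`
  -- below the gap between radii.
  set d := min 1 (min (t₀ / 17) (Real.exp (-(2 * A)) * A / 2)) with hd
  have hd0 : 0 < d := by positivity
  have hd1 : d ≤ 1 := min_le_left _ _
  have hdt : d ≤ t₀ / 17 := (min_le_right _ _).trans (min_le_left _ _)
  have hdA : d ≤ Real.exp (-(2 * A)) * A / 2 := (min_le_right _ _).trans (min_le_right _ _)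
  obtain ⟨S, hS⟩ : ∃ S, S = (8 * C₀ * τ.factorial * (freqBound ω + 1) + 1) / d ^ (τ + 1) := ⟨_, rfl⟩
  have hS0 : 0 < S := by rw [hS]; positivity
  -- The second bound keeps the sum of all corrections within `c`. The third makes the quadratic
  -- term at most `β² ε / 2`, the other half of the next defect.
  set ε₁ := min 1 (min (c / (2 * S)) (β ^ 2 / (2 * ((1 / c ^ 2 + 1) * S ^ 2)))) with hε₁
  have hε0 : 0 < ε₁ := by positivity
  have hεc : 2 * (S * ε₁) ≤ c := by
    have : ε₁ ≤ c / (2 * S) := (min_le_right _ _).trans (min_le_left _ _)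
    rw [le_div_iff₀ (by positivity)] at this
    linarith
  have hεβ : (1 / c ^ 2 + 1) * (S * ε₁) ^ 2 ≤ ε₁ * β ^ 2 / 2 := by
    have : ε₁ ≤ β ^ 2 / (2 * ((1 / c ^ 2 + 1) * S ^ 2)) :=
      (min_le_right _ _).trans (min_le_right _ _)
    rw [le_div_iff₀ (by positivity)] at this
    nlinarith
  refine ⟨ε₁, hε0, fun f g hf hg happ => ?_⟩
  set t : ℕ → ℝ := fun n => t₀ / 2 - 4 * d * (1 - (1 / 2) ^ n) with ht
  set ρ : ℕ → ℝ := fun n => Real.exp (A * ((1 / 2) ^ n - 1)) with hρ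
  set a : ℕ → ℝ := fun n => 2 * (S * ε₁) * (1 - (1 / 2) ^ n) with ha
  set ε : ℕ → ℝ := fun n => ε₁ * (β ^ 2) ^ n with hε
  set w : ℕ → ℝ := fun n => S * ε₁ * β ^ n with hw
  have hhalf : ∀ n : ℕ, (0 : ℝ) < (1 / 2) ^ n ∧ (1 / 2 : ℝ) ^ n ≤ 1 := fun n =>
    ⟨by positivity, pow_le_one₀ (by norm_num) (by norm_num)⟩
  have hβn : ∀ n : ℕ, β ^ n ≤ (1 / 2) ^ n := fun n => pow_le_pow_left₀ hβ0.le hβ1 n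
  have hf1 := hf.mono_const (min_le_left 1 (min (c / (2 * S)) (β ^ 2 / (2 * ((1 / c ^ 2 + 1) * S ^ 2)))))
  have hg1 := hg.mono_const (min_le_left 1 (min (c / (2 * S)) (β ^ 2 / (2 * ((1 / c ^ 2 + 1) * S ^ 2)))))
  have ht4 : ∀ n, t₀ / 4 ≤ t n := fun n => by
    have := (hhalf n).1
    simp only [ht]; nlinarith
  have hρA : ∀ n, Real.exp (-A) ≤ ρ n := fun n => by
    refine Real.exp_le_exp.2 ?_
    have := (hhalf n).1
    nlinarith
  obtain ⟨x, hx0, hxP, hxQ⟩ := exists_seq_of_step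
    (P := fun n (x : (ℝ → ℝ → ℝ) × (ℝ → ℝ → ℝ)) =>
      Approx ω γ f g (2 ^ n + 1) (t n) (ρ n) (a n) (ε n) x.1 x.2)
    (Q := fun n x y => RRep ω 2 (t (n + 1)) (ρ (n + 1)) (w n) (fun ξ η => y.1 ξ η - x.1 ξ η) ∧
      RRep ω 2 (t (n + 1)) (ρ (n + 1)) (w n) (fun ξ η => y.2 ξ η - x.2 ξ η))
    (a := (fun _ _ => 0, fun _ _ => 0))
    (by
      have e1 : t 0 = t₀ / 2 := by simp [ht]
      have e2 : ρ 0 = 1 := by simp [hρ]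
      have e3 : a 0 = 0 := by simp [ha]
      have e4 : ε 0 = ε₁ := by simp [hε]
      rw [e1, e2, e3, e4]
      exact approx_zero (hf.mono le_rfl (by linarith) (by linarith) zero_le_one one_le_two le_rfl)
        (hg.mono le_rfl (by linarith) (by linarith) zero_le_one one_le_two le_rfl))
    (by
      rintro n ⟨u, v⟩ h
      obtain ⟨r1, r2, r3⟩ := radius_step hA0 n
      have hn := (hhalf n).1
      have hn1 := (hhalf n).2
      have htn : t (n + 1) = t n - 2 * (d * (1 / 2) ^ n) := by
        simp only [ht, pow_succ]; ring
      have hwn : w n = (8 * C₀ * τ.factorial * (freqBound ω + 1) + 1) *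
          (ε n / (d * (1 / 2) ^ n) ^ (τ + 1)) := by
        have e : ((1 / 2 : ℝ) ^ n) ^ (τ + 1) = β ^ n := by rw [hβ, ← pow_mul, ← pow_mul, mul_comm]
        simp only [hw, hε, hS]
        have hb : β ^ n ≠ 0 := (pow_pos hβ0 n).ne'
        rw [mul_pow d, e, pow_right_comm, sq, ← mul_assoc, mul_div_mul_right _ _ hb]
        ring
      have hwc : w n ≤ c := by
        have : w n ≤ S * ε₁ := mul_le_of_le_one_right (by positivity) ((hβn n).trans hn1)
        linarith [mul_pos hS0 hε0]
      have hac : a n ≤ c := by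
        have : a n ≤ 2 * (S * ε₁) := mul_le_of_le_one_right (by positivity) (by linarith)
        linarith
      obtain ⟨u', v', h1, h2, h3⟩ := Approx.step hsd hf1 hg1
        (by have := Nat.one_le_two_pow (n := n); omega)
        (happ _) h hc0 (min_le_left _ _)
        (by
          have : t n ≤ t₀ / 2 := by simp only [ht]; nlinarith
          linarith)
        (by positivity) (mul_le_one₀ hd1 hn.le hn1)
        (by have := ht4 n; nlinarith)
        (by
          simp only [hρ]
          rw [Real.exp_le_one_iff]
          nlinarith)
        (Real.exp_pos _) r2 (Real.exp_pos _).le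
        (by rw [Real.exp_le_one_iff]; have := (hhalf (n + 1)).1; nlinarith)
        (by
          have := mul_le_mul_of_nonneg_right hdA hn.le
          linarith)
        hac (by positivity : 0 < ε n) hwn hwc
      rw [← htn] at h1 h2 h3
      refine ⟨(u', v'), ?_, h2, h3⟩
      rw [show 2 * (2 ^ n + 1) - 1 = 2 ^ (n + 1) + 1 by rw [pow_succ]; omega] at h1 r3
      refine h1.mono_const ?_ ?_
      · have := mul_le_mul_of_nonneg_left (hβn n) (mul_pos hS0 hε0).le
        simp only [ha, hw, pow_succ]
        linarith
      · have e1 : w n ^ 2 = (S * ε₁) ^ 2 * (β ^ 2) ^ n := by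
          simp only [hw]; rw [mul_pow, ← pow_mul, ← pow_mul, mul_comm n 2]
        have e2 := mul_le_mul_of_nonneg_right hεβ (by positivity : 0 ≤ (β ^ 2) ^ n)
        have e3 := mul_le_mul_of_nonneg_right (r3.trans_eq hAexp) (by positivity : 0 ≤ ε n)
        have e4 : ε (n + 1) = ε₁ * β ^ 2 * (β ^ 2) ^ n := by simp only [hε, pow_succ]; ring
        rw [e1, e4]
        simp only [hε] at e3 ⊢
        linarith)
  set r := Real.exp (-A) with hr
  have hr0 : 0 < r := Real.exp_pos _
  have hr1 : r ≤ 1 := Real.exp_le_one_iff.2 (by linarith)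
  have ht0 : 0 < t₀ / 4 := by positivity
  have hwsum : HasSum w (S * ε₁ * (1 - β)⁻¹) :=
    (hasSum_geometric_of_lt_one hβ0.le (by linarith)).mul_left _
  have hwc : ∑' n, w n ≤ c := by
    rw [hwsum.tsum_eq]
    have : (1 - β)⁻¹ ≤ 2 := by
      rw [inv_le_comm₀ (by linarith) two_pos]; linarith
    nlinarith [mul_pos hS0 hε0]
  have hlim : ∀ z : ℕ → ℝ → ℝ → ℝ, z 0 = (fun _ _ => 0) →
      (∀ n, RRep ω 2 (t (n + 1)) (ρ (n + 1)) (w n) (fun ξ η => z (n + 1) ξ η - z n ξ η)) →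
      ∃ u, RRep ω 2 (t₀ / 4) r c u ∧
        ∀ ξ η : ℝ, |η| < r → Tendsto (fun n => z n ξ η) atTop (𝓝 (u ξ η)) := by
    intro z hz0 hz
    have hz' : ∀ n, RRep ω 2 (t₀ / 4) r (w n) (fun ξ η => z (n + 1) ξ η - z n ξ η) := fun n =>
      (hz n).mono le_rfl ht0.le (ht4 _) hr0.le (hρA _) le_rfl
    have hs : ∀ ξ η : ℝ, |η| < r → HasSum (fun n => z (n + 1) ξ η - z n ξ η)
        (∑' n, (z (n + 1) ξ η - z n ξ η)) := fun ξ η hη =>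
      (Summable.of_norm_bounded hwsum.summable fun n => (hz' n).abs_le ht0.le ξ hη).hasSum
    refine ⟨fun ξ η => ∑' n, (z (n + 1) ξ η - z n ξ η),
      (RRep.hasSum ht0.le hr0.le hwsum.summable hz' hs).mono_const hwc, fun ξ η hη => ?_⟩
    refine (hs ξ η hη).tendsto_sum_nat.congr fun n => ?_
    rw [Finset.sum_range_sub (fun n => z n ξ η), hz0, sub_zero]
  obtain ⟨u, hu, hul⟩ := hlim (fun n => (x n).1) (by rw [hx0]) fun n => (hxQ n).1
  obtain ⟨v, hv, hvl⟩ := hlim (fun n => (x n).2) (by rw [hx0]) fun n => (hxQ n).2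
  have hε0 : Tendsto ε atTop (𝓝 0) := by
    have h1 : β ^ 2 < 1 := by nlinarith
    simpa [hε] using (tendsto_pow_atTop_nhds_zero_of_lt_one (by positivity) h1).const_mul ε₁
  have hdef : ∀ {k z : ℝ → ℝ → ℝ} (zn : ℕ → ℝ → ℝ → ℝ), RRep ω 2 t₀ 2 ε₁ k →
      (∀ ξ η : ℝ, |η| < r → Tendsto (fun n => zn n ξ η) atTop (𝓝 (z ξ η))) →
      (∀ n, RRep ω (2 ^ n + 1) (t n) (ρ n) (ε n) (defect γ k (x n).1 (x n).2 (zn n))) →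
      ∀ ξ η : ℝ, |η| < r → defect γ k u v z ξ η = 0 := by
    intro k z zn hk hz hE ξ η hη
    have hη2 : |η + v ξ η| < 2 := by
      have h1 := hv.abs_le ht0.le ξ hη
      have h2 := abs_add_le η (v ξ η)
      have h3 : c ≤ 1 / 16 := min_le_left _ _
      linarith
    have h1 : Tendsto (fun n => defect γ k (x n).1 (x n).2 (zn n) ξ η) atTop
        (𝓝 (defect γ k u v z ξ η)) := by
      refine ((hz ξ η hη).add ?_).sub (hz (ξ + γ) η hη)
      have := (hk.continuousAt ht₀ (ξ := ξ + u ξ η) hη2).tendsto.comp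
        (((hul ξ η hη).const_add ξ).prodMk_nhds ((hvl ξ η hη).const_add η))
      exact this
    refine tendsto_nhds_unique h1 (squeeze_zero_norm (fun n => ?_) hε0)
    exact (hE n).abs_le (by have := ht4 n; linarith) ξ (hη.trans_le (hρA n))
  refine ⟨u, v, hu.isQPAnalytic ht0 hr0, hv.isQPAnalytic ht0 hr0, hu.ordU ht0.le hr0,
    hv.ordU ht0.le hr0, eventually_nearAxis.2 ⟨r, hr0, fun ξ η hη => ?_⟩⟩
  have e1 := hdef (z := u) (fun n => (x n).1) hf hul (fun n => (hxP n).defect_fst) ξ η hη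
  have e2 := hdef (z := v) (fun n => (x n).2) hg hvl (fun n => (hxP n).defect_snd) ξ η hη
  simp only [defect] at e1 e2
  simp only [mapM, nearIdentity, rotation, Prod.mk.injEq]
  constructor <;> linarith

end QPReversible

end

/-! ### Reduction to small perturbations. -/

noncomputable section

namespace QPReversible

open Filter Topology Asymptotics

variable {m : ℕ} {ω : Fin m → ℝ} {γ : ℝ}

/-! ### Removal of the smallness assumption by a dilation -/

theorem IsQPAnalytic.scale {f : ℝ → ℝ → ℝ} (hf : IsQPAnalytic ω f) {lam : ℝ} (hl : 0 < lam) :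
    IsQPAnalytic ω fun ξ η => f ξ (lam * η) := by
  obtain ⟨t, ht, ρ, hρ, K, hK⟩ := isQPAnalytic_iff.1 hf
  exact (hK.scale ht.le hρ.le hl).isQPAnalytic ht (by positivity)

theorem QPMap.conj_dilation {P : ℝ × ℝ → ℝ × ℝ} (hP : QPMap ω P) {lam : ℝ} (hl : 0 < lam) :
    QPMap ω (fun p => dilation lam⁻¹ (P (dilation lam p))) := by
  refine ⟨hP.1.scale hl, ((IsQPAnalytic.const lam⁻¹).mul (hP.2.1.scale hl)).congr
    (Eventually.of_forall fun p => ?_), fun ξ => ?_⟩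
  · simp only [dilation]
    field_simp
  · have := hP.2.2 ξ
    simp only [dilation, mul_zero]
    simp only [sub_zero] at this
    exact ⟨this.1, by rw [this.2]; simp⟩

theorem dilation_inv_dilation {lam : ℝ} (hl : lam ≠ 0) (p : ℝ × ℝ) :
    dilation lam⁻¹ (dilation lam p) = p := by
  simp [dilation, hl]

theorem dilation_dilation_inv {lam : ℝ} (hl : lam ≠ 0) (p : ℝ × ℝ) :
    dilation lam (dilation lam⁻¹ p) = p := by
  simp [dilation, hl]

theorem QPDiffeo.conj_dilation {P : ℝ × ℝ → ℝ × ℝ} (hP : QPDiffeo ω P) {lam : ℝ} (hl : 0 < lam) :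
    QPDiffeo ω (fun p => dilation lam⁻¹ (P (dilation lam p))) := by
  obtain ⟨hP, Q, hQ, h1, h2⟩ := hP
  refine ⟨hP.conj_dilation hl, _, hQ.conj_dilation hl, ?_, ?_⟩
  · filter_upwards [(tendsto_dilation lam).eventually h1] with p hp
    rw [dilation_dilation_inv hl.ne', hp, dilation_inv_dilation hl.ne']
  · filter_upwards [(tendsto_dilation lam).eventually h2] with p hp
    rw [dilation_dilation_inv hl.ne', hp, dilation_inv_dilation hl.ne']

theorem OrdU.scale {s : ℕ} {h : ℝ → ℝ → ℝ} (hh : OrdU s h) (lam : ℝ) :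
    OrdU s fun ξ η => h ξ (lam * η) := by
  refine (IsBigO.comp_tendsto hh (tendsto_dilation lam)).trans ?_
  refine IsBigO.of_bound (‖lam ^ s‖) (Eventually.of_forall fun p => ?_)
  simp [dilation, mul_pow]


/-- If the formal normal form of `M` is the rotation then `M` is conjugate to the rotation. -/
theorem exists_conjugacy {C₀ : ℝ} {τ : ℕ} (hsd : SmallDivisors ω γ C₀ τ) {f g : ℝ → ℝ → ℝ}
    (hf : IsQPAnalytic ω f) (hg : IsQPAnalytic ω g) (hf2 : OrdU 2 f) (hg2 : OrdU 2 g)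
    (happ : ∀ N : ℕ, ∃ P, QPDiffeo ω P ∧
      (fun p => mapM γ f g (P p) - P (rotation γ p)) =O[nearAxis] fun p : ℝ × ℝ => p.2 ^ N) :
    ∃ U, QPMap ω U ∧ OrdU 2 (fun ξ η => (U (ξ, η)).2 - η) ∧
      ∀ᶠ p in nearAxis, mapM γ f g (U p) = U (rotation γ p) := by
  obtain ⟨t, ht, ρ, hρ, K, hK, hf', hg'⟩ := hf.exists_common hg
  obtain ⟨ε, hε, hmain⟩ := exists_conjugacy_of_small hsd ht
  -- Functions of order two gain `lam²` under the dilation, so the factor `lam⁻¹` in the second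
  -- component is affordable: the norm `4 * lam² * K / ρ²` is at most `lam * ε`.
  set lam := min 1 (min (ρ / 2) (ε * ρ ^ 2 / (4 * K))) with hlam
  have hl : 0 < lam := by positivity
  have hl1 : lam ≤ 1 := min_le_left _ _
  have hlρ : lam ≤ ρ / 2 := (min_le_right _ _).trans (min_le_left _ _)
  have hlε : lam * (4 * K) ≤ ε * ρ ^ 2 := by
    rw [← le_div_iff₀ (by positivity)]
    exact (min_le_right _ _).trans (min_le_right _ _)
  have hsc : ∀ {h : ℝ → ℝ → ℝ}, RRep ω 0 t ρ K h → OrdU 2 h →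
      RRep ω 2 t 2 (lam * ε) fun ξ η => h ξ (lam * η) := fun {h} hh hO => by
    have h1 := (hh.upgrade hsd.ne_one ht.le hρ fun ξ => hO.isBigO ξ).scale ht.le hρ.le hl
    refine (h1.shrink ht.le zero_le_two (by positivity) (q := 2 * lam / ρ) ?_ (by positivity)
      ?_).mono_const ?_
    · rw [div_le_one hρ]; linarith
    · rw [div_mul_div_comm, mul_comm ρ lam, mul_div_mul_right _ _ hρ.ne', mul_div_cancel_right₀ _ hl.ne']
    · rw [div_pow, div_mul_eq_mul_div, div_le_iff₀ (by positivity)]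
      nlinarith
  set f' : ℝ → ℝ → ℝ := fun ξ η => f ξ (lam * η) with hf'd
  set g' : ℝ → ℝ → ℝ := fun ξ η => lam⁻¹ * g ξ (lam * η) with hg'd
  have hM : ∀ p, mapM γ f' g' p = dilation lam⁻¹ (mapM γ f g (dilation lam p)) := fun p => by
    simp only [mapM, f', g', dilation, mul_add, inv_mul_cancel_left₀ hl.ne']
  obtain ⟨u, v, hu, hv, hu2, hv2, huv⟩ := hmain f' g'
    ((hsc hf' hf2).mono_const (mul_le_of_le_one_left hε.le hl1))
    (((hsc hg' hg2).const_mul ht.le zero_le_two lam⁻¹).mono_const (by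
      rw [abs_of_pos (by positivity), inv_mul_cancel_left₀ hl.ne']))
    (fun N => by
      obtain ⟨P, hP, hPM⟩ := happ N
      refine ⟨_, hP.conj_dilation hl, ?_⟩
      obtain ⟨h1, h2⟩ := ordU_prod hPM
      refine (IsBigO.prod_left (h1.scale lam)
        (IsBigO.const_mul_left (h2.scale lam) lam⁻¹)).congr_left fun p => ?_
      rw [hM, dilation_dilation_inv hl.ne']
      simp [dilation, rotation]
      ring)
  have hV : QPMap ω (nearIdentity u v) := by
    rw [qpMap_nearIdentity]
    exact ⟨hu, hv, fun ξ => ⟨hu2.apply_zero ξ, hv2.apply_zero ξ⟩⟩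
  have hl' : 0 < lam⁻¹ := by positivity
  have hU := hV.conj_dilation hl'
  rw [inv_inv] at hU
  refine ⟨_, hU, ?_, ?_⟩
  · refine (IsBigO.const_mul_left (hv2.scale lam⁻¹) lam).congr_left fun p => ?_
    simp [dilation, nearIdentity, mul_add, hl.ne']
  · filter_upwards [(tendsto_dilation lam⁻¹).eventually huv] with p hp
    have := congrArg (dilation lam) hp
    rw [hM, dilation_dilation_inv hl.ne'] at this
    exact this

end QPReversible

end

/-! ### Inversion of quasi-periodic functions of one variable. -/

noncomputable section

namespace QPReversible

open Filter Topology Asymptotics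

variable {m : ℕ} {ω : Fin m → ℝ} {γ : ℝ}

/-! ### Quasi-periodic functions of one variable -/

theorem summable_exp_neg_abs {s : ℝ} (hs : 0 < s) :
    Summable fun n : ℤ => Real.exp (-s * |(n : ℝ)|) := by
  have h : Summable fun n : ℕ => Real.exp (-s * |((n : ℤ) : ℝ)|) := by
    have h1 := summable_geometric_of_lt_one (Real.exp_pos (-s)).le (Real.exp_lt_one_iff.2 (by linarith))
    refine h1.congr fun n => ?_
    rw [← Real.exp_nat_mul, Int.cast_natCast, Nat.abs_cast, mul_comm]
  exact Summable.of_nat_of_neg h (by simpa using h)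

theorem summable_exp_neg_order (m : ℕ) {s : ℝ} (hs : 0 < s) :
    Summable fun j : Fin m → ℤ => Real.exp (-s * order j) := by
  induction m with
  | zero => exact Summable.of_finite
  | succ m ih =>
    have h1 := (summable_exp_neg_abs hs).mul_of_nonneg ih (fun _ => (Real.exp_pos _).le)
      (fun _ => (Real.exp_pos _).le)
    rw [← (Fin.consEquiv fun _ : Fin (m + 1) => ℤ).summable_iff]
    refine h1.congr fun x => ?_
    simp [Fin.consEquiv, order, Fin.sum_univ_succ, mul_add, Real.exp_add]

theorem rep_of_coeffs {t ρ : ℝ} (ht : 0 ≤ t) (hρ : 0 ≤ ρ) {c : (Fin m → ℤ) → ℂ}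
    (hc : Summable fun j => ‖c j‖ * Real.exp (t * order j)) {h : ℝ → ℂ}
    (hs : ∀ ξ, HasSum (fun j => c j * mode ω j ξ) (h ξ)) :
    Rep ω 0 t ρ (∑' j, ‖c j‖ * Real.exp (t * order j)) fun ξ _ => h ξ := by
  refine Rep.hasSum ht hρ hc (H := fun j ξ η => c j * (mode ω j ξ * (η : ℂ) ^ 0))
    (fun j => ?_) fun ξ η _ => by simpa using hs ξ
  exact (Rep.monomial (c j) 0 j (by simp)).mono_const (by simp [weight])

/-- The two notions of analytic quasi-periodic function agree on functions of `ξ`. -/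
theorem isQPAnalyticFun_iff {a : ℝ → ℝ} :
    IsQPAnalyticFun ω a ↔ IsQPAnalytic ω fun ξ _ => a ξ := by
  constructor
  · rintro ⟨t, ht, c, hc, hs⟩
    exact RRep.isQPAnalytic (rep_of_coeffs ht.le zero_le_one hc hs) ht one_pos
  · rintro ⟨t, ht, ρ, hρ, c, hc, hs⟩
    have hinj : Function.Injective fun j : Fin m → ℤ => ((0 : ℕ), j) := fun _ _ h =>
      (Prod.ext_iff.1 h).2
    refine ⟨t, ht, c 0, ?_, fun θ => ?_⟩
    · simpa [Function.comp_def] using hc.comp_injective hinj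
    · have h1 := hs θ 0 (by simpa using hρ)
      rw [← hinj.hasSum_iff] at h1
      · simpa [Function.comp_def] using h1
      · rintro ⟨k, j⟩ hkj
        have hk : k ≠ 0 := fun h => hkj ⟨j, by simp [h]⟩
        simp [hk]

/-! ### Inverses of quasi-periodic functions -/

/-- Convolution powers. -/
def convPow {ι : Type*} [AddZeroClass ι] (c : ι → ℂ) : ℕ → ι → ℂ
  | 0 => open Classical in Pi.single 0 1
  | n + 1 => conv (convPow c n) c

theorem hasSum_convPow {ι : Type*} [AddZeroClass ι] {c χ : ι → ℂ} (hχ0 : χ 0 = 1)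
    (hχ : ∀ p q, χ (p + q) = χ p * χ q) {A : ℂ} (hc : HasSum (fun p => c p * χ p) A) (n : ℕ) :
    HasSum (fun q => convPow c n q * χ q) (A ^ n) := by
  induction n with
  | zero =>
    classical
    have := hasSum_single (f := fun q => convPow c 0 q * χ q) 0 fun q hq => by
      simp [convPow, Pi.single_eq_of_ne hq]
    simpa [convPow, hχ0] using this
  | succ n ih =>
    rw [pow_succ]
    exact hasSum_conv hχ ih hc

theorem exists_twist (j : Fin m → ℤ) (t : ℝ) (ht : 0 ≤ t) :
    ∃ y : Fin m → ℝ, (∀ k : Fin m → ℤ, |pairing k y| ≤ t * order k) ∧ pairing j y = t * order j := by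
  refine ⟨fun i => t * SignType.sign (j i : ℝ), fun k => ?_, ?_⟩
  · rw [pairing, order, Finset.mul_sum]
    refine (Finset.abs_sum_le_sum_abs _ _).trans (Finset.sum_le_sum fun i _ => ?_)
    rw [abs_mul, abs_mul, abs_of_nonneg ht]
    have : |((SignType.sign (j i : ℝ) : SignType) : ℝ)| ≤ 1 := by
      rcases lt_trichotomy (j i : ℝ) 0 with h | h | h <;> simp [h]
    nlinarith [mul_nonneg ht (abs_nonneg (k i : ℝ)), abs_nonneg (k i : ℝ)]
  · rw [pairing, order, Finset.mul_sum]
    refine Finset.sum_congr rfl fun i _ => ?_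
    rw [mul_left_comm, mul_comm (j i : ℝ), sign_mul_self]

theorem abs_exp_sub_one_le_of_abs_le {x y : ℝ} (h : |x| ≤ y) :
    |Real.exp x - 1| ≤ Real.exp y - 1 := by
  have h1 := abs_le.1 h
  have h2 : Real.exp x ≤ Real.exp y := Real.exp_le_exp.2 h1.2
  have h3 : Real.exp (-y) ≤ Real.exp x := Real.exp_le_exp.2 h1.1
  have h4 : 1 - Real.exp (-y) ≤ Real.exp y - 1 := by
    have a1 := Real.add_one_le_exp (-y)
    have a2 := Real.add_one_le_exp y
    linarith
  rw [abs_le]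
  constructor <;> linarith

/-- A supremum below one on the real line does not bound the weighted `ℓ¹` norm of powers, so
coefficients are estimated by suprema on a complex strip. The factor `exp ⟨k, y⟩` displaces the
function by an imaginary vector of the torus, aligned with the signs of `j`; by convexity of `exp`
this changes `w` by at most `lam * ∑ ‖c k‖ exp (t |k|)`. The coefficient of index `j` of the
displaced power is bounded by its supremum. -/
theorem norm_convPow_le (hγ : ∀ k : Fin m → ℤ, k ≠ 0 → mode ω k γ ≠ 1) {t q lam : ℝ}
    (ht : 0 ≤ t) (hl : 0 ≤ lam) (hl1 : lam ≤ 1) {c : (Fin m → ℤ) → ℂ}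
    (hc : Summable fun j => ‖c j‖ * Real.exp (t * order j)) {w : ℝ → ℂ}
    (hw : ∀ ξ, HasSum (fun j => c j * mode ω j ξ) (w ξ)) (hq : ∀ ξ, ‖w ξ‖ ≤ q) (n : ℕ)
    (j : Fin m → ℤ) :
    ‖convPow c n j‖ ≤
      (q + lam * ∑' k, ‖c k‖ * Real.exp (t * order k)) ^ n * Real.exp (-(lam * t) * order j) := by
  obtain ⟨y, hy, hyj⟩ := exists_twist j (lam * t) (by positivity)
  have hexp : ∀ k, |Real.exp (pairing k y) - 1| ≤ lam * Real.exp (t * order k) := fun k => by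
    refine (abs_exp_sub_one_le_of_abs_le (hy k)).trans ?_
    have := convexOn_exp.2 (Set.mem_univ 0) (Set.mem_univ (t * order k)) (sub_nonneg.2 hl1) hl
      (sub_add_cancel 1 lam)
    simp only [smul_eq_mul, mul_zero, zero_add, Real.exp_zero, mul_one] at this
    rw [mul_assoc]
    linarith
  have hsum : Summable fun k => c k * ((Real.exp (pairing k y) - 1 : ℝ) : ℂ) := by
    refine Summable.of_norm_bounded (hc.mul_left lam) fun k => ?_
    rw [norm_mul, Complex.norm_real, Real.norm_eq_abs, mul_left_comm]
    exact mul_le_mul_of_nonneg_left (hexp k) (norm_nonneg _)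
  set χ : ℝ → (Fin m → ℤ) → ℂ := fun ξ k => (Real.exp (pairing k y) : ℂ) * mode ω k ξ with hχ
  set D : ℝ → ℂ := fun ξ => ∑' k, c k * ((Real.exp (pairing k y) - 1 : ℝ) : ℂ) * mode ω k ξ with hD
  have hDs : ∀ ξ, HasSum (fun k => c k * ((Real.exp (pairing k y) - 1 : ℝ) : ℂ) * mode ω k ξ)
      (D ξ) := fun ξ => by
    refine (Summable.of_norm_bounded hsum.norm fun k => ?_).hasSum
    rw [norm_mul, norm_mode, mul_one]
  have hDb : ∀ ξ, ‖D ξ‖ ≤ lam * ∑' k, ‖c k‖ * Real.exp (t * order k) := fun ξ => by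
    rw [← (hDs ξ).tsum_eq]
    refine tsum_of_norm_bounded (hc.hasSum.mul_left lam) fun k => ?_
    rw [norm_mul, norm_mul, norm_mode, mul_one, Complex.norm_real, Real.norm_eq_abs, mul_left_comm]
    exact mul_le_mul_of_nonneg_left (hexp k) (norm_nonneg _)
  have hW : ∀ ξ, HasSum (fun k => c k * χ ξ k) (w ξ + D ξ) := fun ξ => by
    refine ((hw ξ).add (hDs ξ)).congr_fun fun k => ?_
    simp only [hχ]
    push_cast
    ring
  have hp : ∀ ξ, HasSum (fun k => convPow c n k * χ ξ k) ((w ξ + D ξ) ^ n) := fun ξ =>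
    hasSum_convPow (by simp [hχ, pairing_zero, mode_zero])
      (fun p q => by simp only [hχ, pairing_add, mode_add, Real.exp_add]; push_cast; ring) (hW ξ) n
  have hp' : ∀ ξ, HasSum (fun k => convPow c n k * (Real.exp (pairing k y) : ℂ) * mode ω k ξ)
      ((w ξ + D ξ) ^ n) := fun ξ => (hp ξ).congr_fun fun k => by simp only [hχ]; ring
  have hb : Summable fun k => ‖convPow c n k * (Real.exp (pairing k y) : ℂ)‖ :=
    (hp' 0).summable.norm.congr fun k => by rw [norm_mul _ (mode ω k 0), norm_mode, mul_one]
  have hH : ∀ ξ, ‖(w ξ + D ξ) ^ n‖ ≤ (q + lam * ∑' k, ‖c k‖ * Real.exp (t * order k)) ^ n :=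
    fun ξ => by
      rw [norm_pow]
      exact pow_le_pow_left₀ (norm_nonneg _)
        ((norm_add_le _ _).trans (add_le_add (hq ξ) (hDb ξ))) n
  have hle : ‖convPow c n j * (Real.exp (pairing j y) : ℂ)‖ ≤
      (q + lam * ∑' k, ‖c k‖ * Real.exp (t * order k)) ^ n := by
    refine le_of_forall_pos_le_add fun ε hε => ?_
    obtain ⟨N, hN⟩ := norm_coeff_le_mean hγ hb hp' j hε
    rw [add_comm]
    exact hN 0 _ fun k _ => hH _
  rw [norm_mul, Complex.norm_real, Real.norm_eq_abs, Real.abs_exp, hyj,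
    ← le_div_iff₀ (Real.exp_pos _), div_eq_mul_inv, ← Real.exp_neg] at hle
  rwa [neg_mul]

/-- The inverse of an analytic quasi-periodic function that is bounded away from zero is analytic
quasi-periodic. -/
theorem exists_inverse (hγ : ∀ k : Fin m → ℤ, k ≠ 0 → mode ω k γ ≠ 1) {a : ℝ → ℝ}
    (ha : IsQPAnalytic ω fun ξ _ => a ξ) {δ : ℝ} (hδ : 0 < δ) (had : ∀ ξ, δ ≤ |a ξ|) :
    ∃ b : ℝ → ℝ, (IsQPAnalytic ω fun ξ _ => b ξ) ∧ ∀ ξ, a ξ * b ξ = 1 := by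
  obtain ⟨t₀, ht₀, ρ, hρ, K, hK⟩ := isQPAnalytic_iff.1 ha
  have haK : ∀ ξ, |a ξ| ≤ K := fun ξ => hK.abs_le ht₀.le ξ (r := 0) (by simpa using hρ)
  have hK0 : 0 < K := hδ.trans_le ((had 0).trans (haK 0))
  -- The inverse is `K⁻² a (1 - w)⁻¹`, expanded in powers of `w`; squaring `a` gives `0 ≤ w ≤ q < 1`
  -- whatever the sign of `a`.
  set w : ℝ → ℝ := fun ξ => 1 - (K ^ 2)⁻¹ * a ξ ^ 2 with hw
  have hwa : IsQPAnalyticFun ω w := isQPAnalyticFun_iff.2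
    ((IsQPAnalytic.const 1).sub ((IsQPAnalytic.const (K ^ 2)⁻¹).mul (ha.pow 2)))
  obtain ⟨t, ht, c, hc, hcs⟩ := hwa
  set q := 1 - (K ^ 2)⁻¹ * δ ^ 2 with hq
  have hq1 : q < 1 := by
    have : 0 < (K ^ 2)⁻¹ * δ ^ 2 := by positivity
    linarith
  have hwq : ∀ ξ, ‖(w ξ : ℂ)‖ ≤ q := fun ξ => by
    have h1 : δ ^ 2 ≤ a ξ ^ 2 := by
      rw [← sq_abs (a ξ)]; exact pow_le_pow_left₀ hδ.le (had ξ) 2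
    have h2 : a ξ ^ 2 ≤ K ^ 2 := by
      rw [← sq_abs (a ξ)]; exact pow_le_pow_left₀ (abs_nonneg _) (haK ξ) 2
    have h3 : (K ^ 2)⁻¹ * δ ^ 2 ≤ (K ^ 2)⁻¹ * a ξ ^ 2 :=
      mul_le_mul_of_nonneg_left h1 (by positivity)
    have h4 : (K ^ 2)⁻¹ * a ξ ^ 2 ≤ 1 := by
      rw [inv_mul_le_iff₀ (by positivity), mul_one]; exact h2
    rw [Complex.norm_real, Real.norm_eq_abs, abs_of_nonneg (by simp only [hw]; linarith)]
    simp only [hw]; linarith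
  have hq0 : 0 ≤ q := (norm_nonneg _).trans (hwq 0)
  set N := ∑' k, ‖c k‖ * Real.exp (t * order k) with hN
  have hN0 : 0 ≤ N := tsum_nonneg fun k => by positivity
  -- The strip is narrowed until the bound `q + lam * N` on it is below one. Half of the resulting
  -- decay in `j` gives summability, the other half the remaining strip.
  set lam := min 1 ((1 - q) / (2 * (N + 1))) with hlam
  have h1q : 0 < 1 - q := by linarith
  have hl0 : 0 < lam := by positivity
  have hq' : q + lam * N < 1 := by
    have h1 : lam ≤ (1 - q) / (2 * (N + 1)) := min_le_right _ _
    rw [le_div_iff₀ (by positivity)] at h1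
    nlinarith
  have hcp := norm_convPow_le hγ ht.le hl0.le (min_le_left _ _) hc hcs hwq
  have hs : 0 < lam * t / 2 := by positivity
  have hle : ∀ n j, ‖convPow c n j‖ * Real.exp (lam * t / 2 * order j) ≤
      (q + lam * N) ^ n * Real.exp (-(lam * t / 2) * order j) := fun n j => by
    refine (mul_le_mul_of_nonneg_right (hcp n j) (Real.exp_pos _).le).trans (le_of_eq ?_)
    rw [mul_assoc, ← Real.exp_add]
    congr 2; ring
  have hS := summable_exp_neg_order m hs
  have hpow : ∀ n, RRep ω 0 (lam * t / 2) 1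
      ((q + lam * N) ^ n * ∑' j : Fin m → ℤ, Real.exp (-(lam * t / 2) * order j))
      (fun ξ _ => w ξ ^ n) := fun n => by
    have h1 : Summable fun j => ‖convPow c n j‖ * Real.exp (lam * t / 2 * order j) :=
      Summable.of_nonneg_of_le (fun j => by positivity) (hle n) (hS.mul_left _)
    have h2 : ∀ ξ, HasSum (fun j => convPow c n j * mode ω j ξ) ((w ξ : ℂ) ^ n) := fun ξ =>
      hasSum_convPow (mode_zero ξ) (fun p q => mode_add p q ξ) (hcs ξ) n
    refine ((rep_of_coeffs hs.le zero_le_one h1 h2).mono_const ?_).congr fun ξ η _ => by push_cast; rfl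
    rw [← tsum_mul_left]
    exact h1.tsum_le_tsum (hle n) (hS.mul_left _)
  have hgeo := (summable_geometric_of_lt_one (by positivity) hq').mul_right
    (∑' j : Fin m → ℤ, Real.exp (-(lam * t / 2) * order j))
  have hinv : IsQPAnalytic ω fun ξ _ => (1 - w ξ)⁻¹ := by
    refine (RRep.hasSum hs.le zero_le_one hgeo hpow fun ξ η _ => ?_).isQPAnalytic hs one_pos
    refine hasSum_geometric_of_abs_lt_one (r := w ξ) ?_
    have := hwq ξ
    rw [Complex.norm_real, Real.norm_eq_abs] at this
    linarith
  refine ⟨fun ξ => (a ξ)⁻¹, ?_, fun ξ => mul_inv_cancel₀ fun h => ?_⟩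
  · refine (((IsQPAnalytic.const (K ^ 2)⁻¹).mul ha).mul hinv).congr (Eventually.of_forall fun p => ?_)
    have h0 : a p.1 ≠ 0 := fun h => by
      have := had p.1; rw [h, abs_zero] at this; linarith
    simp only [hw, sub_sub_cancel]
    field_simp
  · have := had ξ; rw [h, abs_zero] at this; linarith

/-- A quasi-periodic function whose zeros propagate along the orbits of the rotation is bounded
away from zero. -/
theorem exists_lower_bound (hγ : ∀ k : Fin m → ℤ, k ≠ 0 → mode ω k γ ≠ 1) {a : ℝ → ℝ}
    (ha : IsQPAnalyticFun ω a) {L : ℝ} (hL : 1 ≤ L) (haL : ∀ ξ, |a (ξ + γ)| ≤ L * |a ξ|) {ξ₀ : ℝ}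
    (h0 : a ξ₀ ≠ 0) : ∃ δ > 0, ∀ ξ, δ ≤ |a ξ| := by
  by_contra! hcon
  obtain ⟨t, ht, c, hc, hs⟩ := ha
  have hc' : Summable fun j => ‖c j‖ := by
    refine Summable.of_nonneg_of_le (fun j => norm_nonneg _) (fun j => ?_) hc
    exact le_mul_of_one_le_right (norm_nonneg _)
      (Real.one_le_exp (mul_nonneg ht.le (order_nonneg j)))
  have hit : ∀ (n : ℕ) ξ, |a (ξ + n * γ)| ≤ L ^ n * |a ξ| := fun n ξ => by
    induction n with
    | zero => simp
    | succ n ih =>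
      have := haL (ξ + n * γ)
      rw [show ξ + ((n + 1 : ℕ) : ℝ) * γ = ξ + n * γ + γ by push_cast; ring, pow_succ']
      nlinarith
  have hz : ∀ j, c j = 0 := fun j => by
    refine norm_le_zero_iff.1 (le_of_forall_pos_le_add fun ε hε => ?_)
    -- `N` is fixed before `ξ`. A point where `|a|` is below `ε / 2 / L ^ N` then keeps `|a|` below
    -- `ε / 2` at the first `N` points of its orbit, and every coefficient is below `ε`.
    obtain ⟨N, hN⟩ := norm_coeff_le_mean hγ hc' hs j (half_pos hε)
    have hLN : 0 < L ^ N := by positivity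
    obtain ⟨ξ, hξ⟩ := hcon (ε / 2 / L ^ N) (by positivity)
    rw [lt_div_iff₀ hLN] at hξ
    have := hN ξ (ε / 2) fun n hn => by
      rw [Complex.norm_real, Real.norm_eq_abs]
      have h1 := hit n ξ
      have h2 := mul_le_mul_of_nonneg_right (pow_le_pow_right₀ hL hn.le) (abs_nonneg (a ξ))
      linarith
    linarith
  have h1 := hs ξ₀
  simp only [hz, zero_mul] at h1
  have := h1.unique hasSum_zero
  exact h0 (by exact_mod_cast this)

end QPReversible

end

/-! ### From formal power series to asymptotic expansions. -/

noncomputable section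

namespace QPReversible

open Filter Topology Asymptotics

variable {m : ℕ} {ω : Fin m → ℝ} {γ : ℝ}

/-! ### Taylor coefficients -/

theorem iteratedDeriv_of_hasSum {a : ℕ → ℝ} {h : ℝ → ℝ} {x₀ : ℝ}
    (hs : ∀ᶠ y in 𝓝 (0 : ℝ), HasSum (fun k => a k * y ^ k) (h (x₀ + y))) (k : ℕ) :
    iteratedDeriv k h x₀ = k.factorial * a k := by
  have hp : HasFPowerSeriesAt h (FormalMultilinearSeries.ofScalars ℝ a) x₀ := by
    rw [hasFPowerSeriesAt_iff]
    filter_upwards [hs] with y hy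
    simpa [FormalMultilinearSeries.coeff_ofScalars, mul_comm] using hy
  obtain ⟨r, hr⟩ := hp
  rw [iteratedDeriv_eq_iteratedFDeriv, ← hr.factorial_smul 1 k, nsmul_eq_mul]
  congr 1
  exact FormalMultilinearSeries.coeff_ofScalars

/-- This identifies the iterated derivatives of the formal hypothesis with the coefficients of a
convergent double series. The inner derivative is found for all small `x`, as a power series in `x`,
before the outer one is taken. -/
theorem IsQPAnalytic.hasSum_taylorCoeff {f : ℝ → ℝ → ℝ} (hf : IsQPAnalytic ω f) (ξ : ℝ) :
    ∃ (Z : ℝ) (κ : ℕ × ℕ → ℝ), 0 < Z ∧ (∀ q, |taylorCoeff f ξ q.1 q.2| ≤ κ q) ∧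
      (Summable fun q => κ q * Z ^ (q.1 + q.2)) ∧ ∀ x y : ℝ, |x| ≤ Z → |y| ≤ Z →
        HasSum (fun q : ℕ × ℕ => taylorCoeff f ξ q.1 q.2 * x ^ q.1 * y ^ q.2) (f (ξ + x) y) := by
  have hΩ := freqBound_pos (ω := ω)
  obtain ⟨t, ht, ρ, hρ, K, hK⟩ := isQPAnalytic_iff.1 hf
  set Z := min (t / freqBound ω) (ρ / 2) with hZ
  have hZ0 : 0 < Z := by positivity
  have hZt : freqBound ω * Z ≤ t := by
    rw [mul_comm, ← le_div_iff₀ hΩ]; exact min_le_left _ _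
  obtain ⟨T, κ, hT, hκ, -, hsum⟩ := Rep.exists_taylor hK (t' := 0) (ρ' := ρ / 2) (X := Z) (Y := Z)
    le_rfl (by positivity) hZ0 hZ0 (by linarith) (by linarith [min_le_right (t / freqBound ω) (ρ / 2)])
  set A : ℕ × ℕ → ℝ := fun q => (T q ξ 0).re with hA
  have hAκ : ∀ q, |A q| ≤ κ q := fun q =>
    (Complex.abs_re_le_norm _).trans ((hT q).norm_le le_rfl ξ (by simpa using hρ))
  have hs : ∀ x y : ℝ, |x| ≤ Z → |y| ≤ Z →
      HasSum (fun q : ℕ × ℕ => A q * x ^ q.1 * y ^ q.2) (f (ξ + x) y) := fun x y hx hy => by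
    have h1 := Complex.hasSum_re (hsum ξ 0 x y (by simpa using hρ) hx hy)
    rw [zero_add, Complex.ofReal_re] at h1
    refine h1.congr_fun fun q => ?_
    rw [mul_assoc (T q ξ 0), ← Complex.ofReal_pow, ← Complex.ofReal_pow, ← Complex.ofReal_mul,
      Complex.re_mul_ofReal, ← mul_assoc]
  have hrow : ∀ k (x : ℝ), |x| ≤ Z → Summable fun n => A (n, k) * x ^ n := fun k x hx => by
    have hinj : Function.Injective fun n : ℕ => (n, k) := fun _ _ h => (Prod.ext_iff.1 h).1
    refine Summable.of_norm_bounded ((hκ.comp_injective hinj).mul_right (Z ^ k)⁻¹) fun n => ?_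
    simp only [Function.comp_apply]
    rw [mul_inv_cancel_right₀ (by positivity), norm_mul, norm_pow]
    exact mul_le_mul (hAκ _) (pow_le_pow_left₀ (norm_nonneg _) hx n) (by positivity)
      ((abs_nonneg _).trans (hAκ _))
  have hball : ∀ᶠ y in 𝓝 (0 : ℝ), |y| ≤ Z := by
    filter_upwards [Metric.ball_mem_nhds (0 : ℝ) hZ0] with y hy
    exact le_of_lt (by simpa using hy)
  have h1 : ∀ k (x : ℝ), |x| ≤ Z →
      iteratedDeriv k (fun r => f (ξ + x) r) 0 = k.factorial * ∑' n, A (n, k) * x ^ n := by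
    intro k x hx
    refine iteratedDeriv_of_hasSum (a := fun k => ∑' n, A (n, k) * x ^ n) ?_ k
    filter_upwards [hball] with y hy
    rw [zero_add]
    have h2 := (Equiv.prodComm ℕ ℕ).hasSum_iff
      (f := fun q : ℕ × ℕ => A q * x ^ q.1 * y ^ q.2) |>.2 (hs x y hx hy)
    refine HasSum.prod_fiberwise h2 fun k => ?_
    exact (hrow k x hx).hasSum.mul_right (y ^ k)
  have h2 : ∀ n k, taylorCoeff f ξ n k = A (n, k) := fun n k => by
    unfold taylorCoeff
    rw [iteratedDeriv_of_hasSum (a := fun n => k.factorial * A (n, k)) ?_ n]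
    · field_simp
    · filter_upwards [hball] with x hx
      rw [h1 k x hx]
      simpa [mul_assoc] using (hrow k x hx).hasSum.mul_left (k.factorial : ℝ)
  refine ⟨Z, κ, hZ0, fun q => by rw [h2]; exact hAκ q, ?_, fun x y hx hy => ?_⟩
  · simpa only [pow_add, mul_assoc] using hκ
  · simpa only [h2] using hs x y hx hy

theorem IsQPAnalytic.taylor_isBigO {f : ℝ → ℝ → ℝ} (hf : IsQPAnalytic ω f) (ξ : ℝ) {x y : ℝ → ℝ}
    (hx : x =O[𝓝 0] fun η : ℝ => η) (hy : y =O[𝓝 0] fun η : ℝ => η) (N : ℕ) :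
    (fun η => f (ξ + x η) (y η) - ∑ n ∈ Finset.range (N + 1), ∑ k ∈ Finset.range (N + 1),
      taylorCoeff f ξ n k * x η ^ n * y η ^ k) =O[𝓝 0] fun η : ℝ => η ^ (N + 1) := by
  obtain ⟨Z, κ, hZ, hκ, hκs, hs⟩ := hf.hasSum_taylorCoeff ξ
  have hκ0 : ∀ q, 0 ≤ κ q := fun q => (abs_nonneg _).trans (hκ q)
  set r : ℝ → ℝ := fun η => max |x η| |y η| with hr
  have hrO : r =O[𝓝 0] fun η : ℝ => η := by
    have := (hx.norm_left.add hy.norm_left)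
    refine (IsBigO.of_bound 1 (Eventually.of_forall fun η => ?_)).trans this
    rw [one_mul, Real.norm_of_nonneg (by positivity), Real.norm_of_nonneg (by positivity)]
    exact max_le (le_add_of_nonneg_right (norm_nonneg _)) (le_add_of_nonneg_left (norm_nonneg _))
  have hr0 : Tendsto r (𝓝 0) (𝓝 0) := hrO.trans_tendsto tendsto_id
  refine (IsBigO.of_bound ((∑' q, κ q * Z ^ (q.1 + q.2)) / Z ^ (N + 1)) ?_).trans (hrO.pow (N + 1))
  filter_upwards [hr0.eventually (Iic_mem_nhds hZ)] with η hη
  have hη' : r η ≤ Z := hη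
  have hxr : |x η| ≤ r η := le_max_left _ _
  have hyr : |y η| ≤ r η := le_max_right _ _
  have hrη : 0 ≤ r η := (abs_nonneg _).trans hxr
  set S := Finset.range (N + 1) ×ˢ Finset.range (N + 1) with hS
  rw [← Finset.sum_product' (Finset.range (N + 1)) (Finset.range (N + 1))
    fun n k => taylorCoeff f ξ n k * x η ^ n * y η ^ k]
  have h1 := HasSum.sub_finset (Complex.hasSum_ofReal.2 (hs (x η) (y η) (hxr.trans hη')
    (hyr.trans hη'))) S
  rw [← Complex.norm_real]
  push_cast at h1 ⊢
  rw [← h1.tsum_eq, norm_pow, Real.norm_of_nonneg hrη, div_mul_eq_mul_div, mul_div_assoc,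
    ← tsum_mul_right]
  refine tsum_of_norm_bounded (hκs.mul_right _).hasSum fun q => ?_
  split_ifs with hq
  · rw [norm_zero]
    have := hκ0 q
    positivity
  · have hq' : N + 1 ≤ q.1 + q.2 := by
      by_contra hlt
      exact hq (by simp only [hS, Finset.mem_product, Finset.mem_range]; omega)
    have e : ‖(taylorCoeff f ξ q.1 q.2 : ℂ) * (x η : ℂ) ^ q.1 * (y η : ℂ) ^ q.2‖ =
        |taylorCoeff f ξ q.1 q.2| * |x η| ^ q.1 * |y η| ^ q.2 := by
      rw [norm_mul, norm_mul, norm_pow, norm_pow, Complex.norm_real, Complex.norm_real,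
        Complex.norm_real, Real.norm_eq_abs, Real.norm_eq_abs, Real.norm_eq_abs]
    rw [e, mul_assoc, mul_assoc]
    have hκq := hκ0 q
    refine mul_le_mul (hκ q) ?_ (by positivity) hκq
    calc |x η| ^ q.1 * |y η| ^ q.2 ≤ r η ^ q.1 * r η ^ q.2 := by gcongr
      _ = r η ^ (N + 1) * r η ^ (q.1 + q.2 - (N + 1)) := by
          rw [← pow_add, ← pow_add]; congr 1; omega
      _ ≤ r η ^ (N + 1) * Z ^ (q.1 + q.2 - (N + 1)) := by gcongr
      _ = Z ^ (q.1 + q.2) * (r η ^ (N + 1) / Z ^ (N + 1)) := by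
          rw [show Z ^ (q.1 + q.2) = Z ^ (N + 1) * Z ^ (q.1 + q.2 - (N + 1)) by
            rw [← pow_add]; congr 1; omega]
          field_simp

/-! ### Asymptotic expansions -/

/-- The formal series `S` is the asymptotic expansion of `φ` at `0` up to order `N`. -/
def Expands (N : ℕ) (φ : ℝ → ℝ) (S : PowerSeries ℝ) : Prop :=
  ∃ P : Polynomial ℝ, (PowerSeries.X ^ N ∣ (P : PowerSeries ℝ) - S) ∧
    (fun η => φ η - P.eval η) =O[𝓝 0] fun η : ℝ => η ^ N

theorem polynomial_isBigO_one (P : Polynomial ℝ) :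
    (fun η => P.eval η) =O[𝓝 0] fun _ : ℝ => (1 : ℝ) :=
  (P.continuous.tendsto 0).isBigO_one ℝ

theorem isBigO_pow_one (N : ℕ) : (fun η : ℝ => η ^ N) =O[𝓝 0] fun _ : ℝ => (1 : ℝ) :=
  ((continuous_pow N).tendsto 0).isBigO_one ℝ

theorem Expands.polynomial (N : ℕ) (P : Polynomial ℝ) :
    Expands N (fun η => P.eval η) (P : PowerSeries ℝ) :=
  ⟨P, by simp, by simpa using isBigO_zero _ _⟩

section

variable {N : ℕ} {φ ψ : ℝ → ℝ} {S T : PowerSeries ℝ}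

theorem Expands.congr (h : Expands N φ S) (hφ : (fun η => ψ η - φ η) =O[𝓝 0] fun η : ℝ => η ^ N)
    (hS : PowerSeries.X ^ N ∣ S - T) : Expands N ψ T := by
  obtain ⟨P, h1, h2⟩ := h
  exact ⟨P, by simpa using dvd_add h1 hS, (hφ.add h2).congr_left fun η => by ring⟩

theorem Expands.add (h : Expands N φ S) (h' : Expands N ψ T) :
    Expands N (fun η => φ η + ψ η) (S + T) := by
  obtain ⟨P, h1, h2⟩ := h
  obtain ⟨Q, h3, h4⟩ := h'
  refine ⟨P + Q, ?_, (h2.add h4).congr_left fun η => by simp; ring⟩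
  rw [Polynomial.coe_add, add_sub_add_comm]
  exact dvd_add h1 h3

theorem Expands.mul (h : Expands N φ S) (h' : Expands N ψ T) :
    Expands N (fun η => φ η * ψ η) (S * T) := by
  obtain ⟨P, h1, h2⟩ := h
  obtain ⟨Q, h3, h4⟩ := h'
  refine ⟨P * Q, ?_, ?_⟩
  · rw [Polynomial.coe_mul, show (P : PowerSeries ℝ) * Q - S * T = (P - S) * Q + S * (Q - T) by ring]
    exact dvd_add (h1.mul_right _) (h3.mul_left _)
  · have hψ : ψ =O[𝓝 0] fun _ : ℝ => (1 : ℝ) :=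
      ((h4.trans (isBigO_pow_one N)).add (polynomial_isBigO_one Q)).congr_left fun η => by ring
    have e1 := h2.mul hψ
    have e2 := (polynomial_isBigO_one P).mul h4
    simp only [mul_one, one_mul] at e1 e2
    exact (e1.add e2).congr_left fun η => by rw [Polynomial.eval_mul]; ring

theorem Expands.const (N : ℕ) (a : ℝ) : Expands N (fun _ => a) (PowerSeries.C a) := by
  simpa using Expands.polynomial N (Polynomial.C a)

theorem Expands.pow (h : Expands N φ S) (n : ℕ) : Expands N (fun η => φ η ^ n) (S ^ n) := by
  induction n with
  | zero => simpa using Expands.const N 1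
  | succ n ih => simpa only [pow_succ] using ih.mul h

theorem Expands.sum {β : Type*} (B : Finset β) {φ : β → ℝ → ℝ} {S : β → PowerSeries ℝ}
    (h : ∀ b ∈ B, Expands N (φ b) (S b)) : Expands N (fun η => ∑ b ∈ B, φ b η) (∑ b ∈ B, S b) := by
  classical
  induction B using Finset.induction_on with
  | empty => simpa using Expands.const N 0
  | insert a B ha ih =>
    simp only [Finset.sum_insert ha]
    exact (h a (by simp)).add (ih fun b hb => h b (by simp [hb]))

theorem Expands.isBigO (h : Expands N φ S) (hS : PowerSeries.X ^ N ∣ S) :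
    φ =O[𝓝 0] fun η : ℝ => η ^ N := by
  obtain ⟨P, h1, h2⟩ := h
  have h3 : Polynomial.X ^ N ∣ P := by
    have := (dvd_sub_left hS).1 h1
    rw [PowerSeries.X_pow_dvd_iff] at this
    rw [Polynomial.X_pow_dvd_iff]
    simpa using this
  obtain ⟨Q, rfl⟩ := h3
  have h4 := (isBigO_refl (fun η : ℝ => η ^ N) (𝓝 0)).mul (polynomial_isBigO_one Q)
  simp only [mul_one] at h4
  exact (h2.add h4).congr_left fun η => by simp

end

end QPReversible

end

/-! ### Approximate conjugacies of every order. -/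

noncomputable section

namespace QPReversible

open Filter Topology Asymptotics

variable {m : ℕ} {ω : Fin m → ℝ} {γ : ℝ}

/-! ### Truncations of formal conjugacies -/

/-- The truncation `∑_{k ≤ N} uₖ(ξ) ηᵏ`. -/
def trunc (u : ℕ → ℝ → ℝ) (N : ℕ) (ξ η : ℝ) : ℝ := ∑ k ∈ Finset.range (N + 1), u k ξ * η ^ k

theorem expands_trunc (u : ℕ → ℝ → ℝ) (N : ℕ) (ξ : ℝ) :
    Expands (N + 1) (fun η => trunc u N ξ η) (seriesAt u ξ) := by
  set P : Polynomial ℝ := ∑ k ∈ Finset.range (N + 1), Polynomial.C (u k ξ) * Polynomial.X ^ k with hP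
  refine (Expands.polynomial (N + 1) P).congr ?_ ?_
  · refine (isBigO_zero _ _).congr_left fun η => ?_
    simp [hP, trunc, Polynomial.eval_finsetSum]
  · rw [PowerSeries.X_pow_dvd_iff]
    intro i hi
    rw [map_sub, Polynomial.coeff_coe, hP, Polynomial.finsetSum_coeff, seriesAt,
      PowerSeries.coeff_mk]
    simp only [Polynomial.coeff_C_mul_X_pow]
    rw [Finset.sum_ite_eq, if_pos (Finset.mem_range.2 hi), sub_self]

theorem trunc_isBigO {u : ℕ → ℝ → ℝ} (N : ℕ) {ξ : ℝ} (h0 : u 0 ξ = 0) :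
    (fun η => trunc u N ξ η) =O[𝓝 0] fun η : ℝ => η := by
  unfold trunc
  refine IsBigO.fun_sum fun k _ => ?_
  rcases Nat.eq_zero_or_pos k with rfl | hk
  · simp only [h0, zero_mul]; exact isBigO_zero _ _
  · refine IsBigO.const_mul_left ?_ _
    obtain ⟨l, rfl⟩ : ∃ l, k = l + 1 := ⟨k - 1, by omega⟩
    have := (isBigO_refl (fun η : ℝ => η) (𝓝 0)).mul (isBigO_pow_one l)
    simpa [pow_succ, mul_comm] using this

/-- The increments have no constant term, so Taylor terms with `n + k > N` are `O(η ^ (N + 1))`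
analytically and divisible by `X ^ (N + 1)` formally. The same finite sum represents both sides. -/
theorem expands_formalComp {f : ℝ → ℝ → ℝ} (hf : IsQPAnalytic ω f) {u v : ℕ → ℝ → ℝ} (N : ℕ)
    {ξ : ℝ} (hu : u 0 ξ = 0) (hv : v 0 ξ = 0) :
    Expands (N + 1) (fun η => f (ξ + trunc u N ξ η) (η + trunc v N ξ η)) (formalComp f u v ξ) := by
  have hX : Expands (N + 1) (fun η => η) PowerSeries.X := by
    simpa using Expands.polynomial (N + 1) Polynomial.X
  have h1 := Expands.sum (Finset.range (N + 1)) fun n (_ : n ∈ Finset.range (N + 1)) =>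
    Expands.sum (Finset.range (N + 1)) fun k (_ : k ∈ Finset.range (N + 1)) =>
      ((Expands.const (N + 1) (taylorCoeff f ξ n k)).mul ((expands_trunc u N ξ).pow n)).mul
        ((hX.add (expands_trunc v N ξ)).pow k)
  refine h1.congr (hf.taylor_isBigO ξ (trunc_isBigO N hu)
    ((isBigO_refl _ _).add (trunc_isBigO N hv)) N) ?_
  rw [PowerSeries.X_pow_dvd_iff]
  intro i hi
  rw [map_sub, sub_eq_zero, formalComp, PowerSeries.coeff_mk, map_sum]
  simp only [map_sum, mul_assoc, PowerSeries.coeff_C_mul]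
  rw [← Finset.sum_product' (Finset.range (N + 1)) (Finset.range (N + 1))
      fun n k => taylorCoeff f ξ n k *
        PowerSeries.coeff i (seriesAt u ξ ^ n * (PowerSeries.X + seriesAt v ξ) ^ k),
    ← Finset.sum_product' (Finset.range (i + 1)) (Finset.range (i + 1))
      fun n k => taylorCoeff f ξ n k *
        PowerSeries.coeff i (seriesAt u ξ ^ n * (PowerSeries.X + seriesAt v ξ) ^ k)]
  symm
  refine Finset.sum_subset (Finset.product_subset_product (Finset.range_mono (by omega))
    (Finset.range_mono (by omega))) fun q _ hq => ?_
  have hq' : i < q.1 + q.2 := by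
    by_contra hlt
    exact hq (by simp only [Finset.mem_product, Finset.mem_range]; omega)
  have hdu : PowerSeries.X ∣ seriesAt u ξ := by
    rw [PowerSeries.X_dvd_iff]; simpa [seriesAt] using hu
  have hdv : PowerSeries.X ∣ PowerSeries.X + seriesAt v ξ := by
    refine dvd_add dvd_rfl ?_
    rw [PowerSeries.X_dvd_iff]; simpa [seriesAt] using hv
  have hd : PowerSeries.X ^ (q.1 + q.2) ∣
      seriesAt u ξ ^ q.1 * (PowerSeries.X + seriesAt v ξ) ^ q.2 := by
    rw [pow_add]; exact mul_dvd_mul (pow_dvd_pow_of_dvd hdu _) (pow_dvd_pow_of_dvd hdv _)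
  rw [PowerSeries.X_pow_dvd_iff.1 hd i hq', mul_zero]

theorem IsFormalQPSeries.trunc_isQPAnalytic {u : ℕ → ℝ → ℝ} (hu : IsFormalQPSeries ω u) (N : ℕ) :
    IsQPAnalytic ω (trunc u N) := by
  unfold trunc
  exact IsQPAnalytic.finset_sum _ fun k _ =>
    (isQPAnalyticFun_iff.1 (hu.2 k)).mul (IsQPAnalytic.snd.pow k)

theorem IsFormalQPSeries.trunc_apply_zero {u : ℕ → ℝ → ℝ} (hu : IsFormalQPSeries ω u) (N : ℕ)
    (ξ : ℝ) : trunc u N ξ 0 = 0 := by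
  unfold trunc
  refine Finset.sum_eq_zero fun k _ => ?_
  rcases Nat.eq_zero_or_pos k with rfl | hk
  · rw [hu.1, zero_mul]
  · rw [zero_pow hk.ne', mul_zero]

theorem IsFormalChange.qpMap_trunc {u v : ℕ → ℝ → ℝ} (huv : IsFormalChange ω u v) (N : ℕ) :
    QPMap ω (nearIdentity (trunc u N) (trunc v N)) := by
  rw [qpMap_nearIdentity]
  exact ⟨huv.1.trunc_isQPAnalytic N, huv.2.1.trunc_isQPAnalytic N, fun ξ =>
    ⟨huv.1.trunc_apply_zero N ξ, huv.2.1.trunc_apply_zero N ξ⟩⟩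

theorem IsQPAnalytic.ordU_of_isBigO (hγ : ∀ k : Fin m → ℤ, k ≠ 0 → mode ω k γ ≠ 1) {s : ℕ}
    {h : ℝ → ℝ → ℝ} (hh : IsQPAnalytic ω h)
    (hO : ∀ ξ, (fun η : ℝ => h ξ η) =O[𝓝 0] fun η : ℝ => η ^ s) : OrdU s h := by
  obtain ⟨t, ht, ρ, hρ, K, hK⟩ := isQPAnalytic_iff.1 hh
  exact (hK.upgrade hγ ht.le hρ hO).ordU ht.le hρ

/-- The truncations of a formal conjugacy are approximate conjugacies. -/
theorem FormallyLinearizes.isBigO (hγ : ∀ k : Fin m → ℤ, k ≠ 0 → mode ω k γ ≠ 1)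
    {f g : ℝ → ℝ → ℝ} (hf : IsQPAnalytic ω f) (hg : IsQPAnalytic ω g) {u v : ℕ → ℝ → ℝ}
    (huv : IsFormalChange ω u v) (hlin : FormallyLinearizes γ f g u v) (N : ℕ) :
    (fun p => mapM γ f g (nearIdentity (trunc u N) (trunc v N) p) -
      nearIdentity (trunc u N) (trunc v N) (rotation γ p)) =O[nearAxis]
        fun p : ℝ × ℝ => p.2 ^ (N + 1) := by
  have hU := huv.qpMap_trunc N
  have key : ∀ {h : ℝ → ℝ → ℝ} {w : ℕ → ℝ → ℝ}, IsQPAnalytic ω h → IsFormalQPSeries ω w →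
      (∀ ξ, seriesAt w ξ + formalComp h u v ξ = seriesAt w (ξ + γ)) →
      OrdU (N + 1) (defect γ h (trunc u N) (trunc v N) (trunc w N)) := by
    intro h w hh hw hs
    -- The formal identity is known for each `ξ` separately; analyticity of the defect makes the
    -- resulting order uniform.
    refine (hh.defect hU (hw.trunc_isQPAnalytic N)).ordU_of_isBigO hγ fun ξ => ?_
    have h1 := ((expands_trunc w N ξ).add (expands_formalComp hh N (huv.1.1 ξ) (huv.2.1.1 ξ))).add
      ((Expands.const (N + 1) (-1)).mul (expands_trunc w N (ξ + γ)))
    rw [hs] at h1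
    refine (h1.isBigO (by simp)).congr_left fun η => ?_
    simp only [defect]; ring
  have e1 := key hf huv.1 fun ξ => by
    have := (hlin ξ).1
    rw [map_add] at this
    linear_combination this
  have e2 := key hg huv.2.1 fun ξ => by
    have := (hlin ξ).2
    linear_combination this
  refine (IsBigO.prod_left e1 e2).congr_left fun p => ?_
  simp only [mapM, nearIdentity, rotation, defect, Prod.mk_sub_mk, Prod.mk.injEq]
  constructor <;> ring

/-- The linear part of a formal conjugacy is bounded away from zero. -/
theorem FormallyLinearizes.exists_lower_bound (hγ : ∀ k : Fin m → ℤ, k ≠ 0 → mode ω k γ ≠ 1)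
    {f g : ℝ → ℝ → ℝ} (hf : IsQPAnalytic ω f) (hg : IsQPAnalytic ω g) (hg0 : ∀ ξ, g ξ 0 = 0)
    {u v : ℕ → ℝ → ℝ} (huv : IsFormalChange ω u v) (hlin : FormallyLinearizes γ f g u v) :
    ∃ δ > 0, ∀ ξ, δ ≤ |1 + v 1 ξ| := by
  have ha : IsQPAnalyticFun ω fun ξ => 1 + v 1 ξ := isQPAnalyticFun_iff.2
    ((IsQPAnalytic.const 1).add (isQPAnalyticFun_iff.1 (huv.2.1.2 1)))
  have hv1 : ∀ ξ η, η + trunc v 1 ξ η = (1 + v 1 ξ) * η := fun ξ η => by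
    simp [trunc, Finset.sum_range_succ, huv.2.1.1 ξ]; ring
  obtain ⟨-, e2⟩ := ordU_prod (hlin.isBigO hγ hf hg huv 1)
  obtain ⟨C, hC, δ, hδ, hb⟩ := ordU_iff.1 (hg.ordU_one hg0)
  obtain ⟨C', hC', δ', hδ', hb'⟩ := ordU_iff.1 e2
  -- Nonvanishing on the real line alone allows infimum zero. The linear part of the conjugacy,
  -- obtained on dividing by a small `η`, gives `|1 + v₁(ξ + γ)| ≤ (1 + C) |1 + v₁(ξ)|`, where `|g|
  -- ≤ C |r|`.
  refine QPReversible.exists_lower_bound hγ ha (L := 1 + C) (by linarith) (fun ξ => ?_) (huv.2.2 0)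
  refine le_of_forall_pos_le_add fun ε hε => ?_
  set η := min (δ / (2 * (|1 + v 1 ξ| + 1))) (min (δ' / 2) (ε / C')) with hη
  have hη0 : 0 < η := by positivity
  have h1 : |(1 + v 1 ξ) * η| < δ := by
    have : η ≤ δ / (2 * (|1 + v 1 ξ| + 1)) := min_le_left _ _
    rw [le_div_iff₀ (by positivity)] at this
    rw [abs_mul, abs_of_pos hη0]
    nlinarith [abs_nonneg (1 + v 1 ξ)]
  have h2 : |η| < δ' := by
    have : η ≤ δ' / 2 := (min_le_right _ _).trans (min_le_left _ _)
    rw [abs_of_pos hη0]; linarith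
  have h3 : C' * η ≤ ε := by
    have : η ≤ ε / C' := (min_le_right _ _).trans (min_le_right _ _)
    rw [le_div_iff₀ hC'] at this
    linarith
  have h4 := hb (ξ + trunc u 1 ξ η) _ h1
  have h5 := hb' ξ η h2
  simp only [mapM, nearIdentity, rotation, Prod.snd_sub, hv1] at h5
  rw [pow_one, abs_mul, abs_of_pos hη0] at h4
  rw [abs_of_pos hη0, one_add_one_eq_two] at h5
  have h6 : |(1 + v 1 (ξ + γ)) * η| ≤ |(1 + v 1 ξ) * η| + C * (|1 + v 1 ξ| * η) + C' * η ^ 2 := by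
    have := abs_sub_abs_le_abs_sub ((1 + v 1 (ξ + γ)) * η)
      ((1 + v 1 ξ) * η + g (ξ + trunc u 1 ξ η) ((1 + v 1 ξ) * η))
    rw [abs_sub_comm] at this
    have := abs_add_le ((1 + v 1 ξ) * η) (g (ξ + trunc u 1 ξ η) ((1 + v 1 ξ) * η))
    linarith
  rw [abs_mul, abs_mul, abs_of_pos hη0] at h6
  have h7 : |1 + v 1 (ξ + γ)| * η ≤ ((1 + C) * |1 + v 1 ξ| + ε) * η := by
    have := mul_le_mul_of_nonneg_right h3 hη0.le
    nlinarith
  exact le_of_mul_le_mul_right h7 hη0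

end QPReversible

end

/-! ### The analytic conjugacy and its symmetry. -/

noncomputable section

namespace QPReversible

open Filter Topology Asymptotics

variable {m : ℕ} {ω : Fin m → ℝ} {γ : ℝ}

/-! ### Small divisors -/

/-- With `j` the integer nearest to `y`, `|exp (2πiy) - 1| = 2 |sin (π (y - j))| ≥ 4 |y - j|`. The
exponent may be rounded up because `|k| ≥ 1`. -/
theorem IsDiophantine.smallDivisors {c₀ σ : ℝ} (hc₀ : 0 < c₀) (h : IsDiophantine ω γ c₀ σ) :
    SmallDivisors ω γ c₀⁻¹ ⌈σ⌉₊ := by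
  refine ⟨by positivity, fun k hk => ?_⟩
  have ho := one_le_order hk
  have ho0 : 0 < order k := by linarith
  set y := pairing k ω * γ / (2 * Real.pi) with hy
  set j := round y with hj
  have hyj : |y - j| ≤ 1 / 2 := abs_sub_round y
  have h1 := h k hk j
  have hpi := Real.pi_pos
  have hpow : order k ^ σ ≤ order k ^ ⌈σ⌉₊ := by
    rw [← Real.rpow_natCast]
    exact Real.rpow_le_rpow_of_exponent_le ho (Nat.le_ceil σ)
  have h2 : c₀ ≤ order k ^ ⌈σ⌉₊ * |y - j| := by
    rw [div_le_iff₀ (Real.rpow_pos_of_pos ho0 σ), mul_comm] at h1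
    exact h1.trans (mul_le_mul_of_nonneg_right hpow (abs_nonneg _))
  have h3 : ‖mode ω k γ - 1‖ = 2 * |Real.sin (Real.pi * (y - j))| := by
    rw [mode, Complex.norm_exp_I_mul_ofReal_sub_one, Real.norm_eq_abs, abs_mul, abs_two]
    have e : pairing k ω * γ / 2 = Real.pi * (y - j) + j * Real.pi := by
      rw [hy]; field_simp; ring
    rw [e, Real.sin_add_int_mul_pi, abs_mul, abs_zpow, abs_neg, abs_one, one_zpow, one_mul]
  have h4 : 2 * |y - j| ≤ |Real.sin (Real.pi * (y - j))| := by
    have := Real.mul_abs_le_abs_sin (x := Real.pi * (y - j)) (by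
      rw [abs_mul, abs_of_pos hpi]; nlinarith)
    rw [abs_mul, abs_of_pos hpi] at this
    refine le_trans (le_of_eq ?_) this
    field_simp
  rw [h3, inv_mul_eq_div, div_mul_eq_mul_div, le_div_iff₀ hc₀, one_mul]
  have h5 : 0 ≤ order k ^ ⌈σ⌉₊ := by positivity
  have h6 := mul_le_mul_of_nonneg_left h4 h5
  have h7 := mul_nonneg h5 (abs_nonneg (y - j))
  linarith

/-! ### Conjugacy to the rotation -/

theorem QPDiffeo.symm {P : ℝ × ℝ → ℝ × ℝ} (hP : QPDiffeo ω P) :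
    ∃ Q, QPDiffeo ω Q ∧ (∀ᶠ p in nearAxis, Q (P p) = p) ∧ ∀ᶠ p in nearAxis, P (Q p) = p := by
  obtain ⟨hP, Q, hQ, h1, h2⟩ := hP
  exact ⟨Q, ⟨hQ, P, hP, h2, h1⟩, h1, h2⟩

theorem isBigO_snd_pow_mono {E : Type*} [Norm E] {A : ℝ × ℝ → E} {s s' : ℕ} (hs : s' ≤ s)
    (hA : A =O[nearAxis] fun p : ℝ × ℝ => p.2 ^ s) : A =O[nearAxis] fun p : ℝ × ℝ => p.2 ^ s' := by
  refine hA.trans (IsBigO.of_bound 1 (eventually_nearAxis.2 ⟨1, one_pos, fun ξ η hη => ?_⟩))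
  rw [one_mul, norm_pow, norm_pow]
  exact pow_le_pow_of_le_one (norm_nonneg _) hη.le hs

theorem IsFormalChange.qpDiffeo_trunc (hγ : ∀ k : Fin m → ℤ, k ≠ 0 → mode ω k γ ≠ 1)
    {u v : ℕ → ℝ → ℝ} (huv : IsFormalChange ω u v) {δ : ℝ} (hδ : 0 < δ)
    (hlow : ∀ ξ, δ ≤ |1 + v 1 ξ|) (n : ℕ) :
    QPDiffeo ω (nearIdentity (trunc u (n + 1)) (trunc v (n + 1))) := by
  have ha : IsQPAnalytic ω fun ξ _ => 1 + v 1 ξ :=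
    (IsQPAnalytic.const 1).add (isQPAnalyticFun_iff.1 (huv.2.1.2 1))
  obtain ⟨b, hb, hab⟩ := exists_inverse hγ ha hδ hlow
  refine (huv.qpMap_trunc (n + 1)).qpDiffeo hγ ha hb hab ?_
  have h1 : IsQPAnalytic ω fun ξ η => ∑ k ∈ Finset.range n, v (k + 2) ξ * η ^ k :=
    IsQPAnalytic.finset_sum _ fun k _ =>
      (isQPAnalyticFun_iff.1 (huv.2.1.2 (k + 2))).mul (IsQPAnalytic.snd.pow k)
  have h2 : OrdU 2 fun _ η => η ^ 2 := isBigO_refl _ _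
  have h3 := h1.ordU_zero.mul h2
  rw [zero_add] at h3
  refine h3.congr (Eventually.of_forall fun p => ?_)
  simp only [nearIdentity, trunc]
  rw [Finset.sum_range_succ', Finset.sum_range_succ', huv.2.1.1, Finset.sum_mul]
  have e : ∑ k ∈ Finset.range n, v (k + 1 + 1) p.1 * p.2 ^ (k + 1 + 1) =
      ∑ k ∈ Finset.range n, v (k + 2) p.1 * p.2 ^ k * p.2 ^ 2 :=
    Finset.sum_congr rfl fun k _ => by ring
  rw [e]
  ring

/-- The iteration needs perturbations of order two, while `f` and `g` have order one. Conjugation by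
the truncation `T 1` removes the linear part, and `(T 1)⁻¹ ∘ T n` are approximate conjugacies of
every order for the new map. The result is carried back by `T 1`. -/
theorem exists_qpDiffeo_conjugacy {C₀ : ℝ} {τ : ℕ} (hsd : SmallDivisors ω γ C₀ τ)
    {f g : ℝ → ℝ → ℝ} (hf : IsQPAnalytic ω f) (hg : IsQPAnalytic ω g) (hf0 : ∀ ξ, f ξ 0 = 0)
    (hg0 : ∀ ξ, g ξ 0 = 0) {u v : ℕ → ℝ → ℝ} (huv : IsFormalChange ω u v)
    (hlin : FormallyLinearizes γ f g u v) :
    ∃ U, QPDiffeo ω U ∧ ∀ᶠ p in nearAxis, mapM γ f g (U p) = U (rotation γ p) := by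
  have hγ := hsd.ne_one
  obtain ⟨δ, hδ, hlow⟩ := hlin.exists_lower_bound hγ hf hg hg0 huv
  have hUN := huv.qpDiffeo_trunc hγ hδ hlow
  have happ := hlin.isBigO hγ hf hg huv
  set T : ℕ → ℝ × ℝ → ℝ × ℝ := fun n => nearIdentity (trunc u n) (trunc v n) with hT
  have hM : QPMap ω (nearIdentity f g) := by
    rw [qpMap_nearIdentity]; exact ⟨hf, hg, fun ξ => ⟨hf0 ξ, hg0 ξ⟩⟩
  have hMt : Tendsto (mapM γ f g) nearAxis nearAxis := tendsto_mapM hM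
  have hR := tendsto_rotation γ
  obtain ⟨V, hV, hVU, hUV⟩ := (hUN 0).symm
  have hU₀ : QPMap ω (T 1) := (hUN 0).1
  -- The rotation is factored out on the left, so that `R ∘ S = V ∘ M ∘ T 1` with `S` a `QPMap`.
  set S : ℝ × ℝ → ℝ × ℝ :=
    (fun p => rotation (-γ) (V (rotation γ p))) ∘ nearIdentity f g ∘ T 1 with hS
  have hSq : QPMap ω S := (hV.1.conj_rotation γ).comp (hM.comp hU₀)
  have hSM : ∀ p, mapM γ (fun ξ η => (S (ξ, η)).1 - ξ) (fun ξ η => (S (ξ, η)).2 - η) p =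
      V (mapM γ f g (T 1 p)) := fun p => by
    rw [mapM_eq γ f g, mapM_eq, ← QPMap.eq_nearIdentity]
    simp [hS, rotation]
  have hord : ∀ n, (fun p => V (mapM γ f g (T n p)) - V (T n (rotation γ p))) =O[nearAxis]
      fun p : ℝ × ℝ => p.2 ^ (n + 1) := fun n =>
    (hV.1.comp_sub_isBigO (hMt.comp (huv.qpMap_trunc n).tendsto)
      ((huv.qpMap_trunc n).tendsto.comp hR)).trans (happ n)
  have h2 : (fun p => V (mapM γ f g (T 1 p)) - rotation γ p) =O[nearAxis]
      fun p : ℝ × ℝ => p.2 ^ 2 := by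
    refine (hord 1).congr' ?_ EventuallyEq.rfl
    filter_upwards [hR.eventually hVU] with p hp
    rw [hp]
  obtain ⟨h21, h22⟩ := ordU_prod h2
  obtain ⟨Uc, hUc, hUc2, hconj⟩ := exists_conjugacy hsd hSq.1 hSq.2.1
    (h21.congr (Eventually.of_forall fun p => by
      have := congrArg Prod.fst (hSM p)
      simp only [mapM] at this
      simp only [mapM, rotation, Prod.fst_sub]
      linarith))
    (h22.congr (Eventually.of_forall fun p => by
      have := congrArg Prod.snd (hSM p)
      simp only [mapM] at this
      simp only [mapM, rotation, Prod.snd_sub]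
      linarith))
    (fun N => by
      refine ⟨V ∘ T (N + 1), hV.comp (hUN N), ?_⟩
      refine (isBigO_snd_pow_mono (by omega) (hord (N + 1))).congr' ?_ EventuallyEq.rfl
      filter_upwards [(hUN N).1.tendsto.eventually hUV] with p hp
      rw [hSM]
      simp only [Function.comp_apply]
      rw [show T 1 (V (T (N + 1) p)) = T (N + 1) p from hp])
  refine ⟨T 1 ∘ Uc, (hUN 0).comp (hUc.qpDiffeo_of_ordU hγ hUc2), ?_⟩
  filter_upwards [hconj, (hMt.comp (hU₀.tendsto.comp hUc.tendsto)).eventually hUV] with p h3 h4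
  rw [hSM] at h3
  simp only [Function.comp_apply] at h4 ⊢
  rw [← h3]
  exact h4.symm

/-! ### Reversibility -/

/-- This covers the reflection `ξ ↦ -ξ` and the restriction to `ξ = 0`, which send modes to modes
without raising the order. -/
theorem IsQPAnalytic.of_monomials {f : ℝ → ℝ → ℝ} (hf : IsQPAnalytic ω f)
    {σ : (Fin m → ℤ) → Fin m → ℤ} (hσ : ∀ j, order (σ j) ≤ order j) {x : ℝ → ℝ}
    (hx : ∀ j ξ, mode ω (σ j) ξ = mode ω j (x ξ)) : IsQPAnalytic ω fun ξ η => f (x ξ) η := by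
  obtain ⟨t, ht, ρ, hρ, c, hc, hs⟩ := hf
  refine RRep.isQPAnalytic (t := t) (ρ := ρ) (s := 0) (Rep.hasSum ht.le hρ.le hc
    (H := fun p ξ η => c p.1 p.2 * (mode ω (σ p.2) ξ * (η : ℂ) ^ p.1)) (fun p => ?_)
    fun ξ η hη => ?_) ht hρ
  · refine (Rep.monomial (c p.1 p.2) p.1 (σ p.2) (by simp)).mono_const ?_
    rw [weight, mul_assoc]
    have := hσ p.2
    gcongr
  · refine (hs (x ξ) η hη).congr_fun fun p => ?_
    rw [hx]; ring

theorem IsQPAnalytic.reflect {f : ℝ → ℝ → ℝ} (hf : IsQPAnalytic ω f) :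
    IsQPAnalytic ω fun ξ η => f (-ξ) η :=
  hf.of_monomials (σ := fun j => -j) (x := fun ξ => -ξ) (fun j => (order_neg j).le) fun j ξ => by
    simp [mode, pairing_neg]

theorem IsQPAnalytic.at_zero {f : ℝ → ℝ → ℝ} (hf : IsQPAnalytic ω f) :
    IsQPAnalytic ω fun _ η => f 0 η :=
  hf.of_monomials (σ := fun _ => 0) (x := fun _ => 0)
    (fun j => by rw [order_zero]; exact order_nonneg j) fun j ξ => by
      simp [mode, pairing_zero]

/-- A function that vanishes along the orbit of `0` vanishes. -/
theorem IsQPAnalytic.eq_zero_of_orbit (hγ : ∀ k : Fin m → ℤ, k ≠ 0 → mode ω k γ ≠ 1)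
    {h : ℝ → ℝ → ℝ} (hh : IsQPAnalytic ω h) {δ : ℝ} (hδ : 0 < δ)
    (h0 : ∀ (n : ℕ) (η : ℝ), |η| < δ → h (n * γ) η = 0) :
    ∀ᶠ p : ℝ × ℝ in nearAxis, h p.1 p.2 = 0 := by
  obtain ⟨t, ht, ρ, hρ, c, hc, hs⟩ := hh
  refine eventually_nearAxis.2 ⟨min ρ δ, lt_min hρ hδ, fun ξ η hη => ?_⟩
  have hηρ : |η| < ρ := hη.trans_le (min_le_left _ _)
  have hηδ : |η| < δ := hη.trans_le (min_le_right _ _)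
  have h1 : Summable fun p : (Fin m → ℤ) × ℕ => ‖c p.2 p.1 * (η : ℂ) ^ p.2‖ := by
    rw [← (Equiv.prodComm ℕ (Fin m → ℤ)).summable_iff]
    refine Summable.of_nonneg_of_le (fun p => norm_nonneg _) (fun p => ?_) hc
    simp only [Function.comp_apply, Equiv.prodComm_apply, Prod.snd_swap, Prod.fst_swap]
    rw [norm_mul, norm_pow, Complex.norm_real, Real.norm_eq_abs]
    have e1 : 1 ≤ Real.exp (t * order p.2) := Real.one_le_exp (mul_nonneg ht.le (order_nonneg _))
    have e2 : |η| ^ p.1 ≤ ρ ^ p.1 := pow_le_pow_left₀ (abs_nonneg _) hηρ.le _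
    exact mul_le_mul (le_mul_of_one_le_right (norm_nonneg _) e1) e2 (by positivity) (by positivity)
  have h2 : ∀ ξ, HasSum (fun j => (∑' k, c k j * (η : ℂ) ^ k) * mode ω j ξ) ((h ξ η : ℝ) : ℂ) :=
    fun ξ => by
      have e1 := (Equiv.prodComm (Fin m → ℤ) ℕ).hasSum_iff
        (f := fun p : ℕ × (Fin m → ℤ) => c p.1 p.2 * mode ω p.2 ξ * (η : ℂ) ^ p.1) |>.2
        (hs ξ η hηρ)
      refine HasSum.prod_fiberwise e1 fun j => ?_
      have e2 := (h1.of_norm.prod_factor j).hasSum.mul_right (mode ω j ξ)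
      refine e2.congr_fun fun k => ?_
      simp only [Function.comp_apply, Equiv.prodComm_apply, Prod.snd_swap, Prod.fst_swap]
      ring
  have h3 : Summable fun j => ‖∑' k, c k j * (η : ℂ) ^ k‖ := by
    refine (h2 0).summable.norm.congr fun j => ?_
    rw [norm_mul, norm_mode, mul_one]
  have h4 := coeff_eq_zero hγ h3 h2 fun n => by rw [h0 n η hηδ]; simp
  have h5 := h2 ξ
  simp only [h4, zero_mul] at h5
  have := h5.unique hasSum_zero
  exact_mod_cast this

/-- A conjugacy can be normalized so that it is the identity on `{0} × ℝ`. -/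
theorem QPDiffeo.normalize (hγ : ∀ k : Fin m → ℤ, k ≠ 0 → mode ω k γ ≠ 1) {U : ℝ × ℝ → ℝ × ℝ}
    (hU : QPDiffeo ω U) {M : ℝ × ℝ → ℝ × ℝ}
    (hMU : ∀ᶠ p in nearAxis, M (U p) = U (rotation γ p)) :
    ∃ W, QPDiffeo ω W ∧ (∀ᶠ p in nearAxis, M (W p) = W (rotation γ p)) ∧
      ∀ᶠ p : ℝ × ℝ in nearAxis, W (0, p.2) = (0, p.2) := by
  obtain ⟨Q, hQ, hQU, hUQ⟩ := hU.symm
  set φ : ℝ → ℝ := fun r => (Q (0, r)).2 with hφ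
  -- The displacement of `C` depends on `η` only, so `C` commutes with the rotation; and `C (0, η) =
  -- U⁻¹ (0, η)`, so `U ∘ C` is the identity on `ξ = 0`.
  set C := nearIdentity (fun _ η => (Q (0, η)).1 - 0) (fun _ η => (Q (0, η)).2 - η) with hC
  have hCq : QPMap ω C := by
    rw [hC, qpMap_nearIdentity]
    exact ⟨hQ.1.1.at_zero, hQ.1.2.1.at_zero, fun ξ => hQ.1.2.2 0⟩
  have hφa : IsQPAnalytic ω fun _ η => φ η :=
    (hQ.1.2.1.at_zero.add IsQPAnalytic.snd).congr (Eventually.of_forall fun p => by simp [hφ])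
  set a := taylorCoeff (fun _ η => φ η) 0 0 1 with ha
  have hφ0 : φ 0 = 0 := by simpa using (hQ.1.2.2 0).2
  have hφ2 : (fun η : ℝ => φ η - a * η) =O[𝓝 0] fun η : ℝ => η ^ 2 := by
    have := hφa.taylor_isBigO 0 (x := fun _ => 0) (y := fun η => η) (isBigO_zero _ _)
      (isBigO_refl _ _) 1
    refine this.congr_left fun η => ?_
    have h00 : taylorCoeff (fun _ η => φ η) 0 0 0 = 0 := by simp [taylorCoeff, hφ0]
    simp [Finset.sum_range_succ, h00, ha]
  -- Otherwise `φ r = O(r²)`. But `U` maps `Q (0, r)` back to `(0, r)`, whence `r ≤ K |φ r|`, a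
  -- contradiction for small `r`.
  have ha0 : a ≠ 0 := fun h0 => by
    rw [h0] at hφ2
    obtain ⟨K, hK, δ, hδ, hb⟩ := ordU_iff.1 hU.1.snd_ordU
    obtain ⟨δ', hδ', hb'⟩ := eventually_nearAxis.1 hUQ
    obtain ⟨K', hK', hb''⟩ := hφ2.exists_pos
    obtain ⟨δ₂, hδ₂, hb₂⟩ := Metric.eventually_nhds_iff.1 hb''.bound
    have hmem : ∀ᶠ p : ℝ × ℝ in nearAxis, |p.2| < δ :=
      eventually_nearAxis.2 ⟨δ, hδ, fun ξ η hη => hη⟩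
    obtain ⟨δ₃, hδ₃, hb₃⟩ := eventually_nearAxis.1 (hQ.1.tendsto.eventually hmem)
    set r := min (min (δ' / 2) (δ₂ / 2)) (min (δ₃ / 2) (1 / (2 * (K * K')))) with hr
    have hr0 : 0 < r := by positivity
    have r1 : r ≤ δ' / 2 := (min_le_left _ _).trans (min_le_left _ _)
    have r2 : r ≤ δ₂ / 2 := (min_le_left _ _).trans (min_le_right _ _)
    have r3 : r ≤ δ₃ / 2 := (min_le_right _ _).trans (min_le_left _ _)
    have r4 : r ≤ 1 / (2 * (K * K')) := (min_le_right _ _).trans (min_le_right _ _)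
    have e1 := hb' 0 r (by rw [abs_of_pos hr0]; linarith)
    have e2 := hb₂ (y := r) (by rw [Real.dist_eq, sub_zero, abs_of_pos hr0]; linarith)
    have e3 := hb₃ 0 r (by rw [abs_of_pos hr0]; linarith)
    have e4 := hb (Q (0, r)).1 (Q (0, r)).2 e3
    rw [Prod.mk.eta, e1, pow_one, abs_of_pos hr0] at e4
    rw [zero_mul, sub_zero, norm_pow, Real.norm_eq_abs, Real.norm_eq_abs, abs_of_pos hr0] at e2
    rw [le_div_iff₀ (by positivity)] at r4
    have e5 := mul_le_mul_of_nonneg_left e2 hK.le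
    have e6 : K * (K' * r ^ 2) = r * (K * K') * r := by ring
    nlinarith
  have hCd : QPDiffeo ω C := by
    refine hCq.qpDiffeo hγ (a := fun _ => a) (b := fun _ => a⁻¹) (IsQPAnalytic.const _)
      (IsQPAnalytic.const _) (fun _ => mul_inv_cancel₀ ha0) ?_
    refine (IsQPAnalytic.ordU_of_isBigO hγ (hφa.sub ((IsQPAnalytic.const a).mul
      IsQPAnalytic.snd)) fun ξ => hφ2).congr (Eventually.of_forall fun p => ?_)
    simp [hC, nearIdentity, hφ]
  refine ⟨U ∘ C, hU.comp hCd, ?_, ?_⟩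
  · filter_upwards [hCq.tendsto.eventually hMU] with p hp
    simp only [Function.comp_apply]
    rw [hp]
    congr 1
    simp [hC, nearIdentity, rotation]
    ring
  · have ht : Tendsto (fun p : ℝ × ℝ => ((0 : ℝ), p.2)) nearAxis nearAxis :=
      tendsto_comap_iff.2 tendsto_comap
    filter_upwards [ht.eventually hUQ] with p hp
    have e : C (0, p.2) = Q (0, p.2) := by simp [hC, nearIdentity]
    simp only [Function.comp_apply]
    rw [e, hp]

/-- A normalized conjugacy between a reversible map and the rotation commutes with the
involution. -/
theorem commute_involution (hγ : ∀ k : Fin m → ℤ, k ≠ 0 → mode ω k γ ≠ 1) {M W : ℝ × ℝ → ℝ × ℝ}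
    (hM : IsReversible M) (hW : QPMap ω W)
    (hMW : ∀ᶠ p in nearAxis, M (W p) = W (rotation γ p))
    (hW0 : ∀ᶠ p : ℝ × ℝ in nearAxis, W (0, p.2) = (0, p.2)) :
    ∀ᶠ p in nearAxis, W (involution p) = involution (W p) := by
  obtain ⟨δ₀, hδ₀, hrev⟩ := hM
  have hinv : ∀ p, involution (involution p) = p := fun p => by simp [involution]
  have hrev' : ∀ p : ℝ × ℝ, |p.2| < δ₀ → M (involution (M p)) = involution p := fun p hp =>
    hrev p.1 p.2 hp
  have hinj : ∀ p q : ℝ × ℝ, |p.2| < δ₀ → |q.2| < δ₀ → M p = M q → p = q := fun p q hp hq hpq => by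
    rw [← hinv p, ← hrev' p hp, hpq, hrev' q hq, hinv]
  have hmem : ∀ᶠ p : ℝ × ℝ in nearAxis, |p.2| < δ₀ :=
    eventually_nearAxis.2 ⟨δ₀, hδ₀, fun ξ η hη => hη⟩
  obtain ⟨δ, hδ, hall⟩ := eventually_nearAxis.1
    (hMW.and (hW0.and (hW.tendsto.eventually hmem)))
  -- `M` sends both sides at `n + 1` to `G W(nγ, r)`: the left one by the conjugacy and induction,
  -- the right one since `M G M = G`. Reversibility also makes `M` injective. One `δ` serves all
  -- `n`, as the rotation preserves `η`.
  have horb : ∀ (n : ℕ) (r : ℝ), |r| < δ → W (-(n * γ), r) = involution (W (n * γ, r)) := by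
    intro n r hr
    induction n with
    | zero =>
      have := (hall 0 r hr).2.1
      simp only [Nat.cast_zero, zero_mul, neg_zero]
      rw [this]; simp [involution]
    | succ n ih =>
      have e1 := (hall (-((n + 1 : ℕ) * γ)) r hr).1
      have e2 := (hall (n * γ) r hr).1
      have e3 := hrev' _ (hall (n * γ) r hr).2.2
      have a1 : rotation γ (-((n + 1 : ℕ) * γ), r) = (-(n * γ), r) := by
        simp [rotation]; ring
      have a2 : rotation γ (n * γ, r) = ((n + 1 : ℕ) * γ, r) := by
        simp [rotation]; ring
      rw [a1, ih] at e1
      rw [a2] at e2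
      rw [e2] at e3
      exact hinj _ _ (hall _ r hr).2.2 (hall ((n + 1 : ℕ) * γ) r hr).2.2 (e1.trans e3.symm)
  -- `u(-ξ) + u(ξ)` and `v(-ξ) - v(ξ)` vanish along the orbit of `0`, hence near the whole axis.
  have h1 := (hW.1.reflect.add hW.1).eq_zero_of_orbit hγ hδ fun n η hη => by
    have := congrArg Prod.fst (horb n η hη)
    simp only [involution] at this
    linarith
  have h2 := (hW.2.1.reflect.sub hW.2.1).eq_zero_of_orbit hγ hδ fun n η hη => by
    have := congrArg Prod.snd (horb n η hη)
    simp only [involution] at this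
    linarith
  filter_upwards [h1, h2] with p h3 h4
  refine Prod.ext ?_ ?_
  · simp only [involution]; linarith
  · simp only [involution]; linarith

end QPReversible

end

theorem theorem1p1 {m : ℕ} (ω : Fin m → ℝ) (γ₀ c₀ σ : ℝ) (hc₀ : 0 < c₀) (hσ : 0 < σ)
    (hdioph : QPReversible.IsDiophantine ω γ₀ c₀ σ)
    (f g : ℝ → ℝ → ℝ)
    (hf : QPReversible.IsQPAnalytic ω f) (hg : QPReversible.IsQPAnalytic ω g)
    (hf0 : ∀ θ : ℝ, f θ 0 = 0) (hg0 : ∀ θ : ℝ, g θ 0 = 0)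
    (hrev : QPReversible.IsReversible (QPReversible.mapM γ₀ f g))
    (hformal : ∃ u v : ℕ → ℝ → ℝ, QPReversible.IsFormalChange ω u v ∧
      QPReversible.FormallyLinearizes γ₀ f g u v) :
    ∃ u v u' v' : ℝ → ℝ → ℝ,
      QPReversible.IsAnalyticQPPair ω u v ∧ QPReversible.IsAnalyticQPPair ω u' v' ∧
      ∃ δ : ℝ, 0 < δ ∧
        -- `U = I + (u, v)` and `I + (u', v')` are mutually inverse near `η = 0`
        (∀ ξ η : ℝ, |η| < δ →
          QPReversible.nearIdentity u' v' (QPReversible.nearIdentity u v (ξ, η)) = (ξ, η) ∧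
          QPReversible.nearIdentity u v (QPReversible.nearIdentity u' v' (ξ, η)) = (ξ, η)) ∧
        -- `M ∘ U = U ∘ (I + β)` and `U⁻¹ ∘ M ∘ U = I + β`
        (∀ ξ η : ℝ, |η| < δ →
          QPReversible.mapM γ₀ f g (QPReversible.nearIdentity u v (ξ, η)) =
              QPReversible.nearIdentity u v (QPReversible.rotation γ₀ (ξ, η)) ∧
          QPReversible.nearIdentity u' v'
              (QPReversible.mapM γ₀ f g (QPReversible.nearIdentity u v (ξ, η))) =
            QPReversible.rotation γ₀ (ξ, η)) ∧
        -- `U ∘ G = G ∘ U`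
        (∀ ξ η : ℝ, |η| < δ →
          QPReversible.nearIdentity u v (QPReversible.involution (ξ, η)) =
            QPReversible.involution (QPReversible.nearIdentity u v (ξ, η))) ∧
        -- the curves `U (ℝ × {η})` are invariant under `M`
        (∀ η : ℝ, |η| < δ →
          QPReversible.mapM γ₀ f g ''
              Set.range (fun ξ : ℝ => QPReversible.nearIdentity u v (ξ, η)) =
            Set.range (fun ξ : ℝ => QPReversible.nearIdentity u v (ξ, η))) := by

  have hsd := hdioph.smallDivisors hc₀
  obtain ⟨p, q, hpq, hlin⟩ := hformal
  obtain ⟨V, hV, hMV⟩ := QPReversible.exists_qpDiffeo_conjugacy hsd hf hg hf0 hg0 hpq hlin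
  obtain ⟨W, hW, hMW, hW0⟩ := hV.normalize hsd.ne_one hMV
  have hGW := QPReversible.commute_involution hsd.ne_one hrev hW.1 hMW hW0
  obtain ⟨W', hW', hl, hr⟩ := hW.symm
  -- The last condition is `W' ∘ W = id` at the rotated point, which turns `M ∘ W = W ∘ R` into `W'
  -- ∘ M ∘ W = R`.
  obtain ⟨δ, hδ, h⟩ := QPReversible.eventually_nearAxis.1 (hMW.and (hGW.and (hl.and (hr.and
    ((QPReversible.tendsto_rotation γ₀).eventually hl)))))
  refine ⟨fun ξ η => (W (ξ, η)).1 - ξ, fun ξ η => (W (ξ, η)).2 - η,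
    fun ξ η => (W' (ξ, η)).1 - ξ, fun ξ η => (W' (ξ, η)).2 - η, hW.1, hW'.1, δ, hδ, ?_⟩
  rw [← QPReversible.QPMap.eq_nearIdentity (P := W), ← QPReversible.QPMap.eq_nearIdentity (P := W')]
  refine ⟨fun ξ η hη => ⟨(h ξ η hη).2.2.1, (h ξ η hη).2.2.2.1⟩,
    fun ξ η hη => ⟨(h ξ η hη).1, ?_⟩, fun ξ η hη => (h ξ η hη).2.1, fun η hη => ?_⟩
  · rw [(h ξ η hη).1]
    exact (h ξ η hη).2.2.2.2
  · rw [← Set.range_comp]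
    have e : QPReversible.mapM γ₀ f g ∘ (fun ξ : ℝ => W (ξ, η)) =
        (fun ξ : ℝ => W (ξ, η)) ∘ fun ξ => ξ + γ₀ := funext fun ξ => (h ξ η hη).1
    rw [e]
    exact (Equiv.addRight γ₀).surjective.range_comp _
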